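/- Let $\Bbbk$ be an algebraically closed field and let $\mathscr C$ be a fiat $2$-category over $\Bbbk$ (bicategories are allowed). That is, $\mathscr C$ is $\Bbbk$-linear with $\Bbbk$-bilinear horizontal composition; it has finitely many objects; each $\mathscr C(\mathtt i,\mathtt j)$ is finitary (additive, idempotent split, with finite dimensional morphism spaces and finitely many isomorphism classes of indecomposable objects); each identity $\mathbb 1_{\mathtt i}$ is indecomposable; and $\mathscr C$ is endowed with a $\Bbbk$-linear weak equivalence ${}^*\colon\mathscr C\to\mathscr C^{\mathrm{co,op}}$, the identity on objects, such that $\mathrm F^*$ is right adjoint to $\mathrm F$ and $\mathrm F^{**}\cong\mathrm F$ for every $1$-morphism $\mathrm F$. A ($\Bbbk$-linear) $2$-representation $\mathbf M$ of $\mathscr C$ assigns to each object $\mathtt i$ a small $\Bbbk$-linear category $\mathbf M(\mathtt i)$, to each $1$-morphism a $\Bbbk$-linear functor and, $\Bbbk$-linearly, to each $2$-morphism a natural transformation, $2$-functorially (pseudofunctors are allowed). Write $\mathrm F X=\mathbf M(\mathrm F)X$. An equivalence of $2$-representations is a strong (i.e. pseudo-) natural transformation all of whose components are $\Bbbk$-linear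 equivalences of categories. $\mathbf M$ is transitive if each $\mathbf M(\mathtt i)$ is finitary and, for every $\mathtt i$ and every nonzero $X\in\mathbf M(\mathtt i)$, the $2$-subrepresentation $\mathrm{add}\{\mathrm F X\}$, where $\mathrm F$ runs over all $1$-morphisms with domain $\mathtt i$, is equivalent to $\mathbf M$. For a $\Bbbk$-linear category $\mathcal A$, the projective abelianization $\overline{\mathcal A}$ has as objects finite families of morphisms $(f_a\colon Y_a\to X)_{a=1}^n$ in $\mathcal A$. Its morphisms to $(f'_b\colon Y'_b\to X')_{b=1}^{n'}$ are the classes of tuples $(g\colon X\to X',\ h_{a,b}\colon Y_a\to Y'_b)$ with $gf_a=\sum_b f'_bh_{a,b}$ for all $a$, where two tuples are identified if the difference of their first components has the form $\sum_b f'_bq_b$ with $q_b\colon X\to Y'_b$. $\mathcal A$ embeds through empty families. The projective abelianization $\overline{\mathscr C}$ has the same objects as $\mathscr C$ and $\overline{\mathscr C}(\mathtt i,\mathtt j)=\overline{\mathscr C(\mathtt i,\mathtt j)}$; the composite $(\alpha_a\colon\mathrm G_a\to\mathrm F)_a\circ(\alpha'_b\colon\mathrm G'_b\to\mathrm F')_b$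 is the family with target $\mathrm F\mathrm F'$ consisting of all $\mathrm{id}_{\mathrm F}\circ_0\alpha'_b$ followed by all $\alpha_a\circ_0\mathrm{id}_{\mathrm F'}$. The projective abelianization $\overline{\mathbf M}$ is the $2$-representation of $\mathscr C$ with $\overline{\mathbf M}(\mathtt i)=\overline{\mathbf M(\mathtt i)}$ and componentwise action. For an algebra $1$-morphism $A\in\overline{\mathscr C}(\mathtt i,\mathtt i)$, $\mathrm{mod}_{\overline{\mathscr C}}(A)$ is the $2$-representation of $\mathscr C$ which sends $\mathtt j$ to the category of right $A$-module $1$-morphisms $X\in\overline{\mathscr C}(\mathtt i,\mathtt j)$, $X\circ A\to X$, with $\mathscr C\subset\overline{\mathscr C}$ acting by composition; $\mathrm{proj}_{\overline{\mathscr C}}(A)$ is its full part on projective objects. **Theorem.** Let $\mathbf M$ be a transitive $2$-representation of $\mathscr C$, $\mathtt i$ an object of $\mathscr C$ and $N\in\mathbf M(\mathtt i)$ a nonzero object. Then there exist an algebra $1$-morphism $A_N\in\overline{\mathscr C}(\mathtt i,\mathtt i)$ and an equivalence $\Phi\colon\overline{\mathbf M}\to\mathrm{mod}_{\overline{\mathscr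 C}}(A_N)$ of $2$-representations of $\mathscr C$ such that $\Phi(N)\cong A_N$ as right $A_N$-modules, $\mathrm{proj}_{\overline{\mathscr C}}(A_N)$ is stable under the action of $\mathscr C$, and $\Phi$ restricts to an equivalence $\Psi\colon\mathbf M\to\mathrm{proj}_{\overline{\mathscr C}}(A_N)$ of $2$-representations of $\mathscr C$. Here "restricts" means that $\Psi$ followed by the inclusion of $\mathrm{proj}_{\overline{\mathscr C}}(A_N)$ is isomorphic, through an invertible modification, to the embedding $\mathbf M\to\overline{\mathbf M}$ followed by $\Phi$. -/

import Mathlib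

open CategoryTheory Bicategory Limits

universe w v u uk

namespace FinTwoRep

section ProjAb

/-- An object of the (diagrammatic) projective abelianization of a category `𝒜`: an object `pt`
together with finitely many arrows `arr i : src i ⟶ pt`, `i < n`.  It is to be thought of as the
cokernel of `⨁ i, src i ⟶ pt`.  (One may equivalently use infinite families of arrows indexed by
the positive integers which have source `0` beyond the bound `n`.)  (The field `k` only serves to remember over which field one works.) -/
structure ProjAb (k : Type uk) (𝒜 : Type u) [Category.{v} 𝒜] where
  pt : 𝒜
  n : ℕ
  src : Fin n → 𝒜
  arr : ∀ i, src i ⟶ pt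

namespace ProjAb

variable {k : Type uk} [Field k] {𝒜 : Type u} [Category.{v} 𝒜] [Preadditive 𝒜] [Linear k 𝒜]

/-- The morphisms `Z ⟶ P.pt` of the form `∑ j, q j ≫ P.arr j`. -/
def image (P : ProjAb k 𝒜) (Z : 𝒜) : Submodule k (Z ⟶ P.pt) where
  carrier := {φ | ∃ q : ∀ j, Z ⟶ P.src j, φ = ∑ j, q j ≫ P.arr j}
  add_mem' := by
    rintro _ _ ⟨q, rfl⟩ ⟨q', rfl⟩
    exact ⟨fun j => q j + q' j, by simp [Finset.sum_add_distrib]⟩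
  zero_mem' := ⟨fun _ => 0, by simp⟩
  smul_mem' := by
    rintro c _ ⟨q, rfl⟩
    exact ⟨fun j => c • q j, by simp [Finset.smul_sum]⟩

lemma comp_arr_mem (P : ProjAb k 𝒜) {Z : 𝒜} (i : Fin P.n) (z : Z ⟶ P.src i) :
    z ≫ P.arr i ∈ P.image Z := by
  classical
  refine ⟨fun j => if h : i = j then z ≫ eqToHom (by rw [h]) else 0, ?_⟩
  rw [Finset.sum_eq_single i]
  · simp
  · intro j _ hj
    simp [Ne.symm hj]
  · simp

lemma arr_mem (P : ProjAb k 𝒜) (i : Fin P.n) : P.arr i ∈ P.image (P.src i) := by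
  simpa using P.comp_arr_mem i (𝟙 _)

lemma comp_mem (P : ProjAb k 𝒜) {Y Z : 𝒜} (y : Y ⟶ Z) {φ : Z ⟶ P.pt} (h : φ ∈ P.image Z) :
    y ≫ φ ∈ P.image Y := by
  obtain ⟨q, rfl⟩ := h
  exact ⟨fun j => y ≫ q j, by simp [Preadditive.comp_sum]⟩

/-- The morphisms `g : P.pt ⟶ Q.pt` which extend to a commutative diagram, i.e. for which there
are `h i j : P.src i ⟶ Q.src j` such that `P.arr i ≫ g = ∑ j, h i j ≫ Q.arr j` for all `i`. -/
def homSub (P Q : ProjAb k 𝒜) : Submodule k (P.pt ⟶ Q.pt) where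
  carrier := {g | ∀ i, P.arr i ≫ g ∈ Q.image (P.src i)}
  add_mem' := by
    intro a b ha hb i
    rw [Preadditive.comp_add]
    exact Submodule.add_mem _ (ha i) (hb i)
  zero_mem' := by
    intro i
    rw [comp_zero]
    exact Submodule.zero_mem _
  smul_mem' := by
    intro c a ha i
    rw [Linear.comp_smul]
    exact Submodule.smul_mem _ c (ha i)

lemma mem_homSub {P Q : ProjAb k 𝒜} {g : P.pt ⟶ Q.pt} :
    g ∈ homSub P Q ↔ ∃ h : ∀ i j, P.src i ⟶ Q.src j,
      ∀ i, P.arr i ≫ g = ∑ j, h i j ≫ Q.arr j :=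
  ⟨fun H => ⟨fun i => (H i).choose, fun i => (H i).choose_spec⟩, fun ⟨h, H⟩ i => ⟨h i, H i⟩⟩

lemma comp_mem_image {P Q : ProjAb k 𝒜} {Z : 𝒜} {φ : Z ⟶ P.pt} (h : φ ∈ P.image Z)
    {g : P.pt ⟶ Q.pt} (hg : g ∈ homSub P Q) : φ ≫ g ∈ Q.image Z := by
  obtain ⟨q, rfl⟩ := h
  rw [Preadditive.sum_comp]
  refine Submodule.sum_mem _ fun j _ => ?_
  rw [Category.assoc]
  exact Q.comp_mem _ (hg j)

lemma id_mem (P : ProjAb k 𝒜) : 𝟙 P.pt ∈ homSub P P := fun i => by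
  rw [Category.comp_id]; exact P.arr_mem i

lemma comp_mem_homSub {P Q R : ProjAb k 𝒜} {g : P.pt ⟶ Q.pt} {g' : Q.pt ⟶ R.pt}
    (hg : g ∈ homSub P Q) (hg' : g' ∈ homSub Q R) : g ≫ g' ∈ homSub P R := fun i => by
  rw [← Category.assoc]; exact comp_mem_image (hg i) hg'

/-- The null-homotopic morphisms: those `g` for which there are `q j : P.pt ⟶ Q.src j` with
`g = ∑ j, q j ≫ Q.arr j`. -/
def nullSub (P Q : ProjAb k 𝒜) : Submodule k (homSub P Q) :=
  (Q.image P.pt).comap (homSub P Q).subtype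

/-- Morphisms in the projective abelianization: diagrams `(g, h)` modulo null-homotopic ones.
The class of a diagram `(g, h)` only depends on `g`, so that only the existence of the
components `h` is recorded. -/
def Hom (P Q : ProjAb k 𝒜) : Type v := homSub P Q ⧸ nullSub P Q

instance (P Q : ProjAb k 𝒜) : AddCommGroup (Hom P Q) :=
  inferInstanceAs (AddCommGroup (homSub P Q ⧸ nullSub P Q))

instance (P Q : ProjAb k 𝒜) : Module k (Hom P Q) :=
  inferInstanceAs (Module k (homSub P Q ⧸ nullSub P Q))

/-- The class of a morphism `g : P.pt ⟶ Q.pt` that extends to a commutative diagram. -/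
def cls {P Q : ProjAb k 𝒜} (g : P.pt ⟶ Q.pt) (hg : g ∈ homSub P Q) : Hom P Q :=
  Submodule.Quotient.mk (p := nullSub P Q) ⟨g, hg⟩

lemma cls_eq_iff {P Q : ProjAb k 𝒜} {g g' : P.pt ⟶ Q.pt} (hg : g ∈ homSub P Q)
    (hg' : g' ∈ homSub P Q) : cls g hg = cls g' hg' ↔ g - g' ∈ Q.image P.pt :=
  Submodule.Quotient.eq (nullSub P Q)

lemma cls_surj {P Q : ProjAb k 𝒜} (x : Hom P Q) : ∃ g hg, x = cls g hg := by
  obtain ⟨⟨g, hg⟩, rfl⟩ := Submodule.Quotient.mk_surjective (nullSub P Q) x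
  exact ⟨g, hg, rfl⟩

lemma cls_congr {P Q : ProjAb k 𝒜} {g g' : P.pt ⟶ Q.pt} {hg : g ∈ homSub P Q}
    {hg' : g' ∈ homSub P Q} (h : g = g') : cls g hg = cls g' hg' := by
  subst h; rfl

/-- Morphisms out of the `Hom` type, defined on representatives. -/
def lift {P Q : ProjAb k 𝒜} {T : Type*} (F : ∀ g : P.pt ⟶ Q.pt, g ∈ homSub P Q → T)
    (hF : ∀ g g' hg hg', g - g' ∈ Q.image P.pt → F g hg = F g' hg') : Hom P Q → T :=
  Quotient.lift (s := (nullSub P Q).quotientRel) (fun x : homSub P Q => F x.1 x.2)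
    (fun _ _ h => hF _ _ _ _ ((Submodule.quotientRel_def (nullSub P Q)).1 h))

lemma lift_cls {P Q : ProjAb k 𝒜} {T : Type*} (F : ∀ g : P.pt ⟶ Q.pt, g ∈ homSub P Q → T)
    (hF : ∀ g g' hg hg', g - g' ∈ Q.image P.pt → F g hg = F g' hg') (g : P.pt ⟶ Q.pt)
    (hg : g ∈ homSub P Q) : lift F hF (cls g hg) = F g hg := rfl

instance : Category.{v} (ProjAb k 𝒜) where
  Hom P Q := Hom P Q
  id P := cls (𝟙 P.pt) P.id_mem
  comp {P Q R} x y := lift (fun g hg => lift (fun g' hg' => cls (g ≫ g') (comp_mem_homSub hg hg'))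
      (fun g₁ g₂ h₁ h₂ h => (cls_eq_iff _ _).2 (by
        rw [← Preadditive.comp_sub]; exact R.comp_mem _ h)) y)
    (fun g₁ g₂ h₁ h₂ h => by
      obtain ⟨g', hg', rfl⟩ := cls_surj y
      exact (cls_eq_iff _ _).2 (by rw [← Preadditive.sub_comp]; exact comp_mem_image h hg')) x
  id_comp x := by
    obtain ⟨g, hg, rfl⟩ := cls_surj x
    exact cls_congr (Category.id_comp g)
  comp_id x := by
    obtain ⟨g, hg, rfl⟩ := cls_surj x
    exact cls_congr (Category.comp_id g)
  assoc x y z := by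
    obtain ⟨g, hg, rfl⟩ := cls_surj x
    obtain ⟨g', hg', rfl⟩ := cls_surj y
    obtain ⟨g'', hg'', rfl⟩ := cls_surj z
    exact cls_congr (Category.assoc g g' g'')

/-- The morphism of the projective abelianization represented by `g`. -/
def homMk {P Q : ProjAb k 𝒜} (g : P.pt ⟶ Q.pt) (hg : g ∈ homSub P Q) : P ⟶ Q := cls g hg

lemma homMk_eq_iff {P Q : ProjAb k 𝒜} {g g' : P.pt ⟶ Q.pt} (hg : g ∈ homSub P Q)
    (hg' : g' ∈ homSub P Q) : homMk g hg = homMk g' hg' ↔ g - g' ∈ Q.image P.pt :=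
  cls_eq_iff hg hg'

lemma homMk_congr {P Q : ProjAb k 𝒜} {g g' : P.pt ⟶ Q.pt} {hg : g ∈ homSub P Q}
    {hg' : g' ∈ homSub P Q} (h : g = g') : homMk g hg = homMk g' hg' := cls_congr h

lemma homMk_surj {P Q : ProjAb k 𝒜} (x : P ⟶ Q) : ∃ g hg, x = homMk g hg := cls_surj x

lemma id_eq (P : ProjAb k 𝒜) : 𝟙 P = homMk (𝟙 P.pt) P.id_mem := rfl

lemma homMk_comp {P Q R : ProjAb k 𝒜} {g : P.pt ⟶ Q.pt} {g' : Q.pt ⟶ R.pt}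
    (hg : g ∈ homSub P Q) (hg' : g' ∈ homSub Q R) :
    homMk g hg ≫ homMk g' hg' = homMk (g ≫ g') (comp_mem_homSub hg hg') := rfl

instance : Preadditive (ProjAb k 𝒜) where
  homGroup P Q := inferInstanceAs (AddCommGroup (Hom P Q))
  add_comp P Q R x y z := by
    obtain ⟨g, hg, rfl⟩ := cls_surj x
    obtain ⟨g', hg', rfl⟩ := cls_surj y
    obtain ⟨g'', hg'', rfl⟩ := cls_surj z
    exact cls_congr (Preadditive.add_comp _ _ _ g g' g'')
  comp_add P Q R x y z := by
    obtain ⟨g, hg, rfl⟩ := cls_surj x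
    obtain ⟨g', hg', rfl⟩ := cls_surj y
    obtain ⟨g'', hg'', rfl⟩ := cls_surj z
    exact cls_congr (Preadditive.comp_add _ _ _ g g' g'')

instance : Linear k (ProjAb k 𝒜) where
  homModule P Q := inferInstanceAs (Module k (Hom P Q))
  smul_comp P Q R c x y := by
    obtain ⟨g, hg, rfl⟩ := cls_surj x
    obtain ⟨g', hg', rfl⟩ := cls_surj y
    exact cls_congr (Linear.smul_comp _ _ _ c g g')
  comp_smul P Q R x c y := by
    obtain ⟨g, hg, rfl⟩ := cls_surj x
    obtain ⟨g', hg', rfl⟩ := cls_surj y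
    exact cls_congr (Linear.comp_smul _ _ _ g c g')

lemma homMk_add {P Q : ProjAb k 𝒜} {g g' : P.pt ⟶ Q.pt} (hg : g ∈ homSub P Q)
    (hg' : g' ∈ homSub P Q) :
    homMk g hg + homMk g' hg' = homMk (g + g') (Submodule.add_mem _ hg hg') := rfl

lemma smul_homMk {P Q : ProjAb k 𝒜} {g : P.pt ⟶ Q.pt} (hg : g ∈ homSub P Q) (c : k) :
    c • homMk g hg = homMk (c • g) (Submodule.smul_mem _ c hg) := rfl

/-- An isomorphism represented by an isomorphism of the targets. -/
def isoMk {P Q : ProjAb k 𝒜} (e : P.pt ≅ Q.pt) (h₁ : e.hom ∈ homSub P Q)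
    (h₂ : e.inv ∈ homSub Q P) : P ≅ Q where
  hom := homMk e.hom h₁
  inv := homMk e.inv h₂
  hom_inv_id := homMk_congr e.hom_inv_id
  inv_hom_id := homMk_congr e.inv_hom_id

variable (k) in
/-- An object of `𝒜` as an object of the projective abelianization (the empty family of
arrows). -/
abbrev emb (X : 𝒜) : ProjAb k 𝒜 where
  pt := X
  n := 0
  src := fun i => i.elim0
  arr := fun i => i.elim0

lemma mem_of_emb {X : 𝒜} {Q : ProjAb k 𝒜} (g : X ⟶ Q.pt) : g ∈ homSub (emb k X) Q :=
  fun i => i.elim0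

variable (k 𝒜) in
/-- The canonical embedding of `𝒜` into its projective abelianization. -/
def embFunctor : 𝒜 ⥤ ProjAb k 𝒜 where
  obj X := emb k X
  map {X Y} f := homMk (P := emb k X) (Q := emb k Y) f (mem_of_emb (Q := emb k Y) f)
  map_id _ := rfl
  map_comp _ _ := rfl

section functoriality

variable {ℬ : Type*} [Category ℬ] [Preadditive ℬ] [Linear k ℬ]

/-- The componentwise action of a functor on objects of the projective abelianization. -/
abbrev mapObj (F : 𝒜 ⥤ ℬ) (P : ProjAb k 𝒜) : ProjAb k ℬ where
  pt := F.obj P.pt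
  n := P.n
  src := fun i => F.obj (P.src i)
  arr := fun i => F.map (P.arr i)

lemma map_mem_image (F : 𝒜 ⥤ ℬ) [F.Additive] {P : ProjAb k 𝒜} {Z : 𝒜} {φ : Z ⟶ P.pt}
    (h : φ ∈ P.image Z) : F.map φ ∈ (mapObj F P).image (F.obj Z) := by
  obtain ⟨q, rfl⟩ := h
  exact ⟨fun j => F.map (q j), by simp [F.map_sum]⟩

lemma map_mem_homSub (F : 𝒜 ⥤ ℬ) [F.Additive] {P Q : ProjAb k 𝒜} {g : P.pt ⟶ Q.pt}
    (h : g ∈ homSub P Q) : F.map g ∈ homSub (mapObj F P) (mapObj F Q) := fun i => by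
  have := map_mem_image F (h i)
  rwa [F.map_comp] at this

variable (k) in
/-- The componentwise action of an additive functor on projective abelianizations. -/
def mapFunctor (F : 𝒜 ⥤ ℬ) [F.Additive] : ProjAb k 𝒜 ⥤ ProjAb k ℬ where
  obj P := mapObj F P
  map {P Q} := lift (P := P) (Q := Q)
    (fun g hg => homMk (P := mapObj F P) (Q := mapObj F Q) (F.map g) (map_mem_homSub F hg))
    (fun g g' hg hg' h => (homMk_eq_iff _ _).2 (by
      rw [← F.map_sub]; exact map_mem_image F h))
  map_id P := homMk_congr (P := mapObj F P) (Q := mapObj F P) (F.map_id _)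
  map_comp x y := by
    obtain ⟨g, hg, rfl⟩ := homMk_surj x
    obtain ⟨g', hg', rfl⟩ := homMk_surj y
    exact homMk_congr (P := mapObj F _) (Q := mapObj F _) (F.map_comp g g')

lemma mapFunctor_map_homMk (F : 𝒜 ⥤ ℬ) [F.Additive] {P Q : ProjAb k 𝒜} (g : P.pt ⟶ Q.pt)
    (hg : g ∈ homSub P Q) :
    (mapFunctor k F).map (homMk g hg) =
      homMk (P := mapObj F P) (Q := mapObj F Q) (F.map g) (map_mem_homSub F hg) := rfl

set_option linter.unusedSectionVars false in
lemma app_mem {F G : 𝒜 ⥤ ℬ} (α : F ⟶ G) (P : ProjAb k 𝒜) :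
    α.app P.pt ∈ homSub (mapObj F P) (mapObj G P) := fun i => by
  have : (mapObj F P).arr i ≫ α.app P.pt = α.app (P.src i) ≫ (mapObj G P).arr i :=
    α.naturality (P.arr i)
  rw [this]
  exact comp_arr_mem (mapObj G P) i (α.app (P.src i))

variable (k) in
/-- The componentwise action of a natural transformation on projective abelianizations. -/
def mapNatTrans {F G : 𝒜 ⥤ ℬ} [F.Additive] [G.Additive] (α : F ⟶ G) :
    mapFunctor k F ⟶ mapFunctor k G where
  app P := homMk (P := mapObj F P) (Q := mapObj G P) (α.app P.pt) (app_mem α P)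
  naturality P Q x := by
    obtain ⟨g, hg, rfl⟩ := homMk_surj x
    exact homMk_congr (P := mapObj F P) (Q := mapObj G Q) (α.naturality g)

end functoriality

end ProjAb

end ProjAb


section LinearBicategory

/-- A bicategory enriched in preadditive categories: `2`-morphisms can be added, and vertical and
horizontal composition are biadditive. -/
class PreadditiveBicategory (C : Type u) [Bicategory.{w, v} C] where
  homPreadditive : ∀ a b : C, Preadditive (a ⟶ b)
  whiskerLeft_add : ∀ {a b c : C} (f : a ⟶ b) {g h : b ⟶ c} (η θ : g ⟶ h),
    f ◁ (η + θ) = f ◁ η + f ◁ θ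
  add_whiskerRight : ∀ {a b c : C} {f g : a ⟶ b} (η θ : f ⟶ g) (h : b ⟶ c),
    (η + θ) ▷ h = η ▷ h + θ ▷ h

attribute [reducible, instance] PreadditiveBicategory.homPreadditive

/-- A `k`-linear bicategory. -/
class LinearBicategory (k : Type uk) [Field k] (C : Type u) [Bicategory.{w, v} C]
    [PreadditiveBicategory C] where
  homLinear : ∀ a b : C, Linear k (a ⟶ b)
  whiskerLeft_smul : ∀ {a b c : C} (f : a ⟶ b) {g h : b ⟶ c} (t : k) (η : g ⟶ h),
    f ◁ (t • η) = t • f ◁ η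
  smul_whiskerRight : ∀ {a b c : C} {f g : a ⟶ b} (t : k) (η : f ⟶ g) (h : b ⟶ c),
    (t • η) ▷ h = t • η ▷ h

attribute [reducible, instance] LinearBicategory.homLinear

variable {C : Type u} [Bicategory.{w, v} C] [PreadditiveBicategory C]

/-- Left whiskering as an additive map. -/
def whiskerLeftHom {a b c : C} (f : a ⟶ b) (g h : b ⟶ c) : (g ⟶ h) →+ (f ≫ g ⟶ f ≫ h) :=
  AddMonoidHom.mk' (fun η => f ◁ η) (PreadditiveBicategory.whiskerLeft_add f)

/-- Right whiskering as an additive map. -/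
def whiskerRightHom {a b c : C} (f g : a ⟶ b) (h : b ⟶ c) : (f ⟶ g) →+ (f ≫ h ⟶ g ≫ h) :=
  AddMonoidHom.mk' (fun η => η ▷ h) (fun η θ => PreadditiveBicategory.add_whiskerRight η θ h)

lemma whiskerLeft_sum {a b c : C} (f : a ⟶ b) {g h : b ⟶ c} {n : ℕ} (η : Fin n → (g ⟶ h)) :
    f ◁ (∑ i, η i) = ∑ i, f ◁ η i :=
  map_sum (whiskerLeftHom f g h) η Finset.univ

lemma sum_whiskerRight {a b c : C} {f g : a ⟶ b} (h : b ⟶ c) {n : ℕ} (η : Fin n → (f ⟶ g)) :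
    (∑ i, η i) ▷ h = ∑ i, η i ▷ h :=
  map_sum (whiskerRightHom f g h) η Finset.univ

lemma whiskerLeft_sub {a b c : C} (f : a ⟶ b) {g h : b ⟶ c} (η θ : g ⟶ h) :
    f ◁ (η - θ) = f ◁ η - f ◁ θ :=
  map_sub (whiskerLeftHom f g h) η θ

lemma sub_whiskerRight {a b c : C} {f g : a ⟶ b} (η θ : f ⟶ g) (h : b ⟶ c) :
    (η - θ) ▷ h = η ▷ h - θ ▷ h :=
  map_sub (whiskerRightHom f g h) η θ

end LinearBicategory

section ProjAbBicategory

/-- The (diagrammatic) projective abelianization `C̄` of a `k`-linear bicategory `C`.  It has the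
same objects as `C`. -/
structure AbBicat (k : Type uk) (C : Type u) where
  as : C

namespace AbBicat

variable {k : Type uk} [Field k] {C : Type u} [Bicategory.{w, v} C] [PreadditiveBicategory C]
  [LinearBicategory k C]

section comp

variable {a b c : C} (P : ProjAb k (a ⟶ b)) (Q : ProjAb k (b ⟶ c))

/-- The sources of the arrows of the composite `1`-morphism, indexed by a disjoint union. -/
abbrev compSrc : Fin P.n ⊕ Fin Q.n → (a ⟶ c)
  | .inl i => P.src i ≫ Q.pt
  | .inr j => P.pt ≫ Q.src j

/-- The arrows of the composite `1`-morphism, indexed by a disjoint union. -/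
abbrev compArr : ∀ s : Fin P.n ⊕ Fin Q.n, compSrc P Q s ⟶ P.pt ≫ Q.pt
  | .inl i => P.arr i ▷ Q.pt
  | .inr j => P.pt ◁ Q.arr j

/-- The composition of `1`-morphisms of the projective abelianization: the target is the composite
of the targets, and the arrows are first the arrows of `P` composed with the target of `Q`, then
the arrows of `Q` composed with the target of `P`. -/
abbrev comp : ProjAb k (a ⟶ c) where
  pt := P.pt ≫ Q.pt
  n := P.n + Q.n
  src := fun i => compSrc P Q (finSumFinEquiv.symm i)
  arr := fun i => compArr P Q (finSumFinEquiv.symm i)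

lemma compArr_mem (s : Fin P.n ⊕ Fin Q.n) :
    compArr P Q s ∈ (comp P Q).image (compSrc P Q s) := by
  obtain ⟨i, rfl⟩ := finSumFinEquiv.symm.surjective s
  exact (comp P Q).arr_mem i

variable {P Q}

lemma left_mem {x : a ⟶ b} {φ : x ⟶ P.pt} (h : φ ∈ P.image x) :
    φ ▷ Q.pt ∈ (comp P Q).image (x ≫ Q.pt) := by
  obtain ⟨q, rfl⟩ := h
  rw [sum_whiskerRight]
  refine Submodule.sum_mem _ fun i _ => ?_
  rw [Bicategory.comp_whiskerRight]
  exact ProjAb.comp_mem _ _ (compArr_mem P Q (.inl i))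

lemma right_mem {x : b ⟶ c} {φ : x ⟶ Q.pt} (h : φ ∈ Q.image x) :
    P.pt ◁ φ ∈ (comp P Q).image (P.pt ≫ x) := by
  obtain ⟨q, rfl⟩ := h
  rw [whiskerLeft_sum]
  refine Submodule.sum_mem _ fun i _ => ?_
  rw [Bicategory.whiskerLeft_comp]
  exact ProjAb.comp_mem _ _ (compArr_mem P Q (.inr i))

lemma mem_homSub_comp {R : ProjAb k (a ⟶ c)} {g : P.pt ≫ Q.pt ⟶ R.pt}
    (h₁ : ∀ i, P.arr i ▷ Q.pt ≫ g ∈ R.image (P.src i ≫ Q.pt))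
    (h₂ : ∀ j, P.pt ◁ Q.arr j ≫ g ∈ R.image (P.pt ≫ Q.src j)) :
    g ∈ ProjAb.homSub (comp P Q) R := by
  have key : ∀ s, compArr P Q s ≫ g ∈ R.image (compSrc P Q s) := by
    rintro (i | j)
    · exact h₁ i
    · exact h₂ j
  exact fun i => key _

lemma whiskerLeft_mem (P : ProjAb k (a ⟶ b)) {Q Q' : ProjAb k (b ⟶ c)} {g : Q.pt ⟶ Q'.pt}
    (hg : g ∈ ProjAb.homSub Q Q') : P.pt ◁ g ∈ ProjAb.homSub (comp P Q) (comp P Q') := by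
  refine mem_homSub_comp (fun i => ?_) (fun j => ?_)
  · rw [← whisker_exchange]
    exact ProjAb.comp_mem _ _ (compArr_mem P Q' (.inl i))
  · rw [← Bicategory.whiskerLeft_comp]
    exact right_mem (hg j)

lemma whiskerRight_mem {P P' : ProjAb k (a ⟶ b)} {g : P.pt ⟶ P'.pt}
    (hg : g ∈ ProjAb.homSub P P') (Q : ProjAb k (b ⟶ c)) :
    g ▷ Q.pt ∈ ProjAb.homSub (comp P Q) (comp P' Q) := by
  refine mem_homSub_comp (fun i => ?_) (fun j => ?_)
  · rw [← Bicategory.comp_whiskerRight]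
    exact left_mem (hg i)
  · rw [whisker_exchange]
    exact ProjAb.comp_mem _ _ (compArr_mem P' Q (.inr j))

/-- Left horizontal multiplication, on representatives. -/
def whiskerLeft (P : ProjAb k (a ⟶ b)) {Q Q' : ProjAb k (b ⟶ c)} (x : Q ⟶ Q') :
    comp P Q ⟶ comp P Q' :=
  ProjAb.lift (fun g hg => ProjAb.homMk (P := comp P Q) (Q := comp P Q') (P.pt ◁ g)
      (whiskerLeft_mem P hg))
    (fun g g' hg hg' h => (ProjAb.homMk_eq_iff _ _).2 (by
      rw [← whiskerLeft_sub]; exact right_mem h)) x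

/-- Right horizontal multiplication, on representatives. -/
def whiskerRight {P P' : ProjAb k (a ⟶ b)} (x : P ⟶ P') (Q : ProjAb k (b ⟶ c)) :
    comp P Q ⟶ comp P' Q :=
  ProjAb.lift (fun g hg => ProjAb.homMk (P := comp P Q) (Q := comp P' Q) (g ▷ Q.pt)
      (whiskerRight_mem hg Q))
    (fun g g' hg hg' h => (ProjAb.homMk_eq_iff _ _).2 (by
      rw [← sub_whiskerRight]; exact left_mem h)) x

end comp

/-- The isomorphism between the two ways of composing three `1`-morphisms. -/
def assocIso {a b c d : C} (P : ProjAb k (a ⟶ b)) (Q : ProjAb k (b ⟶ c))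
    (R : ProjAb k (c ⟶ d)) : comp (comp P Q) R ≅ comp P (comp Q R) :=
  ProjAb.isoMk (P := comp (comp P Q) R) (Q := comp P (comp Q R)) (α_ P.pt Q.pt R.pt)
    (by
      refine mem_homSub_comp (fun i => ?_) (fun j => ?_)
      · have key : ∀ s, compArr P Q s ▷ R.pt ≫ (α_ P.pt Q.pt R.pt).hom ∈
            (comp P (comp Q R)).image (compSrc P Q s ≫ R.pt) := by
          rintro (i | j)
          · rw [associator_naturality_left]
            exact ProjAb.comp_mem _ _ (compArr_mem P (comp Q R) (.inl i))
          · rw [associator_naturality_middle]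
            exact ProjAb.comp_mem _ _ (right_mem (compArr_mem Q R (.inl j)))
        exact key _
      · rw [associator_naturality_right]
        exact ProjAb.comp_mem _ _ (right_mem (compArr_mem Q R (.inr j))))
    (by
      refine mem_homSub_comp (fun i => ?_) (fun j => ?_)
      · rw [associator_inv_naturality_left]
        exact ProjAb.comp_mem _ _ (left_mem (compArr_mem P Q (.inl i)))
      · have key : ∀ s, P.pt ◁ compArr Q R s ≫ (α_ P.pt Q.pt R.pt).inv ∈
            (comp (comp P Q) R).image (P.pt ≫ compSrc Q R s) := by
          rintro (i | j)
          · rw [associator_inv_naturality_middle]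
            exact ProjAb.comp_mem _ _ (left_mem (compArr_mem P Q (.inr i)))
          · rw [associator_inv_naturality_right]
            exact ProjAb.comp_mem _ _ (compArr_mem (comp P Q) R (.inr j))
        exact key _)

/-- The left unit isomorphism. -/
def leftUnitIso {a b : C} (P : ProjAb k (a ⟶ b)) : comp (ProjAb.emb k (𝟙 a)) P ≅ P :=
  ProjAb.isoMk (P := comp (ProjAb.emb k (𝟙 a)) P) (Q := P) (λ_ P.pt)
    (mem_homSub_comp (fun i => i.elim0) (fun j => by
      rw [leftUnitor_naturality]
      exact ProjAb.comp_mem _ _ (P.arr_mem j)))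
    (fun j => by
      rw [leftUnitor_inv_naturality]
      exact ProjAb.comp_mem _ _ (right_mem (P := ProjAb.emb k (𝟙 a)) (P.arr_mem j)))

/-- The right unit isomorphism. -/
def rightUnitIso {a b : C} (P : ProjAb k (a ⟶ b)) : comp P (ProjAb.emb k (𝟙 b)) ≅ P :=
  ProjAb.isoMk (P := comp P (ProjAb.emb k (𝟙 b))) (Q := P) (ρ_ P.pt)
    (mem_homSub_comp (fun j => by
      rw [rightUnitor_naturality]
      exact ProjAb.comp_mem _ _ (P.arr_mem j)) (fun i => i.elim0))
    (fun j => by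
      rw [rightUnitor_inv_naturality]
      exact ProjAb.comp_mem _ _ (left_mem (Q := ProjAb.emb k (𝟙 b)) (P.arr_mem j)))

instance : Bicategory (AbBicat k C) where
  Hom a b := ProjAb k (a.as ⟶ b.as)
  id a := ProjAb.emb k (𝟙 a.as)
  comp P Q := comp P Q
  homCategory a b := inferInstanceAs (Category (ProjAb k (a.as ⟶ b.as)))
  whiskerLeft P _ _ x := whiskerLeft P x
  whiskerRight x Q := whiskerRight x Q
  associator P Q R := assocIso P Q R
  leftUnitor P := leftUnitIso P
  rightUnitor P := rightUnitIso P
  whiskerLeft_id P Q := ProjAb.homMk_congr (Bicategory.whiskerLeft_id _ _)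
  whiskerLeft_comp P Q R S x y := by
    obtain ⟨g, hg, rfl⟩ := ProjAb.homMk_surj x
    obtain ⟨g', hg', rfl⟩ := ProjAb.homMk_surj y
    exact ProjAb.homMk_congr (Bicategory.whiskerLeft_comp _ _ _)
  id_whiskerLeft x := by
    obtain ⟨g, hg, rfl⟩ := ProjAb.homMk_surj x
    exact ProjAb.homMk_congr (Bicategory.id_whiskerLeft _)
  comp_whiskerLeft P Q _ _ x := by
    obtain ⟨g, hg, rfl⟩ := ProjAb.homMk_surj x
    exact ProjAb.homMk_congr (Bicategory.comp_whiskerLeft _ _ _)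
  id_whiskerRight P Q := ProjAb.homMk_congr (Bicategory.id_whiskerRight _ _)
  comp_whiskerRight x y Q := by
    obtain ⟨g, hg, rfl⟩ := ProjAb.homMk_surj x
    obtain ⟨g', hg', rfl⟩ := ProjAb.homMk_surj y
    exact ProjAb.homMk_congr (Bicategory.comp_whiskerRight _ _ _)
  whiskerRight_id x := by
    obtain ⟨g, hg, rfl⟩ := ProjAb.homMk_surj x
    exact ProjAb.homMk_congr (Bicategory.whiskerRight_id _)
  whiskerRight_comp x P Q := by
    obtain ⟨g, hg, rfl⟩ := ProjAb.homMk_surj x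
    exact ProjAb.homMk_congr (Bicategory.whiskerRight_comp _ _ _)
  whisker_assoc P _ _ x Q := by
    obtain ⟨g, hg, rfl⟩ := ProjAb.homMk_surj x
    exact ProjAb.homMk_congr (Bicategory.whisker_assoc _ _ _)
  whisker_exchange x y := by
    obtain ⟨g, hg, rfl⟩ := ProjAb.homMk_surj x
    obtain ⟨g', hg', rfl⟩ := ProjAb.homMk_surj y
    exact ProjAb.homMk_congr (Bicategory.whisker_exchange _ _)
  pentagon P Q R S := ProjAb.homMk_congr (Bicategory.pentagon _ _ _ _)
  triangle P Q := ProjAb.homMk_congr (Bicategory.triangle _ _)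

instance : PreadditiveBicategory (AbBicat k C) where
  homPreadditive a b := inferInstanceAs (Preadditive (ProjAb k (a.as ⟶ b.as)))
  whiskerLeft_add P _ _ x y := by
    obtain ⟨g, hg, rfl⟩ := ProjAb.homMk_surj x
    obtain ⟨g', hg', rfl⟩ := ProjAb.homMk_surj y
    exact ProjAb.homMk_congr (PreadditiveBicategory.whiskerLeft_add _ _ _)
  add_whiskerRight x y P := by
    obtain ⟨g, hg, rfl⟩ := ProjAb.homMk_surj x
    obtain ⟨g', hg', rfl⟩ := ProjAb.homMk_surj y
    exact ProjAb.homMk_congr (PreadditiveBicategory.add_whiskerRight _ _ _)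

instance : LinearBicategory k (AbBicat k C) where
  homLinear a b := inferInstanceAs (Linear k (ProjAb k (a.as ⟶ b.as)))
  whiskerLeft_smul P _ _ t x := by
    obtain ⟨g, hg, rfl⟩ := ProjAb.homMk_surj x
    exact ProjAb.homMk_congr (LinearBicategory.whiskerLeft_smul _ t _)
  smul_whiskerRight t x P := by
    obtain ⟨g, hg, rfl⟩ := ProjAb.homMk_surj x
    exact ProjAb.homMk_congr (LinearBicategory.smul_whiskerRight t _ _)

/-- The composite of two embedded `1`-morphisms is the embedded composite (up to identifying two
empty families of arrows). -/
def embComp {a b c : C} (f : a ⟶ b) (g : b ⟶ c) :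
    ProjAb.emb k (f ≫ g) ≅ comp (ProjAb.emb k f) (ProjAb.emb k g) :=
  ProjAb.isoMk (P := ProjAb.emb k (f ≫ g)) (Q := comp (ProjAb.emb k f) (ProjAb.emb k g))
    (Iso.refl _) (fun i => i.elim0)
    (mem_homSub_comp (fun i => i.elim0) (fun i => i.elim0))

variable (k C) in
/-- The canonical embedding of a bicategory into its projective abelianization. -/
def embed : Pseudofunctor C (AbBicat k C) where
  obj a := ⟨a⟩
  map {a b} f := ProjAb.emb k f
  map₂ {a b f g} η := (ProjAb.embFunctor k (a ⟶ b)).map η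
  map₂_id _ := rfl
  map₂_comp _ _ := rfl
  mapId a := Iso.refl _
  mapComp f g := embComp f g
  map₂_whisker_left {a b c} f g h η := ProjAb.homMk_congr
    (show f ◁ η = 𝟙 (f ≫ g) ≫ f ◁ η ≫ 𝟙 (f ≫ h) by simp)
  map₂_whisker_right {a b c f g} η h := ProjAb.homMk_congr
    (show η ▷ h = 𝟙 (f ≫ h) ≫ η ▷ h ≫ 𝟙 (g ≫ h) by simp)
  map₂_associator f g h := ProjAb.homMk_congr
    (show (α_ f g h).hom = 𝟙 ((f ≫ g) ≫ h) ≫ 𝟙 (f ≫ g) ▷ h ≫ (α_ f g h).hom ≫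
      f ◁ 𝟙 (g ≫ h) ≫ 𝟙 (f ≫ g ≫ h) by simp)
  map₂_left_unitor {a b} f := ProjAb.homMk_congr
    (show (λ_ f).hom = 𝟙 (𝟙 a ≫ f) ≫ 𝟙 (𝟙 a) ▷ f ≫ (λ_ f).hom by simp)
  map₂_right_unitor {a b} f := ProjAb.homMk_congr
    (show (ρ_ f).hom = 𝟙 (f ≫ 𝟙 b) ≫ f ◁ 𝟙 (𝟙 b) ≫ (ρ_ f).hom by simp)

end AbBicat

end ProjAbBicategory

section Finitary

/-- A finitary `k`-linear category: additive, idempotent split, with finite dimensional spaces of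
morphisms and finitely many isomorphism classes of indecomposable objects. -/
class IsFinitaryCategory (k : Type uk) [Field k] (𝒜 : Type u) [Category.{v} 𝒜] [Preadditive 𝒜]
    [Linear k 𝒜] : Prop where
  hasFiniteBiproducts : HasFiniteBiproducts 𝒜
  isIdempotentComplete : IsIdempotentComplete 𝒜
  finiteDimensional_hom : ∀ X Y : 𝒜, FiniteDimensional k (X ⟶ Y)
  finite_indecomposables :
    haveI := hasBinaryBiproducts_of_finite_biproducts 𝒜
    ∃ (n : ℕ) (I : Fin n → 𝒜), ∀ X : 𝒜, Indecomposable X → ∃ a, Nonempty (X ≅ I a)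

/-- A finitary `k`-linear `2`-category: finitely many objects, finitary categories of
`1`-morphisms, and indecomposable identity `1`-morphisms. -/
class IsFinitaryBicategory (k : Type uk) [Field k] (C : Type u) [Bicategory.{w, v} C]
    [PreadditiveBicategory C] [LinearBicategory k C] : Prop where
  finite_objects : Finite C
  finitary_hom : ∀ a b : C, IsFinitaryCategory k (a ⟶ b)
  indecomposable_id : ∀ a : C,
    haveI := (finitary_hom a a).hasFiniteBiproducts
    haveI := hasBinaryBiproducts_of_finite_biproducts (a ⟶ a)
    Indecomposable (𝟙 a)

/-- The structure of a fiat `2`-category on a `k`-linear bicategory `C`: a `k`-linear weak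
equivalence `C ⟶ C^{co,op}` which is the identity on objects, is weakly involutive, and sends
every `1`-morphism to a right adjoint of it.  Of the weak involutivity, only the existence of
isomorphisms `f^{**} ≅ f` is required, without naturality or coherence in `f`.

The weak equivalence is given by the contravariant functors `star a b` between categories of
`1`-morphisms, which are equivalences, together with coherent isomorphisms
`(𝟙 a)^* ≅ 𝟙 a` and `(f ≫ g)^* ≅ g^* ≫ f^*`. -/
structure FiatStructure (k : Type uk) [Field k] (C : Type u) [Bicategory.{w, v} C]
    [PreadditiveBicategory C] [LinearBicategory k C] where
  star : ∀ a b : C, (a ⟶ b)ᵒᵖ ⥤ (b ⟶ a)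
  star_isEquivalence : ∀ a b : C, (star a b).IsEquivalence
  star_add : ∀ {a b : C} {f g : a ⟶ b} (η θ : f ⟶ g),
    (star a b).map (η + θ).op = (star a b).map η.op + (star a b).map θ.op
  star_smul : ∀ {a b : C} {f g : a ⟶ b} (t : k) (η : f ⟶ g),
    (star a b).map (t • η).op = t • (star a b).map η.op
  starId : ∀ a : C, (star a a).obj (.op (𝟙 a)) ≅ 𝟙 a
  starComp : ∀ {a b c : C} (f : a ⟶ b) (g : b ⟶ c),
    (star a c).obj (.op (f ≫ g)) ≅ (star b c).obj (.op g) ≫ (star a b).obj (.op f)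
  star_whiskerLeft : ∀ {a b c : C} (f : a ⟶ b) {g h : b ⟶ c} (η : g ⟶ h),
    (star a c).map (f ◁ η).op ≫ (starComp f g).hom =
      (starComp f h).hom ≫ (star b c).map η.op ▷ (star a b).obj (.op f)
  star_whiskerRight : ∀ {a b c : C} {f g : a ⟶ b} (η : f ⟶ g) (h : b ⟶ c),
    (star a c).map (η ▷ h).op ≫ (starComp f h).hom =
      (starComp g h).hom ≫ (star b c).obj (.op h) ◁ (star a b).map η.op
  star_associator : ∀ {a b c d : C} (f : a ⟶ b) (g : b ⟶ c) (h : c ⟶ d),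
    (star a d).map (α_ f g h).inv.op ≫ (starComp f (g ≫ h)).hom ≫
        (starComp g h).hom ▷ (star a b).obj (.op f) ≫ (α_ _ _ _).hom =
      (starComp (f ≫ g) h).hom ≫ (star c d).obj (.op h) ◁ (starComp f g).hom
  star_leftUnitor : ∀ {a b : C} (f : a ⟶ b),
    (star a b).map (λ_ f).inv.op =
      (starComp (𝟙 a) f).hom ≫ (star a b).obj (.op f) ◁ (starId a).hom ≫ (ρ_ _).hom
  star_rightUnitor : ∀ {a b : C} (f : a ⟶ b),
    (star a b).map (ρ_ f).inv.op =
      (starComp f (𝟙 b)).hom ≫ (starId b).hom ▷ (star a b).obj (.op f) ≫ (λ_ _).hom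
  star_star : ∀ {a b : C} (f : a ⟶ b),
    Nonempty ((star b a).obj (.op ((star a b).obj (.op f))) ≅ f)
  adjunction : ∀ {a b : C} (f : a ⟶ b), Nonempty (Bicategory.Adjunction f ((star a b).obj (.op f)))

end Finitary

section TwoRep

/-- A `k`-linear `2`-representation of a `k`-linear bicategory: a pseudofunctor to categories with
values in `k`-linear categories and `k`-linear functors, and `k`-linear on `2`-morphisms. -/
structure TwoRep (k : Type uk) [Field k] (C : Type u) [Bicategory.{w, v} C]
    [PreadditiveBicategory C] [LinearBicategory k C] where
  toPseudo : Pseudofunctor C Cat.{w, max v w}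
  preadditive : ∀ a, Preadditive (toPseudo.obj a)
  linear : ∀ a, Linear k (toPseudo.obj a)
  additive_map : ∀ {a b : C} (f : a ⟶ b), (toPseudo.map f).toFunctor.Additive
  linear_map : ∀ {a b : C} (f : a ⟶ b), (toPseudo.map f).toFunctor.Linear k
  map₂_add : ∀ {a b : C} {f g : a ⟶ b} (η θ : f ⟶ g) (X : toPseudo.obj a),
    (toPseudo.map₂ (η + θ)).toNatTrans.app X =
      (toPseudo.map₂ η).toNatTrans.app X + (toPseudo.map₂ θ).toNatTrans.app X
  map₂_smul : ∀ {a b : C} {f g : a ⟶ b} (t : k) (η : f ⟶ g) (X : toPseudo.obj a),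
    (toPseudo.map₂ (t • η)).toNatTrans.app X = t • (toPseudo.map₂ η).toNatTrans.app X

attribute [instance] TwoRep.preadditive TwoRep.linear
attribute [instance] TwoRep.additive_map TwoRep.linear_map

namespace TwoRep

open scoped Pseudofunctor.StrongTrans

variable {k : Type uk} [Field k] {C : Type u} [Bicategory.{w, v} C] [PreadditiveBicategory C]
  [LinearBicategory k C]

/-- An equivalence of `2`-representations: a (strong) natural transformation, with `k`-linear
components, all of which are equivalences of categories. -/
structure Equivalence (M N : TwoRep k C) where
  trans : M.toPseudo ⟶ N.toPseudo
  additive : ∀ a, (trans.app a).toFunctor.Additive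
  linear : ∀ a, (trans.app a).toFunctor.Linear k
  isEquivalence : ∀ a, (trans.app a).toFunctor.IsEquivalence

/-- A finitary `2`-representation. -/
def IsFinitary (M : TwoRep k C) : Prop := ∀ a, IsFinitaryCategory k (M.toPseudo.obj a)

instance fullPreadditive (M : TwoRep k C) (P : M.toPseudo.ObjectProperty)
    [P.IsClosedUnderMapObj] (a : C) : Preadditive (P.fullsubcategory.obj a) :=
  inferInstanceAs (Preadditive (P.prop a).FullSubcategory)

instance fullLinear (M : TwoRep k C) (P : M.toPseudo.ObjectProperty)
    [P.IsClosedUnderMapObj] (a : C) : Linear k (P.fullsubcategory.obj a) :=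
  inferInstanceAs (Linear k (P.prop a).FullSubcategory)

/-- The full `2`-subrepresentation on a class of objects that is stable under the action. -/
def full (M : TwoRep k C) (P : M.toPseudo.ObjectProperty) [P.IsClosedUnderMapObj] :
    TwoRep k C where
  toPseudo := P.fullsubcategory
  preadditive a := fullPreadditive M P a
  linear a := fullLinear M P a
  additive_map {a b} f :=
    { map_add := by
        intro X Y x y
        apply ObjectProperty.hom_ext
        exact (M.toPseudo.map f).toFunctor.map_add }
  linear_map {a b} f :=
    { map_smul := by
        intro X Y x t
        apply ObjectProperty.hom_ext
        exact (M.toPseudo.map f).toFunctor.map_smul _ _ }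
  map₂_add η θ X := by
    apply ObjectProperty.hom_ext
    exact M.map₂_add η θ X.obj
  map₂_smul t η X := by
    apply ObjectProperty.hom_ext
    exact M.map₂_smul t η X.obj

/-- The additive closure `add {F X}` of the objects `F X`, where `F` runs over all `1`-morphisms:
it contains `Y` if and only if `Y` is a direct summand of `F 0 X ⊕ ⋯ ⊕ F (n - 1) X` for some
`1`-morphisms `F 0, …, F (n - 1)`; here `s` and `r` are the components of the inclusion of `Y`
and of the projection to `Y`. -/
def gen (M : TwoRep k C) {a : C} (X : M.toPseudo.obj a) : M.toPseudo.ObjectProperty where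
  prop b := fun Y => ∃ (n : ℕ) (F : Fin n → (a ⟶ b))
    (s : ∀ l, Y ⟶ (M.toPseudo.map (F l)).toFunctor.obj X)
    (r : ∀ l, (M.toPseudo.map (F l)).toFunctor.obj X ⟶ Y), ∑ l, s l ≫ r l = 𝟙 Y

instance (M : TwoRep k C) {a : C} (X : M.toPseudo.obj a) : (M.gen X).IsClosedUnderMapObj where
  map_obj := by
    rintro b c Y ⟨n, F, s, r, h⟩ f
    refine ⟨n, fun l => F l ≫ f,
      fun l => (M.toPseudo.map f).toFunctor.map (s l) ≫
        (M.toPseudo.mapComp (F l) f).inv.toNatTrans.app X,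
      fun l => (M.toPseudo.mapComp (F l) f).hom.toNatTrans.app X ≫
        (M.toPseudo.map f).toFunctor.map (r l), ?_⟩
    have e : ∀ l, ((M.toPseudo.map f).toFunctor.map (s l) ≫
        (M.toPseudo.mapComp (F l) f).inv.toNatTrans.app X) ≫
        (M.toPseudo.mapComp (F l) f).hom.toNatTrans.app X ≫
        (M.toPseudo.map f).toFunctor.map (r l) =
        (M.toPseudo.map f).toFunctor.map (s l ≫ r l) := by
      intro l
      rw [Category.assoc, Cat.Hom.inv_hom_id_toNatTrans_app_assoc, Functor.map_comp]
    simp only [e]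
    rw [← Functor.map_sum, h, CategoryTheory.Functor.map_id]

/-- A transitive `2`-representation: a finitary one which is equivalent to each of its
`2`-subrepresentations generated by a nonzero object. -/
def IsTransitive (M : TwoRep k C) : Prop :=
  M.IsFinitary ∧ ∀ (a : C) (X : M.toPseudo.obj a), ¬ IsZero X →
    Nonempty (Equivalence (M.full (M.gen X)) M)

end TwoRep

end TwoRep

section Abelianization

namespace TwoRep

open scoped Pseudofunctor.StrongTrans

variable {k : Type uk} [Field k] {C : Type u} [Bicategory.{w, v} C] [PreadditiveBicategory C]
  [LinearBicategory k C]

/-- Compatibility of the componentwise action with identities. -/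
def barMapId (M : TwoRep k C) (a : C) :
    ProjAb.mapFunctor k (M.toPseudo.map (𝟙 a)).toFunctor ≅ 𝟭 (ProjAb k (M.toPseudo.obj a)) where
  hom :=
    { app := fun P => ProjAb.homMk (P := ProjAb.mapObj (M.toPseudo.map (𝟙 a)).toFunctor P) (Q := P)
        ((M.toPseudo.mapId a).hom.toNatTrans.app P.pt)
        (ProjAb.app_mem (k := k) (M.toPseudo.mapId a).hom.toNatTrans P)
      naturality := by
        intro P Q x
        obtain ⟨g, hg, rfl⟩ := ProjAb.homMk_surj x
        exact ProjAb.homMk_congr (P := ProjAb.mapObj (M.toPseudo.map (𝟙 a)).toFunctor P) (Q := Q)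
          ((M.toPseudo.mapId a).hom.toNatTrans.naturality g) }
  inv :=
    { app := fun P => ProjAb.homMk (P := P) (Q := ProjAb.mapObj (M.toPseudo.map (𝟙 a)).toFunctor P)
        ((M.toPseudo.mapId a).inv.toNatTrans.app P.pt)
        (ProjAb.app_mem (k := k) (M.toPseudo.mapId a).inv.toNatTrans P)
      naturality := by
        intro P Q x
        obtain ⟨g, hg, rfl⟩ := ProjAb.homMk_surj x
        exact ProjAb.homMk_congr (P := P) (Q := ProjAb.mapObj (M.toPseudo.map (𝟙 a)).toFunctor Q)
          ((M.toPseudo.mapId a).inv.toNatTrans.naturality g) }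
  hom_inv_id := by
    ext P
    exact ProjAb.homMk_congr (P := ProjAb.mapObj (M.toPseudo.map (𝟙 a)).toFunctor P)
      (Q := ProjAb.mapObj (M.toPseudo.map (𝟙 a)).toFunctor P)
      (Cat.Hom.hom_inv_id_toNatTrans_app (M.toPseudo.mapId a) P.pt)
  inv_hom_id := by
    ext P
    exact ProjAb.homMk_congr (P := P) (Q := P)
      (Cat.Hom.inv_hom_id_toNatTrans_app (M.toPseudo.mapId a) P.pt)

/-- Compatibility of the componentwise action with composition. -/
def barMapComp (M : TwoRep k C) {a b c : C} (f : a ⟶ b) (g : b ⟶ c) :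
    ProjAb.mapFunctor k (M.toPseudo.map (f ≫ g)).toFunctor ≅
      ProjAb.mapFunctor k (M.toPseudo.map f).toFunctor ⋙
        ProjAb.mapFunctor k (M.toPseudo.map g).toFunctor where
  hom :=
    { app := fun P => ProjAb.homMk (P := ProjAb.mapObj (M.toPseudo.map (f ≫ g)).toFunctor P)
        (Q := ProjAb.mapObj (M.toPseudo.map g).toFunctor
          (ProjAb.mapObj (M.toPseudo.map f).toFunctor P))
        ((M.toPseudo.mapComp f g).hom.toNatTrans.app P.pt)
        (ProjAb.app_mem (k := k) (M.toPseudo.mapComp f g).hom.toNatTrans P)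
      naturality := by
        intro P Q x
        obtain ⟨y, hy, rfl⟩ := ProjAb.homMk_surj x
        exact ProjAb.homMk_congr (P := ProjAb.mapObj (M.toPseudo.map (f ≫ g)).toFunctor P)
          (Q := ProjAb.mapObj (M.toPseudo.map g).toFunctor
            (ProjAb.mapObj (M.toPseudo.map f).toFunctor Q))
          ((M.toPseudo.mapComp f g).hom.toNatTrans.naturality y) }
  inv :=
    { app := fun P => ProjAb.homMk (P := ProjAb.mapObj (M.toPseudo.map g).toFunctor
          (ProjAb.mapObj (M.toPseudo.map f).toFunctor P))
        (Q := ProjAb.mapObj (M.toPseudo.map (f ≫ g)).toFunctor P)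
        ((M.toPseudo.mapComp f g).inv.toNatTrans.app P.pt)
        (ProjAb.app_mem (k := k) (M.toPseudo.mapComp f g).inv.toNatTrans P)
      naturality := by
        intro P Q x
        obtain ⟨y, hy, rfl⟩ := ProjAb.homMk_surj x
        exact ProjAb.homMk_congr (P := ProjAb.mapObj (M.toPseudo.map g).toFunctor
            (ProjAb.mapObj (M.toPseudo.map f).toFunctor P))
          (Q := ProjAb.mapObj (M.toPseudo.map (f ≫ g)).toFunctor Q)
          ((M.toPseudo.mapComp f g).inv.toNatTrans.naturality y) }
  hom_inv_id := by
    ext P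
    exact ProjAb.homMk_congr (P := ProjAb.mapObj (M.toPseudo.map (f ≫ g)).toFunctor P)
      (Q := ProjAb.mapObj (M.toPseudo.map (f ≫ g)).toFunctor P)
      (Cat.Hom.hom_inv_id_toNatTrans_app (M.toPseudo.mapComp f g) P.pt)
  inv_hom_id := by
    ext P
    exact ProjAb.homMk_congr (P := ProjAb.mapObj (M.toPseudo.map g).toFunctor
          (ProjAb.mapObj (M.toPseudo.map f).toFunctor P))
      (Q := ProjAb.mapObj (M.toPseudo.map g).toFunctor
          (ProjAb.mapObj (M.toPseudo.map f).toFunctor P))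
      (Cat.Hom.inv_hom_id_toNatTrans_app (M.toPseudo.mapComp f g) P.pt)

/-- The pseudofunctor underlying the projective abelianization of a `2`-representation. -/
def barPseudo (M : TwoRep k C) : Pseudofunctor C Cat.{w, max v w} where
  obj a := Cat.of (ProjAb k (M.toPseudo.obj a))
  map f := (ProjAb.mapFunctor k (M.toPseudo.map f).toFunctor).toCatHom
  map₂ η := (ProjAb.mapNatTrans k (M.toPseudo.map₂ η).toNatTrans).toCatHom₂
  mapId a := Cat.Hom.isoMk (barMapId M a)
  mapComp f g := Cat.Hom.isoMk (barMapComp M f g)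
  map₂_id f := by
    ext P
    exact ProjAb.homMk_congr (congrArg (fun t => t.toNatTrans.app P.pt) (M.toPseudo.map₂_id f))
  map₂_comp η θ := by
    ext P
    exact ProjAb.homMk_congr
      (congrArg (fun t => t.toNatTrans.app P.pt) (M.toPseudo.map₂_comp η θ))
  map₂_whisker_left f _ _ η := by
    ext P
    exact ProjAb.homMk_congr
      (congrArg (fun t => t.toNatTrans.app P.pt) (M.toPseudo.map₂_whisker_left f η))
  map₂_whisker_right η h := by
    ext P
    exact ProjAb.homMk_congr
      (congrArg (fun t => t.toNatTrans.app P.pt) (M.toPseudo.map₂_whisker_right η h))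
  map₂_associator f g h := by
    ext P
    exact ProjAb.homMk_congr
      (congrArg (fun t => t.toNatTrans.app P.pt) (M.toPseudo.map₂_associator f g h))
  map₂_left_unitor f := by
    ext P
    exact ProjAb.homMk_congr
      (congrArg (fun t => t.toNatTrans.app P.pt) (M.toPseudo.map₂_left_unitor f))
  map₂_right_unitor f := by
    ext P
    exact ProjAb.homMk_congr
      (congrArg (fun t => t.toNatTrans.app P.pt) (M.toPseudo.map₂_right_unitor f))

instance (M : TwoRep k C) (a : C) : Preadditive (M.barPseudo.obj a) :=
  inferInstanceAs (Preadditive (ProjAb k (M.toPseudo.obj a)))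

instance (M : TwoRep k C) (a : C) : Linear k (M.barPseudo.obj a) :=
  inferInstanceAs (Linear k (ProjAb k (M.toPseudo.obj a)))

/-- The projective abelianization of a `2`-representation, as a `2`-representation of `C`, with
the componentwise action. -/
def bar (M : TwoRep k C) : TwoRep k C where
  toPseudo := M.barPseudo
  preadditive a := inferInstance
  linear a := inferInstance
  additive_map {a b} f :=
    { map_add := by
        intro P Q x y
        obtain ⟨g, hg, rfl⟩ := ProjAb.homMk_surj x
        obtain ⟨g', hg', rfl⟩ := ProjAb.homMk_surj y
        exact ProjAb.homMk_congr (M.toPseudo.map f).toFunctor.map_add }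
  linear_map {a b} f :=
    { map_smul := by
        intro P Q x t
        obtain ⟨g, hg, rfl⟩ := ProjAb.homMk_surj x
        exact ProjAb.homMk_congr ((M.toPseudo.map f).toFunctor.map_smul t g) }
  map₂_add η θ X := ProjAb.homMk_congr (M.map₂_add η θ X.pt)
  map₂_smul t η X := ProjAb.homMk_congr (M.map₂_smul t η X.pt)

/-- The canonical embedding of a `2`-representation into its projective abelianization. -/
def embBar (M : TwoRep k C) : M.toPseudo ⟶ M.bar.toPseudo :=
  { app := fun a => (ProjAb.embFunctor k (M.toPseudo.obj a)).toCatHom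
    naturality := fun {a b} f => Cat.Hom.isoMk (NatIso.ofComponents
      (fun X => ProjAb.isoMk (P := ProjAb.emb k ((M.toPseudo.map f).toFunctor.obj X))
        (Q := ProjAb.mapObj (M.toPseudo.map f).toFunctor (ProjAb.emb k X))
        (Iso.refl _) (fun i => i.elim0) (fun i => i.elim0))
      (by
        intro X Y x
        exact ProjAb.homMk_congr
          (P := ProjAb.emb k ((M.toPseudo.map f).toFunctor.obj X))
          (Q := ProjAb.mapObj (M.toPseudo.map f).toFunctor (ProjAb.emb k Y))
          ((Category.comp_id _).trans (Category.id_comp _).symm)))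
    naturality_naturality := by
      intro a b f g η
      ext X
      exact ProjAb.homMk_congr ((Category.comp_id _).trans (Category.id_comp _).symm)
    naturality_id := by
      intro a
      ext X
      exact ProjAb.homMk_congr (by
        refine (Category.id_comp _).trans ?_
        exact ((congrArg _ (Category.comp_id _)).trans (Category.comp_id _)).symm)
    naturality_comp := by
      intro a b c f g
      ext X
      refine ProjAb.homMk_congr ?_
      refine (Category.id_comp _).trans ?_
      refine Eq.symm ?_
      change (M.toPseudo.mapComp f g).hom.toNatTrans.app X ≫ 𝟙 _ ≫ 𝟙 _ ≫ 𝟙 _ ≫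
        (M.toPseudo.map g).toFunctor.map (𝟙 ((M.toPseudo.map f).toFunctor.obj X)) ≫ 𝟙 _ =
        (M.toPseudo.mapComp f g).hom.toNatTrans.app X
      simp }

end TwoRep

end Abelianization

section Modules

open MonObj

variable {B : Type u} [Bicategory.{w, v} B]

/-- A right module `1`-morphism over the algebra `1`-morphism `A` in a bicategory: a `1`-morphism
`X : i ⟶ j` with an associative and unital action `X ∘ A ⟶ X` (recall that `X ∘ A` is `A ≫ X`). -/
structure RightMod {i : B} (A : i ⟶ i) [MonObj A] (j : B) where
  X : i ⟶ j
  act : A ≫ X ⟶ X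
  one_act : (η[A] : 𝟙 i ⟶ A) ▷ X ≫ act = (λ_ X).hom
  mul_act : (μ[A] : A ≫ A ⟶ A) ▷ X ≫ act = (α_ A A X).hom ≫ A ◁ act ≫ act

namespace RightMod

variable [PreadditiveBicategory B] {i : B} {A : i ⟶ i} [MonObj A] {j : B}

/-- The group of morphisms of right modules. -/
def homSub (M N : RightMod A j) : AddSubgroup (M.X ⟶ N.X) where
  carrier := {x | A ◁ x ≫ N.act = M.act ≫ x}
  add_mem' := by
    intro x y (hx : A ◁ x ≫ N.act = M.act ≫ x) (hy : A ◁ y ≫ N.act = M.act ≫ y)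
    change A ◁ (x + y) ≫ N.act = M.act ≫ (x + y)
    rw [PreadditiveBicategory.whiskerLeft_add, Preadditive.add_comp, Preadditive.comp_add, hx, hy]
  zero_mem' := by
    have h : A ◁ (0 : M.X ⟶ N.X) = 0 := map_zero (whiskerLeftHom A M.X N.X)
    simp [h]
  neg_mem' := by
    intro x (hx : A ◁ x ≫ N.act = M.act ≫ x)
    change A ◁ (-x) ≫ N.act = M.act ≫ (-x)
    have h : A ◁ (-x) = -(A ◁ x) := map_neg (whiskerLeftHom A M.X N.X) x
    rw [h, Preadditive.neg_comp, Preadditive.comp_neg, hx]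

lemma comp_mem {M N P : RightMod A j} {x : M.X ⟶ N.X} {y : N.X ⟶ P.X} (hx : x ∈ homSub M N)
    (hy : y ∈ homSub N P) : x ≫ y ∈ homSub M P := by
  change A ◁ (x ≫ y) ≫ P.act = M.act ≫ x ≫ y
  have hx' : A ◁ x ≫ N.act = M.act ≫ x := hx
  have hy' : A ◁ y ≫ P.act = N.act ≫ y := hy
  rw [Bicategory.whiskerLeft_comp, Category.assoc, hy', ← Category.assoc, hx', Category.assoc]

lemma id_mem (M : RightMod A j) : 𝟙 M.X ∈ homSub M M := by
  change A ◁ 𝟙 M.X ≫ M.act = M.act ≫ 𝟙 M.X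
  simp

instance : Category (RightMod A j) where
  Hom M N := homSub M N
  id M := ⟨𝟙 M.X, id_mem M⟩
  comp x y := ⟨x.1 ≫ y.1, comp_mem x.2 y.2⟩
  id_comp x := Subtype.ext (Category.id_comp x.1)
  comp_id x := Subtype.ext (Category.comp_id x.1)
  assoc x y z := Subtype.ext (Category.assoc x.1 y.1 z.1)

/-- The morphism of `1`-morphisms underlying a morphism of right modules. -/
def Hom.val {M N : RightMod A j} (x : M ⟶ N) : M.X ⟶ N.X := Subtype.val x

lemma Hom.comm {M N : RightMod A j} (x : M ⟶ N) : A ◁ Hom.val x ≫ N.act = M.act ≫ Hom.val x :=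
  Subtype.property x

/-- A morphism of right modules. -/
def homMk {M N : RightMod A j} (x : M.X ⟶ N.X) (h : A ◁ x ≫ N.act = M.act ≫ x) : M ⟶ N := ⟨x, h⟩

lemma hom_ext {M N : RightMod A j} {x y : M ⟶ N} (h : Hom.val x = Hom.val y) : x = y :=
  Subtype.ext h

instance : Preadditive (RightMod A j) where
  homGroup M N := inferInstanceAs (AddCommGroup (homSub M N))
  add_comp _ _ _ x y z := Subtype.ext
    (Preadditive.add_comp _ _ _ (Hom.val x) (Hom.val y) (Hom.val z))
  comp_add _ _ _ x y z := Subtype.ext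
    (Preadditive.comp_add _ _ _ (Hom.val x) (Hom.val y) (Hom.val z))

variable {k : Type uk} [Field k] [LinearBicategory k B]

instance (M N : RightMod A j) : SMul k (M ⟶ N) where
  smul t x := homMk (t • Hom.val x) (by
    rw [LinearBicategory.whiskerLeft_smul, Linear.smul_comp, Linear.comp_smul, Hom.comm])

instance : Linear k (RightMod A j) where
  homModule M N :=
    { one_smul := fun x => hom_ext (one_smul k (Hom.val x))
      mul_smul := fun s t x => hom_ext (mul_smul s t (Hom.val x))
      smul_zero := fun t => hom_ext (smul_zero (A := M.X ⟶ N.X) t)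
      smul_add := fun t x y => hom_ext (smul_add t (Hom.val x) (Hom.val y))
      add_smul := fun s t x => hom_ext (add_smul s t (Hom.val x))
      zero_smul := fun x => hom_ext (zero_smul k (Hom.val x)) }
  smul_comp _ _ _ t x y := hom_ext (Linear.smul_comp _ _ _ t (Hom.val x) (Hom.val y))
  comp_smul _ _ _ x t y := hom_ext (Linear.comp_smul _ _ _ (Hom.val x) t (Hom.val y))

/-- An algebra `1`-morphism as a right module over itself. -/
def regular (A : i ⟶ i) [MonObj A] : RightMod A i where
  X := A
  act := (μ[A] : A ≫ A ⟶ A)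
  one_act := MonObj.one_mul A
  mul_act := MonObj.mul_assoc A

/-- Left multiplication of a right module by a `1`-morphism. -/
abbrev postObj {l : B} (f : j ⟶ l) (M : RightMod A j) : RightMod A l where
  X := M.X ≫ f
  act := (α_ A M.X f).inv ≫ M.act ▷ f
  one_act := by
    rw [associator_inv_naturality_left_assoc, ← Bicategory.comp_whiskerRight, M.one_act]
    simp
  mul_act := by
    rw [associator_inv_naturality_left_assoc, ← Bicategory.comp_whiskerRight, M.mul_act]
    simp

/-- Left multiplication by a `1`-morphism, as a functor on right modules. -/
def post {l : B} (f : j ⟶ l) : RightMod A j ⥤ RightMod A l where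
  obj M := postObj f M
  map {M N} x := homMk (M := postObj f M) (N := postObj f N) (Hom.val x ▷ f) (by
    change A ◁ Hom.val x ▷ f ≫ (α_ A N.X f).inv ≫ N.act ▷ f =
      ((α_ A M.X f).inv ≫ M.act ▷ f) ≫ Hom.val x ▷ f
    rw [associator_inv_naturality_middle_assoc, ← Bicategory.comp_whiskerRight, Hom.comm]
    simp)
  map_id M := hom_ext (Bicategory.id_whiskerRight M.X f)
  map_comp x y := hom_ext (Bicategory.comp_whiskerRight (Hom.val x) (Hom.val y) f)

/-- A `2`-morphism induces a natural transformation on right modules. -/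
def post₂ {l : B} {f g : j ⟶ l} (θ : f ⟶ g) : post (A := A) f ⟶ post g where
  app M := homMk (M := postObj f M) (N := postObj g M) (M.X ◁ θ) (by
    change A ◁ M.X ◁ θ ≫ (α_ A M.X g).inv ≫ M.act ▷ g =
      ((α_ A M.X f).inv ≫ M.act ▷ f) ≫ M.X ◁ θ
    rw [associator_inv_naturality_right_assoc, Category.assoc, whisker_exchange])
  naturality M N x := hom_ext (whisker_exchange (Hom.val x) θ).symm

/-- An isomorphism of right modules. -/
def isoMk {M N : RightMod A j} (e : M.X ≅ N.X) (h : A ◁ e.hom ≫ N.act = M.act ≫ e.hom) :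
    M ≅ N where
  hom := homMk e.hom h
  inv := homMk e.inv (by
    rw [← cancel_mono e.hom, Category.assoc, Category.assoc, e.inv_hom_id, Category.comp_id,
      ← h, ← Category.assoc, ← Bicategory.whiskerLeft_comp, e.inv_hom_id]
    simp)
  hom_inv_id := hom_ext e.hom_inv_id
  inv_hom_id := hom_ext e.inv_hom_id

/-- Multiplication by an identity `1`-morphism. -/
def postId (j : B) : post (A := A) (𝟙 j) ≅ 𝟭 (RightMod A j) :=
  NatIso.ofComponents
    (fun M => isoMk (M := postObj (𝟙 j) M) (N := M) (ρ_ M.X) (by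
      change A ◁ (ρ_ M.X).hom ≫ M.act = ((α_ A M.X (𝟙 j)).inv ≫ M.act ▷ 𝟙 j) ≫ (ρ_ M.X).hom
      simp))
    (fun {M N} x => hom_ext (rightUnitor_naturality (Hom.val x)))

/-- Multiplication by a composite of `1`-morphisms. -/
def postComp {l m : B} (f : j ⟶ l) (g : l ⟶ m) : post (A := A) (f ≫ g) ≅ post f ⋙ post g :=
  NatIso.ofComponents
    (fun M => isoMk (M := postObj (f ≫ g) M) (N := postObj g (postObj f M)) (α_ M.X f g).symm (by
      change A ◁ (α_ M.X f g).inv ≫ (α_ A (M.X ≫ f) g).inv ≫ ((α_ A M.X f).inv ≫ M.act ▷ f) ▷ g =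
        ((α_ A M.X (f ≫ g)).inv ≫ M.act ▷ (f ≫ g)) ≫ (α_ M.X f g).inv
      simp))
    (fun {M N} x => hom_ext (by
      change Hom.val x ▷ (f ≫ g) ≫ (α_ N.X f g).inv = (α_ M.X f g).inv ≫ Hom.val x ▷ f ▷ g
      simp))

variable (A) in
/-- The pseudofunctor sending `j` to the category of right `A`-modules `i ⟶ j`. -/
def pseudo : Pseudofunctor B Cat.{w, max v w} where
  obj j := Cat.of (RightMod A j)
  map f := (post f).toCatHom
  map₂ θ := (post₂ θ).toCatHom₂
  mapId j := Cat.Hom.isoMk (postId j)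
  mapComp f g := Cat.Hom.isoMk (postComp f g)
  map₂_id f := by
    ext M
    exact hom_ext (Bicategory.whiskerLeft_id M.X f)
  map₂_comp θ ξ := by
    ext M
    exact hom_ext (Bicategory.whiskerLeft_comp M.X θ ξ)
  map₂_whisker_left f g h θ := by
    ext M
    refine hom_ext ?_
    change M.X ◁ f ◁ θ = (α_ M.X f g).inv ≫ (M.X ≫ f) ◁ θ ≫ (α_ M.X f h).hom
    simp
  map₂_whisker_right {_ _ _ f g} θ h := by
    ext M
    refine hom_ext ?_
    change M.X ◁ θ ▷ h = (α_ M.X f h).inv ≫ (M.X ◁ θ) ▷ h ≫ (α_ M.X g h).hom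
    simp
  map₂_associator f g h := by
    ext M
    refine hom_ext ?_
    change M.X ◁ (α_ f g h).hom = (α_ M.X (f ≫ g) h).inv ≫ (α_ M.X f g).inv ▷ h ≫
      𝟙 _ ≫ (α_ (M.X ≫ f) g h).hom ≫ (α_ M.X f (g ≫ h)).hom
    simp
  map₂_left_unitor {a b} f := by
    ext M
    refine hom_ext ?_
    change M.X ◁ (λ_ f).hom = (α_ M.X (𝟙 a) f).inv ≫ (ρ_ M.X).hom ▷ f ≫ 𝟙 _
    simp
  map₂_right_unitor {a b} f := by
    ext M
    refine hom_ext ?_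
    change M.X ◁ (ρ_ f).hom = (α_ M.X f (𝟙 b)).inv ≫ (ρ_ (M.X ≫ f)).hom ≫ 𝟙 _
    simp

end RightMod

end Modules

section ModuleRepresentations

open scoped Pseudofunctor.StrongTrans

variable {k : Type uk} [Field k] {C : Type u} [Bicategory.{w, v} C] [PreadditiveBicategory C]
  [LinearBicategory k C] {i : AbBicat k C}

/-- The pseudofunctor underlying the `2`-representation of `C` on right `A`-module `1`-morphisms
in the projective abelianization of `C`. -/
abbrev modPseudo (A : i ⟶ i) [MonObj A] : Pseudofunctor C Cat.{w, max v w} :=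
  (AbBicat.embed k C).comp (RightMod.pseudo A)

instance (A : i ⟶ i) [MonObj A] (a : C) : Preadditive ((modPseudo A).obj a) :=
  inferInstanceAs (Preadditive (RightMod A (⟨a⟩ : AbBicat k C)))

instance (A : i ⟶ i) [MonObj A] (a : C) : Linear k ((modPseudo A).obj a) :=
  inferInstanceAs (Linear k (RightMod A (⟨a⟩ : AbBicat k C)))

/-- The `2`-representation of `C` on the categories of right `A`-module `1`-morphisms in the
projective abelianization of `C`, where `A` is an algebra `1`-morphism there.  A `1`-morphism of
`C` acts by composition. -/
def modRep (A : i ⟶ i) [MonObj A] : TwoRep k C where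
  toPseudo := modPseudo A
  preadditive a := inferInstance
  linear a := inferInstance
  additive_map {a b} f :=
    { map_add := by
        intro M N x y
        exact RightMod.hom_ext (PreadditiveBicategory.add_whiskerRight
          (RightMod.Hom.val x) (RightMod.Hom.val y) ((AbBicat.embed k C).map f)) }
  linear_map {a b} f :=
    { map_smul := by
        intro M N x t
        exact RightMod.hom_ext (LinearBicategory.smul_whiskerRight t
          (RightMod.Hom.val x) ((AbBicat.embed k C).map f)) }
  map₂_add {a b f g} η θ M := RightMod.hom_ext (PreadditiveBicategory.whiskerLeft_add
    (RightMod.X M) ((AbBicat.embed k C).map₂ η) ((AbBicat.embed k C).map₂ θ))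
  map₂_smul {a b f g} t η M := RightMod.hom_ext (LinearBicategory.whiskerLeft_smul
    (RightMod.X M) t ((AbBicat.embed k C).map₂ η))

/-- The class of projective right `A`-module `1`-morphisms. -/
def projMod (A : i ⟶ i) [MonObj A] : (modRep A).toPseudo.ObjectProperty where
  prop _ := fun X => Projective X

end ModuleRepresentations

end FinTwoRep

open FinTwoRep
open scoped Pseudofunctor.StrongTrans

universe v₁ u₁

/-! Evaluation `F ↦ F N` extends componentwise to a right exact functor `evBar` from the 1-morphisms
`i ⟶ j` of the abelianized bicategory to the abelianization of `M(j)`. It has a right adjoint `[N,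
-]` (`ProjAb.mapFunctor_isLeftAdjoint`): hom spaces are finite dimensional and finitely many objects
generate, so the functor `F ↦ Hom(F N, P)` has a finite presentation by representables, and such a
presentation is exactly an object of the projective abelianization. The counit `[N, P] N ⟶ P` makes
`A = [N, N]` an algebra and each `[N, P]` a right `A`-module. The equivalence `Φ` is `P ↦ [N, P]`.

`Φ` commutes with the action because every `f` is, up to isomorphism, right adjoint to `f^*`:
morphisms `X ⟶ f [N, P]` are morphisms `f^* X ⟶ [N, P]`, that is `f^* (X N) ⟶ P`, that is `X N ⟶ f
P`, that is `X ⟶ [N, f P]` (`isIso_ihomStr`).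

That `Φ` is an equivalence is a monadicity argument. The functor `[N, -]` is right exact, since its
left adjoint sends embedded objects to embedded ones, which are projective
(`ProjAb.isCoker_map_of_adjunction`). Compatibility with the action at `P = N` gives `F A ≅ [N, F
N]` for `F` in `C`, and right exactness extends this to `X A ≅ [N, X N]` for all `X`
(`isIso_endIhom`). A module `X` is the cokernel of its bar presentation, hence is `[N, K]` for the
corresponding quotient `K` of `X N` (`isIso_toIhom`). Full faithfulness needs moreover that `[N, -]`
reflects isomorphisms, that is, that the objects `F N` generate (`isIso_of_isIso_ihom`). Here
transitivity enters: it supplies only an abstract equivalence between `add {F N}` and `M`, and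
counting indecomposables shows that the inclusion already reaches every object
(`IsFinitaryCategory.prop_of_equivalence`).

Finally, since idempotents split in `M(j)`, the projective objects of its abelianization are, up to
isomorphism, the embedded ones. An equivalence preserves and reflects projectivity, so `Φ` restricts
to `Ψ`, and `f [N, Z] ≅ [N, f Z]` shows that projective modules are stable under the action. -/

namespace FinTwoRep

/-! ### Finitary categories: decomposition, finite generation, counting indecomposables. -/

section FinitaryCategories

variable {k : Type uk} [Field k] {𝒜 : Type u} [Category.{v} 𝒜] [Preadditive 𝒜] [Linear k 𝒜]

/-- The identity of `X` is a finite sum of endomorphisms that factor through objects satisfying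
`P`. -/
def IsSummandOfSum {𝒜 : Type u} [Category.{v} 𝒜] [Preadditive 𝒜] (P : 𝒜 → Prop) (X : 𝒜) : Prop :=
  ∃ (n : ℕ) (Y : Fin n → 𝒜) (s : ∀ l, X ⟶ Y l) (r : ∀ l, Y l ⟶ X), (∀ l, P (Y l)) ∧
    ∑ l, s l ≫ r l = 𝟙 X

lemma IsSummandOfSum.of_isZero {P : 𝒜 → Prop} {X : 𝒜} (h : IsZero X) : IsSummandOfSum P X :=
  ⟨0, fun i => i.elim0, fun i => i.elim0, fun i => i.elim0, fun i => i.elim0, h.eq_of_src _ _⟩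

lemma IsSummandOfSum.of_retract {P : 𝒜 → Prop} {X Y : 𝒜} (hY : P Y) (s : X ⟶ Y) (r : Y ⟶ X)
    (h : s ≫ r = 𝟙 X) : IsSummandOfSum P X :=
  ⟨1, fun _ => Y, fun _ => s, fun _ => r, fun _ => hY, by simpa using h⟩

lemma IsSummandOfSum.of_sum {P : 𝒜 → Prop} {X Y Z : 𝒜} (hY : IsSummandOfSum P Y)
    (hZ : IsSummandOfSum P Z) (s : X ⟶ Y) (r : Y ⟶ X) (s' : X ⟶ Z) (r' : Z ⟶ X)
    (h : s ≫ r + s' ≫ r' = 𝟙 X) : IsSummandOfSum P X := by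
  obtain ⟨n, U, a, b, hU, e⟩ := hY
  obtain ⟨n', U', a', b', hU', e'⟩ := hZ
  refine ⟨n + n', Fin.addCases U U',
    fun l => Fin.addCases (motive := fun l => X ⟶ (Fin.addCases U U' l : 𝒜))
      (fun l => s ≫ a l ≫ eqToHom (by simp)) (fun l => s' ≫ a' l ≫ eqToHom (by simp)) l,
    fun l => Fin.addCases (motive := fun l => (Fin.addCases U U' l : 𝒜) ⟶ X)
      (fun l => eqToHom (by simp) ≫ b l ≫ r) (fun l => eqToHom (by simp) ≫ b' l ≫ r') l, ?_, ?_⟩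
  · intro l
    refine Fin.addCases (fun l => ?_) (fun l => ?_) l
    · simpa using hU l
    · simpa using hU' l
  · rw [Fin.sum_univ_add, ← h]
    have h₁ : s ≫ r = ∑ l, s ≫ (a l ≫ b l) ≫ r := by
      rw [← Preadditive.comp_sum, ← Preadditive.sum_comp, e, Category.id_comp]
    have h₂ : s' ≫ r' = ∑ l, s' ≫ (a' l ≫ b' l) ≫ r' := by
      rw [← Preadditive.comp_sum, ← Preadditive.sum_comp, e', Category.id_comp]
    rw [h₁, h₂]
    simp

/-- In a `Hom`-finite additive category, every object is a finite sum of indecomposable ones. -/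
lemma isSummandOfSum_indecomposable [HasBinaryBiproducts 𝒜]
    (hfin : ∀ X Y : 𝒜, FiniteDimensional k (X ⟶ Y)) (X : 𝒜) :
    IsSummandOfSum (fun Y : 𝒜 => Indecomposable Y) X := by
  induction hn : Module.finrank k (X ⟶ X) using Nat.strong_induction_on generalizing X with
  | _ n ih =>
  by_cases hX : IsZero X
  · exact .of_isZero hX
  by_cases hI : Indecomposable X
  · exact .of_retract hI (𝟙 X) (𝟙 X) (by simp)
  have : ∃ Y Z : 𝒜, ∃ _ : X ≅ Y ⊞ Z, ¬ IsZero Y ∧ ¬ IsZero Z := by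
    by_contra hcon
    refine hI ⟨hX, fun Y Z e => ?_⟩
    by_contra h
    rw [not_or] at h
    exact hcon ⟨Y, Z, e, h⟩
  obtain ⟨Y, Z, e, hY, hZ⟩ := this
  -- The map `g ↦ s ≫ g ≫ r` embeds `End Y` into `End X` and misses the idempotent `s' ≫ r'` of the
  -- complementary nonzero summand, so the dimension drops strictly.
  have key : ∀ (Y Z : 𝒜) (s : X ⟶ Y) (r : Y ⟶ X) (s' : X ⟶ Z) (r' : Z ⟶ X), r ≫ s = 𝟙 Y →
      r' ≫ s' = 𝟙 Z → r ≫ s' = 0 → ¬ IsZero Z →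
      Module.finrank k (Y ⟶ Y) < Module.finrank k (X ⟶ X) := by
    intro Y Z s r s' r' h₁ h₂ h₃ hZ
    let f : (Y ⟶ Y) →ₗ[k] (X ⟶ X) :=
      { toFun := fun g => s ≫ g ≫ r
        map_add' := by simp
        map_smul' := by simp }
    have hf : Function.Injective f := by
      intro g g' h
      have : r ≫ (s ≫ g ≫ r) ≫ s = r ≫ (s ≫ g' ≫ r) ≫ s := congrArg (fun t => r ≫ t ≫ s) h
      simpa [h₁, reassoc_of% h₁] using this
    have hlt : LinearMap.range f < ⊤ := by
      refine lt_top_iff_ne_top.2 fun htop => hZ ?_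
      have : s' ≫ r' ∈ LinearMap.range f := by rw [htop]; trivial
      obtain ⟨g, hg⟩ := this
      have hg' : s ≫ g ≫ r = s' ≫ r' := hg
      have : (s ≫ g ≫ r) ≫ s' = (s' ≫ r') ≫ s' := by rw [hg']
      simp only [Category.assoc, h₂, h₃, comp_zero, Category.comp_id] at this
      rw [IsZero.iff_id_eq_zero, ← h₂, ← this, comp_zero]
    have := hfin X X
    rw [← LinearMap.finrank_range_of_inj hf]
    exact Submodule.finrank_lt hlt.ne
  have hYl : Module.finrank k (Y ⟶ Y) < n := hn ▸ key Y Z (e.hom ≫ biprod.fst) (biprod.inl ≫ e.inv)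
    (e.hom ≫ biprod.snd) (biprod.inr ≫ e.inv) (by simp) (by simp) (by simp) hZ
  have hZl : Module.finrank k (Z ⟶ Z) < n := hn ▸ key Z Y (e.hom ≫ biprod.snd) (biprod.inr ≫ e.inv)
    (e.hom ≫ biprod.fst) (biprod.inl ≫ e.inv) (by simp) (by simp) (by simp) hY
  refine IsSummandOfSum.of_sum (ih _ hYl Y rfl) (ih _ hZl Z rfl) (e.hom ≫ biprod.fst)
    (biprod.inl ≫ e.inv) (e.hom ≫ biprod.snd) (biprod.inr ≫ e.inv) ?_
  have : e.hom ≫ (biprod.fst ≫ biprod.inl + biprod.snd ≫ biprod.inr) ≫ e.inv = 𝟙 X := by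
    rw [biprod.total, Category.id_comp, e.hom_inv_id]
  simpa only [Preadditive.add_comp, Preadditive.comp_add, Category.assoc] using this

/-- In a finitary category there are finitely many objects that generate all objects. -/
lemma IsFinitaryCategory.exists_generators [IsFinitaryCategory k 𝒜] :
    ∃ (n : ℕ) (I : Fin n → 𝒜), ∀ X : 𝒜, IsSummandOfSum (fun Y => ∃ a, Y = I a) X := by
  have := IsFinitaryCategory.hasFiniteBiproducts (k := k) (𝒜 := 𝒜)
  have := hasBinaryBiproducts_of_finite_biproducts 𝒜
  obtain ⟨n, I, hI⟩ := IsFinitaryCategory.finite_indecomposables (k := k) (𝒜 := 𝒜)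
  refine ⟨n, I, fun X => ?_⟩
  obtain ⟨m, Y, s, r, hY, e⟩ :=
    isSummandOfSum_indecomposable (IsFinitaryCategory.finiteDimensional_hom (k := k)) X
  choose a ha using fun l => hI (Y l) (hY l)
  refine ⟨m, fun l => I (a l), fun l => s l ≫ (ha l).some.hom, fun l => (ha l).some.inv ≫ r l,
    fun l => ⟨a l, rfl⟩, by simpa using e⟩

/-- A family of subspaces of `Hom(E F, P)`, stable under precomposition, is finitely generated
when the source of `E` is finitary. -/
lemma IsFinitaryCategory.exists_finite_generation [IsFinitaryCategory k 𝒜] {𝒟 : Type*}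
    [Category 𝒟] [Preadditive 𝒟] [Linear k 𝒟] (E : 𝒜 ⥤ 𝒟) [E.Additive] [E.Linear k] (P : 𝒟)
    (hP : ∀ F, FiniteDimensional k (E.obj F ⟶ P)) (K : ∀ F, Submodule k (E.obj F ⟶ P))
    (hK : ∀ {F G : 𝒜} (f : F ⟶ G) (z : E.obj G ⟶ P), z ∈ K G → E.map f ≫ z ∈ K F) :
    ∃ (m : ℕ) (G : Fin m → 𝒜) (z : ∀ t, E.obj (G t) ⟶ P), (∀ t, z t ∈ K (G t)) ∧
      ∀ (F : 𝒜) (h : E.obj F ⟶ P), h ∈ K F → ∃ f : ∀ t, F ⟶ G t, h = ∑ t, E.map (f t) ≫ z t := by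
  obtain ⟨n, I, hI⟩ := IsFinitaryCategory.exists_generators (k := k) (𝒜 := 𝒜)
  let b := fun a => Module.finBasis k (K (I a))
  -- The generators are bases of the spaces `K (I a)`, all collected in one finite index type.
  let T := Σ a, Fin (Module.finrank k (K (I a)))
  let e : T ≃ Fin (Fintype.card T) := Fintype.equivFin T
  have main : ∀ (F : 𝒜) (h : E.obj F ⟶ P), h ∈ K F →
      ∃ f : ∀ t : T, F ⟶ I t.1, h = ∑ t : T, E.map (f t) ≫ (b t.1 t.2 : E.obj (I t.1) ⟶ P) := by
    intro F h hh
    obtain ⟨m, Y, s, r, hY, hsum⟩ := hI F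
    have step : ∀ l, ∃ f : ∀ t : T, F ⟶ I t.1, E.map (s l) ≫ E.map (r l) ≫ h =
        ∑ t : T, E.map (f t) ≫ (b t.1 t.2 : E.obj (I t.1) ⟶ P) := by
      intro l
      obtain ⟨a, ha⟩ := hY l
      obtain ⟨s', r', hsr⟩ : ∃ (s' : F ⟶ I a) (r' : I a ⟶ F),
          E.map (s l) ≫ E.map (r l) ≫ h = E.map s' ≫ E.map r' ≫ h :=
        ⟨s l ≫ eqToHom ha, eqToHom ha.symm ≫ r l, by
          rw [← E.map_comp_assoc, ← E.map_comp_assoc]; simp⟩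
      let x : K (I a) := ⟨E.map r' ≫ h, hK r' h hh⟩
      have hx : E.map r' ≫ h = ∑ c, (b a).repr x c • (b a c : E.obj (I a) ⟶ P) := by
        rw [show E.map r' ≫ h = (x : E.obj (I a) ⟶ P) from rfl]
        have := congrArg (K (I a)).subtype ((b a).sum_repr x)
        rw [map_sum] at this
        exact this.symm.trans (Finset.sum_congr rfl fun c _ => rfl)
      -- Expanding in the basis at `I a` uses only the indices over `a`; all others receive the zero
      -- morphism.
      refine ⟨fun t => if h : t.1 = a then
        (b a).repr x (h ▸ t.2) • s' ≫ eqToHom (by rw [h]) else 0, ?_⟩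
      rw [hsr, hx, Fintype.sum_sigma, Finset.sum_eq_single a]
      · simp [Preadditive.comp_sum, E.map_smul]
      · intro a' _ ha'
        simp [ha']
      · simp
    choose f hf using step
    refine ⟨fun t => ∑ l, f l t, ?_⟩
    have h₁ : h = ∑ l, E.map (s l) ≫ E.map (r l) ≫ h := by
      have := congrArg (fun t => E.map t ≫ h) hsum
      simp only [E.map_sum, E.map_comp, E.map_id, Category.id_comp, Preadditive.sum_comp,
        Category.assoc] at this
      exact this.symm
    rw [h₁]
    simp only [hf, E.map_sum, Preadditive.sum_comp]
    exact Finset.sum_comm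
  refine ⟨Fintype.card T, fun t => I (e.symm t).1, fun t => b (e.symm t).1 (e.symm t).2,
    fun t => (b (e.symm t).1 (e.symm t).2).2, fun F h hh => ?_⟩
  obtain ⟨f, hf⟩ := main F h hh
  refine ⟨fun t => f (e.symm t), hf.trans ?_⟩
  exact (e.symm.sum_comp (fun t : T => E.map (f t) ≫ (b t.1 t.2 : E.obj (I t.1) ⟶ P))).symm

/-- A full subcategory of a finitary category, closed under direct sums and summands, which is
equivalent to the whole category contains all objects. -/
lemma IsFinitaryCategory.prop_of_equivalence [IsFinitaryCategory k 𝒜] (P : ObjectProperty 𝒜)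
    (hP : ∀ X, IsSummandOfSum P X → P X) (E : P.FullSubcategory ⥤ 𝒜) [E.Additive]
    [E.IsEquivalence] (X : 𝒜) : P X := by
  have := IsFinitaryCategory.hasFiniteBiproducts (k := k) (𝒜 := 𝒜)
  have := hasBinaryBiproducts_of_finite_biproducts 𝒜
  obtain ⟨n, I, hI⟩ := IsFinitaryCategory.finite_indecomposables (k := k) (𝒜 := 𝒜)
  -- `T` is the set of isomorphism classes of indecomposables; choosing an isomorphic member of the
  -- list `I` embeds it into `Fin n`.
  let T := {q : Quotient (isIsomorphicSetoid 𝒜) // ∃ X : 𝒜, Indecomposable X ∧ ⟦X⟧ = q}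
  have hT : Finite T := by
    let f : T → Fin n := fun t => (hI _ t.2.choose_spec.1).choose
    refine Finite.of_injective f fun t t' h => Subtype.ext ?_
    rw [← t.2.choose_spec.2, ← t'.2.choose_spec.2]
    refine Quotient.sound ?_
    obtain ⟨e⟩ := (hI _ t.2.choose_spec.1).choose_spec
    obtain ⟨e'⟩ := (hI _ t'.2.choose_spec.1).choose_spec
    exact ⟨e ≪≫ eqToIso (congrArg I h) ≪≫ e'.symm⟩
  -- Both parts of a decomposition of `Y.obj` lie in `P`, being retracts of it, so `E` carries the
  -- decomposition to one of `E.obj Y`.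
  have hind : ∀ Y : P.FullSubcategory, Indecomposable (E.obj Y) → Indecomposable Y.obj := by
    intro Y hY
    refine ⟨fun h0 => hY.1 ?_, fun U V e => ?_⟩
    · rw [IsZero.iff_id_eq_zero] at h0 ⊢
      rw [← E.map_id, show 𝟙 Y = 0 from ObjectProperty.hom_ext _ h0, E.map_zero]
    · have zero_of : ∀ {U : 𝒜} (hU : P U), IsZero (E.obj ⟨U, hU⟩) → IsZero U := by
        intro U hU h
        rw [IsZero.iff_id_eq_zero, ← E.map_id] at h
        have : 𝟙 (⟨U, hU⟩ : P.FullSubcategory) = 0 := E.map_injective (h.trans (E.map_zero _ _).symm)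
        rw [IsZero.iff_id_eq_zero]
        exact congrArg (fun t => t.hom) this
      have hU : P U := hP _ (.of_retract Y.2 (biprod.inl ≫ e.inv) (e.hom ≫ biprod.fst) (by simp))
      have hV : P V := hP _ (.of_retract Y.2 (biprod.inr ≫ e.inv) (e.hom ≫ biprod.snd) (by simp))
      let U' : P.FullSubcategory := ⟨U, hU⟩
      let V' : P.FullSubcategory := ⟨V, hV⟩
      let i₁ : U' ⟶ Y := ObjectProperty.homMk (biprod.inl ≫ e.inv)
      let i₂ : V' ⟶ Y := ObjectProperty.homMk (biprod.inr ≫ e.inv)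
      let p₁ : Y ⟶ U' := ObjectProperty.homMk (e.hom ≫ biprod.fst)
      let p₂ : Y ⟶ V' := ObjectProperty.homMk (e.hom ≫ biprod.snd)
      have e₁₁ : i₁ ≫ p₁ = 𝟙 U' := ObjectProperty.hom_ext _ (by simp [i₁, p₁, U'])
      have e₂₂ : i₂ ≫ p₂ = 𝟙 V' := ObjectProperty.hom_ext _ (by simp [i₂, p₂, V'])
      have e₁₂ : i₁ ≫ p₂ = 0 := ObjectProperty.hom_ext _ (by
        change (biprod.inl ≫ e.inv) ≫ e.hom ≫ biprod.snd = 0; simp)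
      have e₂₁ : i₂ ≫ p₁ = 0 := ObjectProperty.hom_ext _ (by
        change (biprod.inr ≫ e.inv) ≫ e.hom ≫ biprod.fst = 0; simp)
      have et : p₁ ≫ i₁ + p₂ ≫ i₂ = 𝟙 Y := ObjectProperty.hom_ext _ (by
        change (e.hom ≫ biprod.fst) ≫ biprod.inl ≫ e.inv +
          (e.hom ≫ biprod.snd) ≫ biprod.inr ≫ e.inv = 𝟙 Y.obj
        have : e.hom ≫ (biprod.fst ≫ biprod.inl + biprod.snd ≫ biprod.inr) ≫ e.inv = 𝟙 _ := by
          rw [biprod.total, Category.id_comp, e.hom_inv_id]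
        simpa only [Preadditive.add_comp, Preadditive.comp_add, Category.assoc] using this)
      refine (hY.2 (E.obj U') (E.obj V')
        ⟨biprod.lift (E.map p₁) (E.map p₂), biprod.desc (E.map i₁) (E.map i₂), ?_, ?_⟩).imp
        (zero_of hU) (zero_of hV)
      · rw [biprod.lift_desc, ← E.map_comp, ← E.map_comp, ← E.map_add, et, E.map_id]
      · ext
        · simp [← E.map_comp, e₁₁]
        · simp [← E.map_comp, e₁₂]
        · simp [← E.map_comp, e₂₁]
        · simp [← E.map_comp, e₂₂]
  have hrep : ∀ t : T, ∃ Y : P.FullSubcategory, Indecomposable (E.obj Y) ∧ ⟦E.obj Y⟧ = t.1 := by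
    rintro ⟨_, X, hX, rfl⟩
    have e := E.objObjPreimageIso X
    refine ⟨E.objPreimage X, ⟨fun h => hX.1 (h.of_iso e.symm), fun U V a => hX.2 U V (e.symm ≪≫ a)⟩,
      Quotient.sound ⟨e⟩⟩
  choose Y hY hYt using hrep
  -- Pigeonhole: the class of `E.obj Y` is sent to the class of `Y.obj`. An isomorphism of the
  -- underlying objects is one in the full subcategory, and `E` preserves it, so `φ` is injective,
  -- hence surjective: every indecomposable is isomorphic to an object of `P`.
  let φ : T → T := fun t => ⟨⟦(Y t).obj⟧, (Y t).obj, hind _ (hY t), rfl⟩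
  have hφ : Function.Injective φ := by
    intro t t' h
    obtain ⟨e⟩ := Quotient.exact (congrArg Subtype.val h)
    refine Subtype.ext ?_
    rw [← hYt, ← hYt]
    exact Quotient.sound ⟨E.mapIso (P.isoMk e)⟩
  have hI : ∀ X, Indecomposable X → P X := by
    intro X hX
    obtain ⟨t, ht⟩ := Finite.surjective_of_injective hφ ⟨⟦X⟧, X, hX, rfl⟩
    obtain ⟨e⟩ := Quotient.exact (congrArg Subtype.val ht)
    exact hP _ (.of_retract (Y t).2 e.inv e.hom e.inv_hom_id)
  obtain ⟨m, Z, s, r, hZ, h⟩ :=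
    isSummandOfSum_indecomposable (IsFinitaryCategory.finiteDimensional_hom (k := k)) X
  exact hP X ⟨m, Z, s, r, fun l => hI _ (hZ l), h⟩

end FinitaryCategories

/-! ### Projective abelianizations: projective objects and existence of right adjoints. -/

namespace ProjAb

variable {k : Type uk} [Field k] {𝒜 : Type u} [Category.{v} 𝒜] [Preadditive 𝒜] [Linear k 𝒜]

lemma finiteDimensional_hom (hfin : ∀ X Y : 𝒜, FiniteDimensional k (X ⟶ Y)) (P Q : ProjAb k 𝒜) :
    FiniteDimensional k (P ⟶ Q) := by
  have := hfin P.pt Q.pt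
  exact inferInstanceAs (FiniteDimensional k (homSub P Q ⧸ nullSub P Q))

/-- The canonical projection to `P` from its target object. -/
def proj (P : ProjAb k 𝒜) : emb k P.pt ⟶ P := homMk (P := emb k P.pt) (𝟙 P.pt) (mem_of_emb _)

lemma proj_homMk {P Q : ProjAb k 𝒜} (g : P.pt ⟶ Q.pt) (hg : g ∈ homSub P Q) :
    P.proj ≫ homMk g hg = homMk (P := emb k P.pt) g (mem_of_emb g) :=
  homMk_congr (P := emb k P.pt) (Category.id_comp g)

/-- A class depends only on its component between the targets, and whether it is null-homotopic
involves only the arrows of `Q`, so nothing is lost on the embedded target of `P`. -/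
lemma proj_comp_eq_zero_iff {P Q : ProjAb k 𝒜} (x : P ⟶ Q) : P.proj ≫ x = 0 ↔ x = 0 := by
  obtain ⟨g, hg, rfl⟩ := homMk_surj x
  rw [proj_homMk]
  exact (homMk_eq_iff (P := emb k P.pt) (mem_of_emb g) (Submodule.zero_mem _)).trans
    (homMk_eq_iff hg (Submodule.zero_mem _)).symm

instance (P : ProjAb k 𝒜) : Epi P.proj :=
  Preadditive.epi_of_cancel_zero _ fun x hx => (proj_comp_eq_zero_iff x).1 hx

variable (k) in
/-- A morphism as a morphism between embedded objects. -/
def embMap {X Y : 𝒜} (f : X ⟶ Y) : emb k X ⟶ emb k Y :=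
  homMk (P := emb k X) (Q := emb k Y) f (mem_of_emb (Q := emb k Y) f)

@[simp]
lemma embMap_id (X : 𝒜) : embMap k (𝟙 X) = 𝟙 (emb k X) := rfl

@[simp]
lemma embMap_comp {X Y Z : 𝒜} (f : X ⟶ Y) (g : Y ⟶ Z) :
    embMap k (f ≫ g) = embMap k f ≫ embMap k g := rfl

lemma embMap_sum {X Y : 𝒜} {n : ℕ} (f : Fin n → (X ⟶ Y)) :
    embMap k (∑ t, f t) = ∑ t, embMap k (f t) :=
  map_sum (AddMonoidHom.mk' (embMap k (X := X) (Y := Y)) fun _ _ => rfl) f Finset.univ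

/-- Exactness of the presentation of `P`, tested on embedded objects. -/
lemma embMap_proj_eq_zero_iff {P : ProjAb k 𝒜} {Z : 𝒜} (g : Z ⟶ P.pt) :
    embMap k g ≫ P.proj = 0 ↔ ∃ q : ∀ t, Z ⟶ P.src t, g = ∑ t, q t ≫ P.arr t := by
  have h : embMap k g ≫ P.proj = homMk (P := emb k Z) g (mem_of_emb g) :=
    homMk_congr (P := emb k Z) (Category.comp_id g)
  rw [h]
  refine (homMk_eq_iff (P := emb k Z) (Q := P) (mem_of_emb _) (Submodule.zero_mem _)).trans ?_
  rw [sub_zero]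
  rfl

@[simp]
lemma arr_proj (P : ProjAb k 𝒜) (t : Fin P.n) : embMap k (P.arr t) ≫ P.proj = 0 :=
  (embMap_proj_eq_zero_iff _).2 (P.arr_mem t)

/-- Every morphism from an embedded object lifts to the target. -/
lemma exists_emb_lift {Z : 𝒜} {P : ProjAb k 𝒜} (x : emb k Z ⟶ P) :
    ∃ g : Z ⟶ P.pt, x = embMap k g ≫ P.proj := by
  obtain ⟨g, hg, rfl⟩ := homMk_surj x
  exact ⟨g, homMk_congr (P := emb k Z) (Category.comp_id g).symm⟩

lemma embMap_injective {X Y : 𝒜} {f g : X ⟶ Y} (h : embMap k f = embMap k g) : f = g := by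
  obtain ⟨q, hq⟩ := (homMk_eq_iff (P := emb k X) (Q := emb k Y) (mem_of_emb _) (mem_of_emb _)).1 h
  exact sub_eq_zero.1 (hq.trans (Finset.sum_eq_zero fun t _ => t.elim0))

lemma embMap_surjective {X Y : 𝒜} (x : emb k X ⟶ emb k Y) : ∃ f : X ⟶ Y, x = embMap k f := by
  obtain ⟨g, hg, rfl⟩ := homMk_surj x
  exact ⟨g, rfl⟩

instance : (embFunctor k 𝒜).Additive := ⟨rfl⟩

instance : (embFunctor k 𝒜).Linear k := ⟨fun _ _ => rfl⟩

/-- Morphisms out of `P` are morphisms out of the target that vanish on all arrows. -/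
lemma exists_desc {P Q : ProjAb k 𝒜} (x : emb k P.pt ⟶ Q)
    (hx : ∀ t, embMap k (P.arr t) ≫ x = 0) : ∃ y : P ⟶ Q, P.proj ≫ y = x := by
  obtain ⟨g, hg, rfl⟩ := homMk_surj x
  have : g ∈ homSub P Q := fun t => by
    have : P.arr t ≫ g - 0 ∈ Q.image (P.src t) :=
      (homMk_eq_iff (P := emb k (P.src t)) (Q := Q) (mem_of_emb _) (Submodule.zero_mem _)).1 (hx t)
    rwa [sub_zero] at this
  exact ⟨homMk (P := P) g this, proj_homMk (P := P) g this⟩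

/-- A morphism which is bijective on morphisms from embedded objects is an isomorphism. -/
lemma isIso_of_bijective {P Q : ProjAb k 𝒜} (x : P ⟶ Q)
    (hinj : ∀ (Z : 𝒜) (z : emb k Z ⟶ P), z ≫ x = 0 → z = 0)
    (hsurj : ∀ (Z : 𝒜) (z : emb k Z ⟶ Q), ∃ z', z' ≫ x = z) : IsIso x := by
  -- The projection of `Q` lifts through `x`; by injectivity the lift kills the arrows of `Q`, so it
  -- descends to a section of `x`. Injectivity again makes the section an inverse.
  obtain ⟨y, hy⟩ := hsurj _ Q.proj
  obtain ⟨y', hy'⟩ := exists_desc y fun t => hinj _ _ (by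
    rw [Category.assoc, hy, arr_proj])
  have h₂ : y' ≫ x = 𝟙 Q := by
    rw [← cancel_epi Q.proj, reassoc_of% hy', hy, Category.comp_id]
  refine ⟨y', ?_, h₂⟩
  rw [← cancel_epi P.proj, ← sub_eq_zero, ← Preadditive.comp_sub]
  refine hinj _ _ ?_
  simp [Preadditive.sub_comp, h₂]

/-- The criterion of `isIso_of_bijective` needs only be checked on generators. -/
lemma isIso_of_bijective_of_generates (G : 𝒜 → Prop) (hG : ∀ Z, IsSummandOfSum G Z)
    {P Q : ProjAb k 𝒜} (x : P ⟶ Q)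
    (hinj : ∀ (Z : 𝒜) (_ : G Z) (z : emb k Z ⟶ P), z ≫ x = 0 → z = 0)
    (hsurj : ∀ (Z : 𝒜) (_ : G Z) (z : emb k Z ⟶ Q), ∃ z', z' ≫ x = z) : IsIso x := by
  have dec : ∀ (Z : 𝒜) {R : ProjAb k 𝒜} (z : emb k Z ⟶ R), ∃ (n : ℕ) (Y : Fin n → 𝒜)
      (s : ∀ l, Z ⟶ Y l) (r : ∀ l, Y l ⟶ Z), (∀ l, G (Y l)) ∧
      ∀ {R : ProjAb k 𝒜} (z : emb k Z ⟶ R),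
        z = ∑ l, embMap k (s l) ≫ embMap k (r l) ≫ z := by
    intro Z R z
    obtain ⟨n, Y, s, r, hY, e⟩ := hG Z
    refine ⟨n, Y, s, r, hY, fun z => ?_⟩
    simp only [← reassoc_of% @embMap_comp, ← Preadditive.sum_comp, ← embMap_sum, e]
    simp
  refine isIso_of_bijective x (fun Z z hz => ?_) (fun Z z => ?_)
  · obtain ⟨n, Y, s, r, hY, e⟩ := dec Z z
    rw [e z]
    refine Finset.sum_eq_zero fun l _ => ?_
    rw [hinj (Y l) (hY l) (embMap k (r l) ≫ z) (by rw [Category.assoc, hz, comp_zero]),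
      comp_zero]
  · obtain ⟨n, Y, s, r, hY, e⟩ := dec Z z
    choose y hy using fun l => hsurj (Y l) (hY l) (embMap k (r l) ≫ z)
    refine ⟨∑ l, embMap k (s l) ≫ y l, ?_⟩
    rw [Preadditive.sum_comp, e z]
    simp only [Category.assoc, hy]

/-- Embedded objects are projective. -/
lemma emb_lift_of_epi {P Q : ProjAb k 𝒜} (x : P ⟶ Q) [Epi x] {Z : 𝒜} (z : emb k Z ⟶ Q) :
    ∃ y, y ≫ x = z := by
  obtain ⟨g, hg, rfl⟩ := homMk_surj x
  let arr : ∀ t : Option (Fin Q.n), (t.elim P.pt Q.src) ⟶ Q.pt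
    | none => g
    | some t => Q.arr t
  let e := finSuccEquiv Q.n
  -- `R` is the cokernel of `x`, formed by adjoining `g` (the index `none`) to the arrows of `Q`. As
  -- `x` is epi, the projection `Q ⟶ R` vanishes, so the identity of `Q.pt` is a combination of `g`
  -- and the arrows of `Q`.
  let R : ProjAb k 𝒜 :=
    { pt := Q.pt
      n := Q.n + 1
      src := fun t => (e t).elim P.pt Q.src
      arr := fun t => arr (e t) }
  have harr : ∀ t, arr t ∈ R.image _ := fun t => by
    obtain ⟨t, rfl⟩ := e.surjective t
    exact R.arr_mem t
  have hq : 𝟙 Q.pt ∈ homSub Q R := fun t => by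
    rw [Category.comp_id]
    exact harr (some t)
  have hzero : homMk (Q := R) (𝟙 Q.pt) hq = 0 := by
    rw [← cancel_epi (homMk g hg), comp_zero, homMk_comp]
    refine (homMk_eq_iff _ (Submodule.zero_mem _)).2 ?_
    rw [sub_zero, Category.comp_id]
    exact harr none
  have hid : 𝟙 Q.pt ∈ R.image Q.pt := by
    have := (homMk_eq_iff _ (Submodule.zero_mem _)).1 hzero
    rwa [sub_zero] at this
  obtain ⟨f, rfl⟩ := exists_emb_lift z
  obtain ⟨q, hq⟩ := R.comp_mem f hid
  -- Modulo the image of `Q` only the summand at `none` survives, and it factors through `g`.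
  have key : ∀ t (u : Z ⟶ t.elim P.pt Q.src), ∃ y : Z ⟶ P.pt, u ≫ arr t - y ≫ g ∈ Q.image Z := by
    rintro (_ | t) u
    · exact ⟨u, (congrArg (· ∈ Q.image Z) (sub_self (u ≫ g))).mpr (Submodule.zero_mem _)⟩
    · exact ⟨0, by rw [zero_comp, sub_zero]; exact Q.comp_arr_mem t u⟩
  choose y hy using fun t => key (e t) (q t)
  refine ⟨embMap k (∑ t, y t) ≫ P.proj, Eq.symm ?_⟩
  refine (homMk_eq_iff (P := emb k Z) (mem_of_emb _) (mem_of_emb _)).2 ?_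
  change f ≫ 𝟙 Q.pt - ((∑ t, y t) ≫ 𝟙 P.pt) ≫ g ∈ Q.image Z
  rw [hq, Category.comp_id, Preadditive.sum_comp, ← Finset.sum_sub_distrib]
  exact Submodule.sum_mem _ fun t _ => hy t

instance projective_emb (Z : 𝒜) : Projective (emb k Z) where
  factors z x _ := emb_lift_of_epi x z

/-- Projective objects are embedded ones, if idempotents split. -/
lemma exists_iso_emb_of_projective [IsIdempotentComplete 𝒜] (P : ProjAb k 𝒜) [Projective P] :
    ∃ Z : 𝒜, Nonempty (P ≅ emb k Z) := by
  -- The section `s` makes `P` a retract of an embedded object. The embedding is fully faithful, so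
  -- the resulting idempotent comes from `𝒜`, where it splits.
  let s := Projective.factorThru (𝟙 P) P.proj
  have hs : s ≫ P.proj = 𝟙 P := Projective.factorThru_comp _ _
  obtain ⟨p, hp⟩ := embMap_surjective (P.proj ≫ s)
  have hpp : p ≫ p = p := embMap_injective (k := k) (by
    rw [embMap_comp, ← hp, Category.assoc, reassoc_of% hs])
  obtain ⟨Z, i, e, hie, hei⟩ := IsIdempotentComplete.idempotents_split P.pt p hpp
  refine ⟨Z, ⟨⟨s ≫ embMap k e, embMap k i ≫ P.proj, ?_, ?_⟩⟩⟩
  · rw [Category.assoc, ← reassoc_of% @embMap_comp, hei, ← hp, Category.assoc, reassoc_of% hs, hs]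
  · rw [Category.assoc, reassoc_of% hp, ← embMap_comp, ← embMap_comp, ← hei, Category.assoc, hie,
      Category.comp_id, hie, embMap_id]

section Map

variable {ℬ : Type*} [Category ℬ] [Preadditive ℬ] [Linear k ℬ]

/-- An object with no arrows is embedded. -/
def mapEmbIso (E : 𝒜 ⥤ ℬ) [E.Additive] (X : 𝒜) : (mapFunctor k E).obj (emb k X) ≅ emb k (E.obj X) :=
  isoMk (P := mapObj E (emb k X)) (Q := emb k (E.obj X)) (Iso.refl _) (fun i => i.elim0)
    (fun i => i.elim0)

lemma mapEmbIso_hom_naturality (E : 𝒜 ⥤ ℬ) [E.Additive] {X Y : 𝒜} (f : X ⟶ Y) :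
    (mapFunctor k E).map (embMap k f) ≫ (mapEmbIso E Y).hom =
      (mapEmbIso E X).hom ≫ embMap k (E.map f) :=
  homMk_congr (P := mapObj E (emb k X)) (Q := emb k (E.obj Y))
    ((Category.comp_id _).trans (Category.id_comp _).symm)

instance mapFunctor_additive (E : 𝒜 ⥤ ℬ) [E.Additive] : (mapFunctor k E).Additive where
  map_add {P Q x y} := by
    obtain ⟨g, hg, rfl⟩ := homMk_surj x
    obtain ⟨g', hg', rfl⟩ := homMk_surj y
    exact homMk_congr (P := mapObj E P) (Q := mapObj E Q) E.map_add

/-- The canonical projection to the image of `P`. -/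
def mapProj (E : 𝒜 ⥤ ℬ) [E.Additive] (P : ProjAb k 𝒜) :
    emb k (E.obj P.pt) ⟶ (mapFunctor k E).obj P := (mapObj E P).proj

instance (E : 𝒜 ⥤ ℬ) [E.Additive] (P : ProjAb k 𝒜) : Epi (mapProj E P) :=
  inferInstanceAs (Epi (mapObj E P).proj)

lemma mapProj_naturality (E : 𝒜 ⥤ ℬ) [E.Additive] {P Q : ProjAb k 𝒜} (g : P.pt ⟶ Q.pt)
    (hg : g ∈ homSub P Q) :
    mapProj E P ≫ (mapFunctor k E).map (homMk g hg) = embMap k (E.map g) ≫ mapProj E Q :=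
  homMk_congr (P := emb k (E.obj P.pt)) (Q := mapObj E Q)
    ((Category.id_comp _).trans (Category.comp_id _).symm)

@[simp]
lemma map_arr_mapProj (E : 𝒜 ⥤ ℬ) [E.Additive] (P : ProjAb k 𝒜) (t : Fin P.n) :
    embMap k (E.map (P.arr t)) ≫ mapProj E P = 0 :=
  arr_proj (mapObj E P) t

lemma exists_mapProj_desc (E : 𝒜 ⥤ ℬ) [E.Additive] {P : ProjAb k 𝒜} {Q : ProjAb k ℬ}
    (x : emb k (E.obj P.pt) ⟶ Q) (hx : ∀ t, embMap k (E.map (P.arr t)) ≫ x = 0) :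
    ∃ y : (mapFunctor k E).obj P ⟶ Q, mapProj E P ≫ y = x :=
  exists_desc (P := mapObj E P) x hx

lemma homMk_eq_zero_iff {P Q : ProjAb k 𝒜} (g : P.pt ⟶ Q.pt) (hg : g ∈ homSub P Q) :
    homMk g hg = 0 ↔ g ∈ Q.image P.pt := by
  refine (homMk_eq_iff _ (Submodule.zero_mem _)).trans ?_
  rw [sub_zero]

/-- Finitely many generators of the functor `F ↦ Hom(E F, P)`, then finitely many generators of the
relations between them, form a presentation by representables. Read as an object `Q` of the
abelianization, it represents the functor on embedded objects, and then on all objects because they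
are cokernels of embedded ones. -/
lemma exists_universal_arrow [IsFinitaryCategory k 𝒜] (E : 𝒜 ⥤ ℬ) [E.Additive] [E.Linear k]
    (hℬ : ∀ X Y : ℬ, FiniteDimensional k (X ⟶ Y)) (P : ProjAb k ℬ) :
    ∃ (Q : ProjAb k 𝒜) (c : (mapFunctor k E).obj Q ⟶ P),
      ∀ (Q' : ProjAb k 𝒜) (y : (mapFunctor k E).obj Q' ⟶ P),
        ∃! x : Q' ⟶ Q, (mapFunctor k E).map x ≫ c = y := by
  have h𝒜 : HasFiniteBiproducts 𝒜 := IsFinitaryCategory.hasFiniteBiproducts (k := k)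
  obtain ⟨m, G, z, hz⟩ : ∃ (m : ℕ) (G : Fin m → 𝒜) (z : ∀ t, emb k (E.obj (G t)) ⟶ P),
      ∀ (F : 𝒜) (y : emb k (E.obj F) ⟶ P),
        ∃ f : ∀ t, F ⟶ G t, y = ∑ t, embMap k (E.map (f t)) ≫ z t := by
    have : (E ⋙ embFunctor k ℬ).Additive := inferInstance
    have : (E ⋙ embFunctor k ℬ).Linear k := inferInstance
    obtain ⟨m, G, z, -, hz⟩ := IsFinitaryCategory.exists_finite_generation (k := k)
      (E ⋙ embFunctor k ℬ) P (fun _ => finiteDimensional_hom hℬ _ _) (fun _ => ⊤)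
      (fun _ _ _ => trivial)
    exact ⟨m, G, z, fun F y => hz F y trivial⟩
  -- All generators are assembled into a single one on the direct sum, through which every morphism
  -- `E F ⟶ P` factors.
  let zG : emb k (E.obj (⨁ G)) ⟶ P := ∑ t, embMap k (E.map (biproduct.π G t)) ≫ z t
  have lift : ∀ (F : 𝒜) (y : emb k (E.obj F) ⟶ P), ∃ f : F ⟶ ⨁ G, embMap k (E.map f) ≫ zG = y := by
    intro F y
    obtain ⟨f, hf⟩ := hz F y
    refine ⟨biproduct.lift f, Eq.trans ?_ hf.symm⟩
    rw [Preadditive.comp_sum]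
    refine Finset.sum_congr rfl fun t _ => ?_
    rw [← reassoc_of% @embMap_comp, ← E.map_comp, biproduct.lift_π]
  -- `K` is the subfunctor of relations in `Hom(-, ⨁ G)`; its finitely many generators become the
  -- arrows of `Q`.
  let K : ∀ F, Submodule k (F ⟶ ⨁ G) := fun F => LinearMap.ker
    ({ toFun := fun f => embMap k (E.map f) ≫ zG
       map_add' := fun f g => by
         rw [E.map_add, ← Preadditive.add_comp]; rfl
       map_smul' := fun c f => by
         rw [E.map_smul, RingHom.id_apply, ← Linear.smul_comp]; rfl } :
       (F ⟶ ⨁ G) →ₗ[k] (emb k (E.obj F) ⟶ P))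
  have hK : ∀ (F : 𝒜) (f : F ⟶ ⨁ G), f ∈ K F ↔ embMap k (E.map f) ≫ zG = 0 :=
    fun _ _ => Iff.rfl
  obtain ⟨n, S, a, ha, hgen⟩ := IsFinitaryCategory.exists_finite_generation (k := k)
    (𝟭 𝒜) (⨁ G) (fun F => IsFinitaryCategory.finiteDimensional_hom (k := k) F (⨁ G)) K
    (fun {F F'} f f' hf' => (hK _ _).2 (by
      have hf'' := (hK _ _).1 hf'
      rw [Functor.id_map, E.map_comp, embMap_comp, Category.assoc, hf'', comp_zero]))
  let Q : ProjAb k 𝒜 := { pt := ⨁ G, n := n, src := S, arr := a }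
  have hQ : ∀ (F : 𝒜) (f : F ⟶ ⨁ G), f ∈ Q.image F ↔ f ∈ K F := by
    intro F f
    constructor
    · rintro ⟨q, rfl⟩
      refine Submodule.sum_mem _ fun t _ => (hK _ _).2 ?_
      rw [E.map_comp, embMap_comp, Category.assoc]
      exact (congrArg _ ((hK _ _).1 (ha t))).trans comp_zero
    · intro hf
      obtain ⟨q, hq⟩ := hgen F f hf
      exact ⟨q, hq⟩
  obtain ⟨c, hc⟩ := exists_mapProj_desc (P := Q) E zG ha
  refine ⟨Q, c, fun Q' y => ?_⟩
  obtain ⟨f, hf⟩ := lift Q'.pt (mapProj E Q' ≫ y)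
  have hfm : f ∈ homSub Q' Q := fun t => (hQ _ _).2 ((hK _ _).2 (by
    rw [E.map_comp, embMap_comp, Category.assoc, hf, reassoc_of% @map_arr_mapProj, zero_comp]))
  refine ⟨homMk f hfm, ?_, fun x hx => ?_⟩
  · change (mapFunctor k E).map (homMk f hfm) ≫ c = y
    rw [← cancel_epi (mapProj E Q'), reassoc_of% @mapProj_naturality, hc, hf]
  · obtain ⟨g, hg, rfl⟩ := homMk_surj x
    refine (homMk_eq_iff _ _).2 ((hQ _ _).2 ((hK _ _).2 ?_))
    have h : mapProj E Q' ≫ (mapFunctor k E).map (homMk g hg) ≫ c = _ ≫ y :=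
      congrArg (mapProj E Q' ≫ ·) hx
    rw [reassoc_of% @mapProj_naturality, hc, ← hf] at h
    rw [E.map_sub]
    exact (Preadditive.sub_comp _ _ _).trans (sub_eq_zero.2 h)

/-- For a functor from a finitary category to a `Hom`-finite category, the induced functor
between projective abelianizations has a right adjoint. -/
lemma mapFunctor_isLeftAdjoint [IsFinitaryCategory k 𝒜] (E : 𝒜 ⥤ ℬ) [E.Additive] [E.Linear k]
    (hℬ : ∀ X Y : ℬ, FiniteDimensional k (X ⟶ Y)) : (mapFunctor k E).IsLeftAdjoint := by
  have key : ∀ P : ProjAb k ℬ, HasTerminal (CostructuredArrow (mapFunctor k E) P) := by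
    intro P
    obtain ⟨Q, c, hc⟩ := exists_universal_arrow E hℬ P
    exact IsTerminal.hasTerminal (X := CostructuredArrow.mk c) (IsTerminal.ofUniqueHom
      (fun Y => CostructuredArrow.homMk (hc _ Y.hom).choose (hc _ Y.hom).choose_spec.1)
      fun Y f => CostructuredArrow.ext _ _ ((hc _ Y.hom).choose_spec.2 _ (CostructuredArrow.w f)))
  exact isLeftAdjoint_of_costructuredArrowTerminals _

end Map

end ProjAb

/-! ### Generation in transitive 2-representations. -/

namespace TwoRep

variable {k : Type uk} [Field k] {C : Type u} [Bicategory.{w, v} C] [PreadditiveBicategory C]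
  [LinearBicategory k C]

/-- Decompositions of the `Z l` compose with that of `Y` into one indexed by pairs. This is the
closure required by the counting argument. -/
lemma gen_of_isSummandOfSum (M : TwoRep k C) {a b : C} (X : M.toPseudo.obj a)
    (Y : M.toPseudo.obj b) (h : IsSummandOfSum ((M.gen X).prop b) Y) : (M.gen X).prop b Y := by
  obtain ⟨n, Z, s, r, hZ, e⟩ := h
  choose m F s' r' e' using hZ
  let e₀ : (Σ l, Fin (m l)) ≃ Fin (Fintype.card (Σ l, Fin (m l))) := Fintype.equivFin _
  refine ⟨_, fun t => F (e₀.symm t).1 (e₀.symm t).2,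
    fun t => s (e₀.symm t).1 ≫ s' (e₀.symm t).1 (e₀.symm t).2,
    fun t => r' (e₀.symm t).1 (e₀.symm t).2 ≫ r (e₀.symm t).1, ?_⟩
  rw [e₀.symm.sum_comp (fun t : Σ l, Fin (m l) => (s t.1 ≫ s' t.1 t.2) ≫ r' t.1 t.2 ≫ r t.1),
    Fintype.sum_sigma, ← e]
  refine Finset.sum_congr rfl fun l _ => ?_
  have : s l ≫ r l = s l ≫ (∑ c, s' l c ≫ r' l c) ≫ r l := by rw [e', Category.id_comp]
  rw [this]
  simp [Preadditive.comp_sum, Preadditive.sum_comp]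

/-- In a transitive `2`-representation, every nonzero object generates everything. -/
lemma IsTransitive.gen_eq_top {M : TwoRep k C} (hM : M.IsTransitive) {a b : C}
    {X : M.toPseudo.obj a} (hX : ¬ IsZero X) (Y : M.toPseudo.obj b) : (M.gen X).prop b Y := by
  -- `E` need not be related to the inclusion of `add {F X}`, which is why the counting lemma is
  -- needed.
  obtain ⟨E⟩ := hM.2 a X hX
  have := hM.1 b
  let E' : ((M.gen X).prop b).FullSubcategory ⥤ M.toPseudo.obj b := (E.trans.app b).toFunctor
  have : E'.Additive := E.additive b
  have : E'.IsEquivalence := E.isEquivalence b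
  exact IsFinitaryCategory.prop_of_equivalence (k := k) ((M.gen X).prop b)
    (M.gen_of_isSummandOfSum X) E' Y

lemma isSummandOfSum_of_gen {M : TwoRep k C} {a b : C} {X : M.toPseudo.obj a}
    {Y : M.toPseudo.obj b} (h : (M.gen X).prop b Y) :
    IsSummandOfSum (fun Z => ∃ F : a ⟶ b, Z = (M.toPseudo.map F).toFunctor.obj X) Y := by
  obtain ⟨n, F, s, r, e⟩ := h
  exact ⟨n, _, s, r, fun l => ⟨F l, rfl⟩, e⟩

end TwoRep

/-! ### Category-valued pseudofunctors and strong transformations in components. -/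

namespace CatAction

open scoped Pseudofunctor.StrongTrans

variable {C : Type u} [Bicategory.{w, v} C] (T : Pseudofunctor C Cat.{v₁, u₁})

/-- The functor by which a `1`-morphism acts. -/
abbrev fn {a b : C} (f : a ⟶ b) : T.obj a ⥤ T.obj b := (T.map f).toFunctor

/-- The components of the natural transformation by which a `2`-morphism acts. -/
abbrev nt {a b : C} {f g : a ⟶ b} (η : f ⟶ g) (X : T.obj a) : (fn T f).obj X ⟶ (fn T g).obj X :=
  (T.map₂ η).toNatTrans.app X

/-- The compatibility of the action with composition. -/
@[simps]
def cmp {a b c : C} (f : a ⟶ b) (g : b ⟶ c) (X : T.obj a) :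
    (fn T (f ≫ g)).obj X ≅ (fn T g).obj ((fn T f).obj X) where
  hom := (T.mapComp f g).hom.toNatTrans.app X
  inv := (T.mapComp f g).inv.toNatTrans.app X
  hom_inv_id := Cat.Hom.hom_inv_id_toNatTrans_app (T.mapComp f g) X
  inv_hom_id := Cat.Hom.inv_hom_id_toNatTrans_app (T.mapComp f g) X

/-- The compatibility of the action with identities. -/
def unt {a : C} (X : T.obj a) : (fn T (𝟙 a)).obj X ≅ X where
  hom := (T.mapId a).hom.toNatTrans.app X
  inv := (T.mapId a).inv.toNatTrans.app X
  hom_inv_id := Cat.Hom.hom_inv_id_toNatTrans_app (T.mapId a) X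
  inv_hom_id := Cat.Hom.inv_hom_id_toNatTrans_app (T.mapId a) X

@[simp]
lemma nt_id {a b : C} (f : a ⟶ b) (X : T.obj a) : nt T (𝟙 f) X = 𝟙 _ :=
  congrArg (fun t => t.toNatTrans.app X) (T.map₂_id f)

lemma nt_comp {a b : C} {f g h : a ⟶ b} (η : f ⟶ g) (θ : g ⟶ h) (X : T.obj a) :
    nt T (η ≫ θ) X = nt T η X ≫ nt T θ X :=
  congrArg (fun t => t.toNatTrans.app X) (T.map₂_comp η θ)

lemma nt_naturality {a b : C} {f g : a ⟶ b} (η : f ⟶ g) {X Y : T.obj a} (x : X ⟶ Y) :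
    (fn T f).map x ≫ nt T η Y = nt T η X ≫ (fn T g).map x :=
  (T.map₂ η).toNatTrans.naturality x

lemma cmp_naturality {a b c : C} (f : a ⟶ b) (g : b ⟶ c) {X Y : T.obj a} (x : X ⟶ Y) :
    (fn T (f ≫ g)).map x ≫ (cmp T f g Y).hom =
      (cmp T f g X).hom ≫ (fn T g).map ((fn T f).map x) :=
  (T.mapComp f g).hom.toNatTrans.naturality x

lemma unt_naturality {a : C} {X Y : T.obj a} (x : X ⟶ Y) :
    (fn T (𝟙 a)).map x ≫ (unt T Y).hom = (unt T X).hom ≫ x :=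
  (T.mapId a).hom.toNatTrans.naturality x

lemma nt_whiskerRight {a b c : C} {f f' : a ⟶ b} (η : f ⟶ f') (g : b ⟶ c) (X : T.obj a) :
    nt T (η ▷ g) X ≫ (cmp T f' g X).hom = (cmp T f g X).hom ≫ (fn T g).map (nt T η X) := by
  have h : nt T (η ▷ g) X = (cmp T f g X).hom ≫ (fn T g).map (nt T η X) ≫ (cmp T f' g X).inv :=
    congrArg (fun t => t.toNatTrans.app X) (T.map₂_whisker_right η g)
  rw [h, Category.assoc, Category.assoc, Iso.inv_hom_id, Category.comp_id]

lemma nt_whiskerLeft {a b c : C} (f : a ⟶ b) {g g' : b ⟶ c} (η : g ⟶ g') (X : T.obj a) :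
    nt T (f ◁ η) X ≫ (cmp T f g' X).hom = (cmp T f g X).hom ≫ nt T η ((fn T f).obj X) := by
  have h : nt T (f ◁ η) X = (cmp T f g X).hom ≫ nt T η ((fn T f).obj X) ≫ (cmp T f g' X).inv :=
    congrArg (fun t => t.toNatTrans.app X) (T.map₂_whisker_left f η)
  rw [h, Category.assoc, Category.assoc, Iso.inv_hom_id, Category.comp_id]

lemma nt_associator {a b c d : C} (f : a ⟶ b) (g : b ⟶ c) (h : c ⟶ d) (X : T.obj a) :
    nt T (α_ f g h).hom X ≫ (cmp T f (g ≫ h) X).hom ≫ (cmp T g h ((fn T f).obj X)).hom =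
      (cmp T (f ≫ g) h X).hom ≫ (fn T h).map (cmp T f g X).hom := by
  have h : nt T (α_ f g h).hom X = (cmp T (f ≫ g) h X).hom ≫ (fn T h).map (cmp T f g X).hom ≫
      𝟙 _ ≫ (cmp T g h ((fn T f).obj X)).inv ≫ (cmp T f (g ≫ h) X).inv :=
    congrArg (fun t => t.toNatTrans.app X) (T.map₂_associator f g h)
  rw [h]
  simp only [Category.assoc, Iso.inv_hom_id_assoc, Iso.inv_hom_id, Category.comp_id,
    Category.id_comp]

lemma cmp_id_left {a b : C} (f : a ⟶ b) (X : T.obj a) :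
    (cmp T (𝟙 a) f X).hom ≫ (fn T f).map (unt T X).hom = nt T (λ_ f).hom X := by
  have h : nt T (λ_ f).hom X = (cmp T (𝟙 a) f X).hom ≫ (fn T f).map (unt T X).hom ≫ 𝟙 _ :=
    congrArg (fun t => t.toNatTrans.app X) (T.map₂_left_unitor f)
  rw [h, Category.comp_id]

lemma cmp_id_right {a b : C} (f : a ⟶ b) (X : T.obj a) :
    (cmp T f (𝟙 b) X).hom ≫ (unt T ((fn T f).obj X)).hom = nt T (ρ_ f).hom X := by
  have h : nt T (ρ_ f).hom X =
      (cmp T f (𝟙 b) X).hom ≫ (unt T ((fn T f).obj X)).hom ≫ 𝟙 _ :=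
    congrArg (fun t => t.toNatTrans.app X) (T.map₂_right_unitor f)
  rw [h, Category.comp_id]

/-- An arrow of the inner 1-morphism meets `e` under the functor of `g`, where the composite
vanishes. Together with `nt_whiskerLeft_act` this makes `evAct` well defined. -/
lemma nt_whiskerRight_act_eq_zero [∀ a, Preadditive (T.obj a)] {a b c : C} {f f' : a ⟶ b}
    (η : f ⟶ f') (g : b ⟶ c) [(fn T g).Additive] {X : T.obj a} {Y : T.obj b}
    (e : (fn T f').obj X ⟶ Y) (h : nt T η X ≫ e = 0) :
    nt T (η ▷ g) X ≫ (cmp T f' g X).hom ≫ (fn T g).map e = 0 := by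
  rw [reassoc_of% @nt_whiskerRight, ← Functor.map_comp, h, Functor.map_zero, comp_zero]

/-- An arrow of the outer 1-morphism slides past `e` and ends as the last factor, hence in the image
of the presentation of the target. -/
lemma nt_whiskerLeft_act {a b c : C} (f : a ⟶ b) {g g' : b ⟶ c} (η : g ⟶ g') {X : T.obj a}
    {Y : T.obj b} (e : (fn T f).obj X ⟶ Y) :
    nt T (f ◁ η) X ≫ (cmp T f g' X).hom ≫ (fn T g').map e =
      ((cmp T f g X).hom ≫ (fn T g).map e) ≫ nt T η Y := by
  rw [reassoc_of% @nt_whiskerLeft, Category.assoc, ← nt_naturality]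

/-- The morphism `e` concerns only the innermost 1-morphism, so applying it commutes with a further
action from outside. -/
lemma nt_associator_act {a b c d : C} (f : a ⟶ b) (g : b ⟶ c) (h : c ⟶ d) {X : T.obj a}
    {Y : T.obj b} (e : (fn T f).obj X ⟶ Y) :
    nt T (α_ f g h).hom X ≫ ((cmp T f (g ≫ h) X).hom ≫ (fn T (g ≫ h)).map e) ≫
      (cmp T g h Y).hom =
    (cmp T (f ≫ g) h X).hom ≫ (fn T h).map ((cmp T f g X).hom ≫ (fn T g).map e) := by
  rw [Category.assoc, cmp_naturality, reassoc_of% @nt_associator, Functor.map_comp]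

/-- Acting by a composite is acting twice; this is the source of associativity of `[N, N]` and of
its modules. -/
lemma act_comp {a b c d : C} (f : a ⟶ b) (g : b ⟶ c) (h : c ⟶ d) {X : T.obj a}
    {Y : T.obj b} {Z : T.obj c} (e : (fn T f).obj X ⟶ Y) (e' : (fn T g).obj Y ⟶ Z) :
    (cmp T (f ≫ g) h X).hom ≫
      (fn T h).map (((cmp T f g X).hom ≫ (fn T g).map e) ≫ e') =
    nt T (α_ f g h).hom X ≫ ((cmp T f (g ≫ h) X).hom ≫ (fn T (g ≫ h)).map e) ≫
      (cmp T g h Y).hom ≫ (fn T h).map e' := by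
  simp only [Functor.map_comp, Category.assoc]
  rw [reassoc_of% @cmp_naturality, reassoc_of% @nt_associator]

lemma act_unit {a b : C} (f : a ⟶ b) {X : T.obj a} {Y : T.obj b} (e : (fn T f).obj X ⟶ Y) :
    ((cmp T f (𝟙 b) X).hom ≫ (fn T (𝟙 b)).map e) ≫ (unt T Y).hom = nt T (ρ_ f).hom X ≫ e := by
  rw [Category.assoc, unt_naturality, reassoc_of% @cmp_id_right]

/-- Construction of strong transformations in terms of components. -/
def strongTransMk {T T' : Pseudofunctor C Cat.{v₁, u₁}} (F : ∀ a, T.obj a ⥤ T'.obj a)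
    (e : ∀ {a b : C} (f : a ⟶ b) (X : T.obj a),
      (F b).obj ((fn T f).obj X) ≅ (fn T' f).obj ((F a).obj X))
    (nat : ∀ {a b : C} (f : a ⟶ b) {X Y : T.obj a} (x : X ⟶ Y),
      (F b).map ((fn T f).map x) ≫ (e f Y).hom = (e f X).hom ≫ (fn T' f).map ((F a).map x))
    (nat₂ : ∀ {a b : C} {f g : a ⟶ b} (η : f ⟶ g) (X : T.obj a),
      (F b).map (nt T η X) ≫ (e g X).hom = (e f X).hom ≫ nt T' η ((F a).obj X))
    (id : ∀ {a : C} (X : T.obj a),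
      (e (𝟙 a) X).hom ≫ (unt T' ((F a).obj X)).hom = (F a).map (unt T X).hom)
    (comp : ∀ {a b c : C} (f : a ⟶ b) (g : b ⟶ c) (X : T.obj a),
      (e (f ≫ g) X).hom ≫ (cmp T' f g ((F a).obj X)).hom =
        (F c).map (cmp T f g X).hom ≫ (e g ((fn T f).obj X)).hom ≫ (fn T' g).map (e f X).hom) :
    T ⟶ T' :=
  { app := fun a => (F a).toCatHom
    naturality := fun {a b} f => Cat.Hom.isoMk (NatIso.ofComponents (fun X => e f X)
      (fun {X Y} x => nat f x))
    naturality_naturality := by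
      intro a b f g η
      ext X
      exact nat₂ η X
    naturality_id := by
      intro a
      ext X
      refine (id X).trans ?_
      exact (Eq.trans (congrArg _ (Category.comp_id _)) (Category.comp_id _)).symm
    naturality_comp := by
      intro a b c f g
      ext X
      refine (comp f g X).trans ?_
      change _ = (F c).map (cmp T f g X).hom ≫ 𝟙 _ ≫ (e g ((fn T f).obj X)).hom ≫ 𝟙 _ ≫
        (fn T' g).map (e f X).hom ≫ 𝟙 _
      simp only [Category.id_comp, Category.comp_id] }

/-- Construction of strong transformations from their inverse structure isomorphisms. -/
def strongTransMkInv {T T' : Pseudofunctor C Cat.{v₁, u₁}} (F : ∀ a, T.obj a ⥤ T'.obj a)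
    (e : ∀ {a b : C} (f : a ⟶ b) (X : T.obj a),
      (fn T' f).obj ((F a).obj X) ≅ (F b).obj ((fn T f).obj X))
    (nat : ∀ {a b : C} (f : a ⟶ b) {X Y : T.obj a} (x : X ⟶ Y),
      (fn T' f).map ((F a).map x) ≫ (e f Y).hom = (e f X).hom ≫ (F b).map ((fn T f).map x))
    (nat₂ : ∀ {a b : C} {f g : a ⟶ b} (η : f ⟶ g) (X : T.obj a),
      nt T' η ((F a).obj X) ≫ (e g X).hom = (e f X).hom ≫ (F b).map (nt T η X))
    (id : ∀ {a : C} (X : T.obj a),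
      (e (𝟙 a) X).hom ≫ (F a).map (unt T X).hom = (unt T' ((F a).obj X)).hom)
    (comp : ∀ {a b c : C} (f : a ⟶ b) (g : b ⟶ c) (X : T.obj a),
      (e (f ≫ g) X).hom ≫ (F c).map (cmp T f g X).hom =
        (cmp T' f g ((F a).obj X)).hom ≫ (fn T' g).map (e f X).hom ≫
          (e g ((fn T f).obj X)).hom) :
    T ⟶ T' :=
  strongTransMk F (fun f X => (e f X).symm)
    (fun {_ _} f {X Y} x => by
      rw [Iso.symm_hom, Iso.symm_hom, Iso.comp_inv_eq, Category.assoc, nat, Iso.inv_hom_id_assoc])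
    (fun η X => by
      rw [Iso.symm_hom, Iso.symm_hom, Iso.comp_inv_eq, Category.assoc, nat₂, Iso.inv_hom_id_assoc])
    (fun X => by rw [Iso.symm_hom, Iso.inv_comp_eq, id])
    (fun f g X => by
      rw [Iso.symm_hom, Iso.symm_hom, Iso.symm_hom, Iso.inv_comp_eq, reassoc_of% (comp f g X),
        Iso.hom_inv_id_assoc, ← Functor.map_comp, Iso.hom_inv_id, CategoryTheory.Functor.map_id,
        Category.comp_id])

end CatAction

open CatAction


/-! ### Evaluation at `N` on the abelianized bicategory. -/

section Evaluation

variable {k : Type uk} [Field k] {C : Type u} [Bicategory.{w, v} C] [PreadditiveBicategory C]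
  [LinearBicategory k C] (M : TwoRep k C) {i : C} (N : M.toPseudo.obj i)

/-- The evaluation functor `F ↦ F N`. -/
def ev (j : C) : (i ⟶ j) ⥤ M.toPseudo.obj j where
  obj F := (fn M.toPseudo F).obj N
  map η := nt M.toPseudo η N
  map_id F := nt_id M.toPseudo F N
  map_comp η θ := nt_comp M.toPseudo η θ N

instance (j : C) : (ev M N j).Additive := ⟨fun {_ _ η θ} => M.map₂_add η θ N⟩

instance (j : C) : (ev M N j).Linear k := ⟨fun η t => M.map₂_smul t η N⟩

/-- The evaluation functor at `N`, on the projective abelianizations. -/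
def evBar (j : C) : ((⟨i⟩ : AbBicat k C) ⟶ ⟨j⟩) ⥤ M.bar.toPseudo.obj j :=
  ProjAb.mapFunctor k (ev M N j)

/-- An object `N` as an object of the projective abelianization. -/
def embObj {j : C} (N : M.toPseudo.obj j) : M.bar.toPseudo.obj j := ProjAb.emb k N

variable (k) in
/-- A `1`-morphism of `C` as a `1`-morphism of the projective abelianization. -/
def emb₁ {j l : C} (f : j ⟶ l) : (⟨j⟩ : AbBicat k C) ⟶ ⟨l⟩ := (AbBicat.embed k C).map f

variable (k) in
/-- A `2`-morphism of `C` as a `2`-morphism of the projective abelianization. -/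
def emb₂ {j l : C} {f g : j ⟶ l} (η : f ⟶ g) : emb₁ k f ⟶ emb₁ k g := (AbBicat.embed k C).map₂ η

variable (k) in
/-- The compatibility of the embedding with identities. -/
def embId (j : C) : emb₁ k (𝟙 j) ≅ 𝟙 (⟨j⟩ : AbBicat k C) := (AbBicat.embed k C).mapId j

variable (k) in
/-- The compatibility of the embedding with composition. -/
def embComp {j l m : C} (f : j ⟶ l) (g : l ⟶ m) : emb₁ k (f ≫ g) ≅ emb₁ k f ≫ emb₁ k g :=
  (AbBicat.embed k C).mapComp f g

-- The arrows of a composite are indexed through a disjoint union, so the two kinds of arrows can be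
-- tested separately.
set_option linter.unusedSectionVars false in
lemma mem_homSub_mapObj_comp {a b c : C} {𝒟 : Type*} [Category 𝒟] [Preadditive 𝒟] [Linear k 𝒟]
    (E : (a ⟶ c) ⥤ 𝒟) {P : ProjAb k (a ⟶ b)} {Q : ProjAb k (b ⟶ c)} {R : ProjAb k 𝒟}
    {g : E.obj (P.pt ≫ Q.pt) ⟶ R.pt}
    (h₁ : ∀ t, E.map (P.arr t ▷ Q.pt) ≫ g ∈ R.image (E.obj (P.src t ≫ Q.pt)))
    (h₂ : ∀ t, E.map (P.pt ◁ Q.arr t) ≫ g ∈ R.image (E.obj (P.pt ≫ Q.src t))) :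
    g ∈ ProjAb.homSub (ProjAb.mapObj E (AbBicat.comp P Q)) R := by
  have key : ∀ s, E.map (AbBicat.compArr P Q s) ≫ g ∈ R.image (E.obj (AbBicat.compSrc P Q s)) := by
    rintro (i | j)
    · exact h₁ i
    · exact h₂ j
  exact fun i => key _

/-- Evaluation commutes with the action. -/
def evStr {j l : C} (X : (⟨i⟩ : AbBicat k C) ⟶ ⟨j⟩) (f : j ⟶ l) :
    (evBar M N l).obj (X ≫ emb₁ k f) ≅
      (fn M.bar.toPseudo f).obj ((evBar M N j).obj X) :=
  ProjAb.isoMk (P := ProjAb.mapObj (ev M N l) (AbBicat.comp X (ProjAb.emb k f)))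
    (Q := ProjAb.mapObj (fn M.toPseudo f) (ProjAb.mapObj (ev M N j) X))
    (cmp M.toPseudo X.pt f N)
    (mem_homSub_mapObj_comp _
      (fun t => by
        have h : (ev M N l).map (X.arr t ▷ f) ≫ (cmp M.toPseudo X.pt f N).hom = _ :=
          nt_whiskerRight M.toPseudo (X.arr t) f N
        refine Eq.mpr (congrArg (· ∈ _) h) ?_
        exact ProjAb.comp_arr_mem (ProjAb.mapObj (fn M.toPseudo f) (ProjAb.mapObj (ev M N j) X)) t _)
      (fun t => t.elim0))
    (fun t => by
      have h : (fn M.toPseudo f).map (nt M.toPseudo (X.arr t) N) ≫ (cmp M.toPseudo X.pt f N).inv =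
          (cmp M.toPseudo (X.src t) f N).inv ≫ nt M.toPseudo (X.arr t ▷ f) N := by
        rw [Iso.comp_inv_eq, Category.assoc, nt_whiskerRight, Iso.inv_hom_id_assoc]
      refine Eq.mpr (congrArg (· ∈ _) h) ?_
      exact ProjAb.comp_mem _ _ (ProjAb.map_mem_image (ev M N l)
        (AbBicat.compArr_mem X (ProjAb.emb k f) (.inl t))))


variable {M N}

/-- The morphism of targets underlying a morphism to an embedded object. -/
def toEmb {j : C} {P : M.bar.toPseudo.obj j} {N : M.toPseudo.obj j} (y : P ⟶ embObj M N) :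
    ProjAb.pt P ⟶ N :=
  ProjAb.lift (P := P) (Q := ProjAb.emb k N) (fun g _ => g) (fun _ _ _ _ h => by
    obtain ⟨q, hq⟩ := h
    exact sub_eq_zero.1 (hq.trans (Finset.sum_eq_zero fun t _ => t.elim0))) y

lemma toEmb_mem {j : C} {P : M.bar.toPseudo.obj j} {N : M.toPseudo.obj j} (y : P ⟶ embObj M N) :
    toEmb y ∈ ProjAb.homSub P (ProjAb.emb k N) := by
  obtain ⟨g, hg, rfl⟩ := ProjAb.homMk_surj y
  exact hg

lemma arr_toEmb {j : C} {P : M.bar.toPseudo.obj j} {N : M.toPseudo.obj j} (y : P ⟶ embObj M N)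
    (t : Fin (ProjAb.n P)) : ProjAb.arr P t ≫ toEmb y = 0 := by
  obtain ⟨q, hq⟩ := toEmb_mem y t
  exact hq.trans (Finset.sum_eq_zero fun t _ => t.elim0)

/-- The morphism `X (Y N) ⟶ X N` induced by a morphism `Y N ⟶ N`. -/
def evAct (Y : (⟨i⟩ : AbBicat k C) ⟶ ⟨i⟩) (y : (evBar M N i).obj Y ⟶ embObj M N) {j : C}
    (X : (⟨i⟩ : AbBicat k C) ⟶ ⟨j⟩) : (evBar M N j).obj (Y ≫ X) ⟶ (evBar M N j).obj X :=
  ProjAb.homMk (P := ProjAb.mapObj (ev M N j) (AbBicat.comp Y X))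
    (Q := ProjAb.mapObj (ev M N j) X)
    ((cmp M.toPseudo (ProjAb.pt Y) (ProjAb.pt X) N).hom ≫
      (fn M.toPseudo (ProjAb.pt X)).map (toEmb y))
    (mem_homSub_mapObj_comp _
      (fun t => by
        refine Eq.mpr (congrArg (· ∈ _) (nt_whiskerRight_act_eq_zero M.toPseudo (ProjAb.arr Y t)
          (ProjAb.pt X) (toEmb y) (arr_toEmb y t))) (Submodule.zero_mem _))
      (fun t => by
        refine Eq.mpr (congrArg (· ∈ _) (nt_whiskerLeft_act M.toPseudo (ProjAb.pt Y)
          (ProjAb.arr X t) (toEmb y))) ?_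
        exact ProjAb.comp_arr_mem (ProjAb.mapObj (ev M N j) X) t _))

variable (M N) in
/-- The identity acts as the identity. -/
def evUnit : (evBar M N i).obj (𝟙 (⟨i⟩ : AbBicat k C)) ≅ embObj M N :=
  ProjAb.isoMk (P := ProjAb.mapObj (ev M N i) (ProjAb.emb k (𝟙 i))) (Q := ProjAb.emb k N)
    (unt M.toPseudo N) (fun t => t.elim0) (fun t => t.elim0)

variable (M N) in
/-- The evaluation of an embedded `1`-morphism. -/
def evEmb {j : C} (F : i ⟶ j) : (evBar M N j).obj (emb₁ k F) ≅
    (fn M.bar.toPseudo F).obj (embObj M N) :=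
  ProjAb.isoMk (P := ProjAb.mapObj (ev M N j) (ProjAb.emb k F))
    (Q := ProjAb.mapObj (fn M.toPseudo F) (ProjAb.emb k N)) (Iso.refl _)
    (fun t => t.elim0) (fun t => t.elim0)

section laws

variable {j l m : C} {X X' : (⟨i⟩ : AbBicat k C) ⟶ ⟨j⟩}
  {Y Y' : (⟨i⟩ : AbBicat k C) ⟶ ⟨i⟩}

lemma evStr_naturality (x : X ⟶ X') (f : j ⟶ l) :
    (evBar M N l).map (x ▷ emb₁ k f) ≫ (evStr M N X' f).hom =
      (evStr M N X f).hom ≫ (fn M.bar.toPseudo f).map ((evBar M N j).map x) := by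
  obtain ⟨g, hg, rfl⟩ := ProjAb.homMk_surj x
  exact ProjAb.homMk_congr (nt_whiskerRight M.toPseudo g f N)

variable (M N X) in
lemma evStr_naturality₂ {f f' : j ⟶ l} (η : f ⟶ f') :
    (evBar M N l).map (X ◁ emb₂ k η) ≫ (evStr M N X f').hom =
      (evStr M N X f).hom ≫ nt M.bar.toPseudo η ((evBar M N j).obj X) :=
  ProjAb.homMk_congr (nt_whiskerLeft M.toPseudo (ProjAb.pt X) η N)

variable (M N X) in
lemma evStr_comp (f : j ⟶ l) (g : l ⟶ m) :
    (evStr M N X (f ≫ g)).hom ≫ (cmp M.bar.toPseudo f g ((evBar M N j).obj X)).hom =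
      (evBar M N m).map (X ◁ (embComp k f g).hom ≫ (α_ _ _ _).inv) ≫
        (evStr M N (X ≫ emb₁ k f) g).hom ≫
          (fn M.bar.toPseudo g).map (evStr M N X f).hom :=
  ProjAb.homMk_congr (by
    change (cmp M.toPseudo (ProjAb.pt X) (f ≫ g) N).hom ≫ (cmp M.toPseudo f g _).hom =
      nt M.toPseudo (ProjAb.pt X ◁ 𝟙 _ ≫ (α_ (ProjAb.pt X) f g).inv) N ≫
      (cmp M.toPseudo (ProjAb.pt X ≫ f) g N).hom ≫
      (fn M.toPseudo g).map (cmp M.toPseudo (ProjAb.pt X) f N).hom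
    rw [← nt_associator, ← reassoc_of% @nt_comp]
    simp)

variable (M N X) in
lemma evStr_id :
    (evStr M N X (𝟙 j)).hom ≫ (unt M.bar.toPseudo ((evBar M N j).obj X)).hom =
      (evBar M N j).map (X ◁ (embId k j).hom ≫ (ρ_ X).hom) :=
  ProjAb.homMk_congr (by
    change (cmp M.toPseudo (ProjAb.pt X) (𝟙 j) N).hom ≫ (unt M.toPseudo _).hom =
      nt M.toPseudo (ProjAb.pt X ◁ 𝟙 _ ≫ (ρ_ (ProjAb.pt X)).hom) N
    rw [cmp_id_right]
    simp)

lemma evAct_naturality (y : (evBar M N i).obj Y ⟶ embObj M N) (x : X ⟶ X') :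
    (evBar M N j).map (Y ◁ x) ≫ evAct Y y X' = evAct Y y X ≫ (evBar M N j).map x := by
  obtain ⟨g, hg, rfl⟩ := ProjAb.homMk_surj x
  exact ProjAb.homMk_congr (nt_whiskerLeft_act M.toPseudo (ProjAb.pt Y) g (toEmb y))

-- Precomposition in the acting 1-morphism is absorbed into `y`. Thus maps into `[N, N]`, known only
-- through the counit, act in a computable way.
variable (X) in
lemma evAct_naturality_left (u : Y' ⟶ Y) (y : (evBar M N i).obj Y ⟶ embObj M N) :
    (evBar M N j).map (u ▷ X) ≫ evAct Y y X = evAct Y' ((evBar M N i).map u ≫ y) X := by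
  obtain ⟨g, hg, rfl⟩ := ProjAb.homMk_surj u
  obtain ⟨e, he, rfl⟩ := ProjAb.homMk_surj y
  refine ProjAb.homMk_congr ?_
  refine ((reassoc_of% nt_whiskerRight M.toPseudo g (ProjAb.pt X) N) _).trans ?_
  exact congrArg _ ((fn M.toPseudo (ProjAb.pt X)).map_comp (nt M.toPseudo g N) e).symm

variable (X) in
lemma evAct_comp_str (y : (evBar M N i).obj Y ⟶ embObj M N) (f : j ⟶ l) :
    (evBar M N l).map (α_ Y X (emb₁ k f)).hom ≫ evAct Y y (X ≫ _) ≫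
      (evStr M N X f).hom =
      (evStr M N (Y ≫ X) f).hom ≫ (fn M.bar.toPseudo f).map (evAct Y y X) :=
  ProjAb.homMk_congr (nt_associator_act M.toPseudo (ProjAb.pt Y) (ProjAb.pt X) f (toEmb y))

-- The composite `Y ≫ Y'` acts through `Y' (Y N) ⟶ Y' N ⟶ N`; for `Y = Y' = [N, N]` this becomes the
-- associativity law.
variable (X) in
lemma evAct_comp (y : (evBar M N i).obj Y ⟶ embObj M N)
    (y' : (evBar M N i).obj Y' ⟶ embObj M N) :
    evAct (Y ≫ Y') (evAct Y y Y' ≫ y') X =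
      (evBar M N j).map (α_ Y Y' X).hom ≫ evAct Y y (Y' ≫ X) ≫ evAct Y' y' X := by
  obtain ⟨e, he, rfl⟩ := ProjAb.homMk_surj y
  obtain ⟨e', he', rfl⟩ := ProjAb.homMk_surj y'
  exact ProjAb.homMk_congr
    (act_comp M.toPseudo (ProjAb.pt Y) (ProjAb.pt Y') (ProjAb.pt X) e e')

variable (X) in
lemma evAct_evUnit :
    evAct (𝟙 _) (evUnit M N).hom X = (evBar M N j).map (λ_ X).hom :=
  ProjAb.homMk_congr (cmp_id_left M.toPseudo (ProjAb.pt X) N)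

lemma evAct_unit (y : (evBar M N i).obj Y ⟶ embObj M N) :
    evAct Y y (𝟙 _) ≫ (evUnit M N).hom = (evBar M N i).map (ρ_ Y).hom ≫ y := by
  obtain ⟨e, he, rfl⟩ := ProjAb.homMk_surj y
  exact ProjAb.homMk_congr (act_unit M.toPseudo (ProjAb.pt Y) e)

/-- On a 1-morphism `F` of `C`, acting by `y` is just the functor of `F` applied to `y`. This later
identifies `endIhom` with `ihomStr`. -/
lemma evAct_emb (y : (evBar M N i).obj Y ⟶ embObj M N) (F : i ⟶ j) :
    evAct Y y (emb₁ k F) ≫ (evEmb M N F).hom =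
      (evStr M N Y F).hom ≫ (fn M.bar.toPseudo F).map y := by
  obtain ⟨e, he, rfl⟩ := ProjAb.homMk_surj y
  exact ProjAb.homMk_congr (Category.comp_id _)

end laws

end Evaluation


/-! ### The internal hom, the algebra `[N, N]` and its modules `[N, P]`. -/

section InternalHom

variable {k : Type uk} [Field k] {C : Type u} [Bicategory.{w, v} C] [PreadditiveBicategory C]
  [LinearBicategory k C] (M : TwoRep k C) {i : C} (N : M.toPseudo.obj i)
  [H : ∀ j, (evBar M N j).IsLeftAdjoint]

/-- The internal hom `[N, -]`, right adjoint to evaluation at `N`. -/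
noncomputable def ihom (j : C) : M.bar.toPseudo.obj j ⥤ ((⟨i⟩ : AbBicat k C) ⟶ ⟨j⟩) :=
  (evBar M N j).rightAdjoint

/-- The adjunction between evaluation and internal hom. -/
noncomputable def ihomAdj (j : C) : evBar M N j ⊣ ihom M N j :=
  Adjunction.ofIsLeftAdjoint (evBar M N j)

/-- The universal morphism `[N, P] N ⟶ P`. -/
noncomputable def coev {j : C} (P : M.bar.toPseudo.obj j) :
    (evBar M N j).obj ((ihom M N j).obj P) ⟶ P :=
  (ihomAdj M N j).counit.app P

lemma coev_naturality {j : C} {P Q : M.bar.toPseudo.obj j} (p : P ⟶ Q) :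
    (evBar M N j).map ((ihom M N j).map p) ≫ coev M N Q = coev M N P ≫ p :=
  (ihomAdj M N j).counit.naturality p

variable {M N}

/-- The morphism to an internal hom that corresponds to a morphism from an evaluation. -/
noncomputable def toIhom {j : C} {X : (⟨i⟩ : AbBicat k C) ⟶ ⟨j⟩} {P : M.bar.toPseudo.obj j}
    (y : (evBar M N j).obj X ⟶ P) : X ⟶ (ihom M N j).obj P :=
  (ihomAdj M N j).homEquiv X P y

@[simp]
lemma map_toIhom_coev {j : C} {X : (⟨i⟩ : AbBicat k C) ⟶ ⟨j⟩} {P : M.bar.toPseudo.obj j}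
    (y : (evBar M N j).obj X ⟶ P) : (evBar M N j).map (toIhom y) ≫ coev M N P = y := by
  have := ((ihomAdj M N j).homEquiv X P).symm_apply_apply y
  rwa [Adjunction.homEquiv_counit] at this

/-- The uniqueness half of the universal property. Identities between morphisms into `[N, P]` are
verified by evaluating at `N` and composing with the counit. -/
lemma ihom_hom_ext {j : C} {X : (⟨i⟩ : AbBicat k C) ⟶ ⟨j⟩} {P : M.bar.toPseudo.obj j}
    {x y : X ⟶ (ihom M N j).obj P}
    (h : (evBar M N j).map x ≫ coev M N P = (evBar M N j).map y ≫ coev M N P) : x = y := by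
  apply ((ihomAdj M N j).homEquiv X P).symm.injective
  rw [Adjunction.homEquiv_counit, Adjunction.homEquiv_counit]
  exact h

variable (M N)

/-- The algebra `1`-morphism `[N, N]`. -/
noncomputable abbrev iEnd : (⟨i⟩ : AbBicat k C) ⟶ ⟨i⟩ := (ihom M N i).obj (embObj M N)

/-- The right action of `[N, N]` on the evaluation of a `1`-morphism. -/
noncomputable def endAct {j : C} (X : (⟨i⟩ : AbBicat k C) ⟶ ⟨j⟩) :
    (evBar M N j).obj (iEnd M N ≫ X) ⟶ (evBar M N j).obj X :=
  evAct (iEnd M N) (coev M N (embObj M N)) X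

lemma endAct_naturality {j : C} {X X' : (⟨i⟩ : AbBicat k C) ⟶ ⟨j⟩} (x : X ⟶ X') :
    (evBar M N j).map (iEnd M N ◁ x) ≫ endAct M N X' = endAct M N X ≫ (evBar M N j).map x :=
  evAct_naturality _ x

lemma endAct_unit :
    endAct M N (𝟙 _) ≫ (evUnit M N).hom =
      (evBar M N i).map (ρ_ (iEnd M N)).hom ≫ coev M N (embObj M N) :=
  evAct_unit _

lemma endAct_str {j l : C} (X : (⟨i⟩ : AbBicat k C) ⟶ ⟨j⟩) (f : j ⟶ l) :
    (evBar M N l).map (α_ (iEnd M N) X (emb₁ k f)).hom ≫ endAct M N (X ≫ emb₁ k f) ≫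
      (evStr M N X f).hom =
      (evStr M N (iEnd M N ≫ X) f).hom ≫ (fn M.bar.toPseudo f).map (endAct M N X) :=
  evAct_comp_str X _ f

/-- The right action of `[N, N]` on `[N, P]`. -/
noncomputable def ihomAct {j : C} (P : M.bar.toPseudo.obj j) :
    iEnd M N ≫ (ihom M N j).obj P ⟶ (ihom M N j).obj P :=
  toIhom (endAct M N _ ≫ coev M N P)

lemma map_ihomAct_coev {j : C} (P : M.bar.toPseudo.obj j) :
    (evBar M N j).map (ihomAct M N P) ≫ coev M N P = endAct M N _ ≫ coev M N P :=
  map_toIhom_coev _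

/-- The unit of `[N, N]`. -/
noncomputable def endOne : 𝟙 (⟨i⟩ : AbBicat k C) ⟶ iEnd M N := toIhom (evUnit M N).hom

lemma map_endOne_coev :
    (evBar M N i).map (endOne M N) ≫ coev M N (embObj M N) = (evUnit M N).hom :=
  map_toIhom_coev _

/-- The multiplication of `[N, N]`. -/
noncomputable def endMul : iEnd M N ≫ iEnd M N ⟶ iEnd M N := ihomAct M N (embObj M N)

lemma map_endMul_coev :
    (evBar M N i).map (endMul M N) ≫ coev M N (embObj M N) =
      endAct M N (iEnd M N) ≫ coev M N (embObj M N) :=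
  map_toIhom_coev _

/-- The unit transposes the canonical isomorphism of `𝟙 N` with `N`, so it acts by that isomorphism.
-/
lemma endOne_endAct {j : C} (X : (⟨i⟩ : AbBicat k C) ⟶ ⟨j⟩) :
    (evBar M N j).map (endOne M N ▷ X) ≫ endAct M N X = (evBar M N j).map (λ_ X).hom := by
  rw [endAct, evAct_naturality_left, map_endOne_coev, evAct_evUnit]

/-- The multiplication transposes the twofold action on `N`, so acting by a product is acting twice.
The module laws of every `[N, P]` follow by transposition. -/
lemma endMul_endAct {j : C} (X : (⟨i⟩ : AbBicat k C) ⟶ ⟨j⟩) :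
    (evBar M N j).map (endMul M N ▷ X) ≫ endAct M N X =
      (evBar M N j).map (α_ _ _ X).hom ≫ endAct M N (iEnd M N ≫ X) ≫ endAct M N X := by
  rw [endAct, evAct_naturality_left, map_endMul_coev, endAct, evAct_comp]; rfl

lemma endOne_ihomAct {j : C} (P : M.bar.toPseudo.obj j) :
    endOne M N ▷ (ihom M N j).obj P ≫ ihomAct M N P = (λ_ _).hom := by
  apply ihom_hom_ext
  rw [Functor.map_comp, Category.assoc, map_ihomAct_coev, reassoc_of% @endOne_endAct]

lemma endMul_ihomAct {j : C} (P : M.bar.toPseudo.obj j) :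
    endMul M N ▷ (ihom M N j).obj P ≫ ihomAct M N P =
      (α_ _ _ _).hom ≫ iEnd M N ◁ ihomAct M N P ≫ ihomAct M N P := by
  apply ihom_hom_ext
  simp only [Functor.map_comp, Category.assoc]
  rw [map_ihomAct_coev, reassoc_of% @endMul_endAct, reassoc_of% @endAct_naturality, map_ihomAct_coev]

/-- Unlike the left unit law this is not a module law: it uses naturality of the action along the
unit and its value on the identity 1-morphism. -/
lemma endMul_endOne : iEnd M N ◁ endOne M N ≫ endMul M N = (ρ_ _).hom := by
  apply ihom_hom_ext
  rw [Functor.map_comp, Category.assoc, map_endMul_coev, reassoc_of% @endAct_naturality, map_endOne_coev,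
    endAct_unit]

/-- Left unit and associativity are the module laws of `[N, P]` at `P = N`. -/
noncomputable instance : MonObj (iEnd M N) where
  one := endOne M N
  mul := endMul M N
  one_mul := endOne_ihomAct M N (embObj M N)
  mul_one := endMul_endOne M N
  mul_assoc := endMul_ihomAct M N (embObj M N)

lemma ihomAct_naturality {j : C} {P Q : M.bar.toPseudo.obj j} (p : P ⟶ Q) :
    iEnd M N ◁ (ihom M N j).map p ≫ ihomAct M N Q = ihomAct M N P ≫ (ihom M N j).map p := by
  apply ihom_hom_ext
  simp only [Functor.map_comp, Category.assoc]
  rw [map_ihomAct_coev, reassoc_of% @endAct_naturality, coev_naturality, reassoc_of% @map_ihomAct_coev]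

/-- The internal hom as a functor to right `[N, N]`-modules. -/
noncomputable def ihomMod (j : C) : M.bar.toPseudo.obj j ⥤ RightMod (iEnd M N) (⟨j⟩ : AbBicat k C) where
  obj P :=
    { X := (ihom M N j).obj P
      act := ihomAct M N P
      one_act := endOne_ihomAct M N P
      mul_act := endMul_ihomAct M N P }
  map p := RightMod.homMk ((ihom M N j).map p) (ihomAct_naturality M N p)
  map_id P := RightMod.hom_ext ((ihom M N j).map_id P)
  map_comp p q := RightMod.hom_ext ((ihom M N j).map_comp p q)

/-- The comparison `[N, P] f ⟶ [N, f P]`. -/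
noncomputable def ihomStr {j l : C} (f : j ⟶ l) (P : M.bar.toPseudo.obj j) :
    (ihom M N j).obj P ≫ emb₁ k f ⟶
      (ihom M N l).obj ((fn M.bar.toPseudo f).obj P) :=
  toIhom ((evStr M N _ f).hom ≫ (fn M.bar.toPseudo f).map (coev M N P))

lemma map_ihomStr_coev {j l : C} (f : j ⟶ l) (P : M.bar.toPseudo.obj j) :
    (evBar M N l).map (ihomStr M N f P) ≫ coev M N _ =
      (evStr M N _ f).hom ≫ (fn M.bar.toPseudo f).map (coev M N P) :=
  map_toIhom_coev _

lemma ihomStr_naturality {j l : C} (f : j ⟶ l) {P Q : M.bar.toPseudo.obj j} (p : P ⟶ Q) :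
    (ihom M N j).map p ▷ emb₁ k f ≫ ihomStr M N f Q =
      ihomStr M N f P ≫ (ihom M N l).map ((fn M.bar.toPseudo f).map p) := by
  apply ihom_hom_ext
  simp only [Functor.map_comp, Category.assoc]
  rw [map_ihomStr_coev, reassoc_of% @evStr_naturality, coev_naturality, reassoc_of% @map_ihomStr_coev,
    ← Functor.map_comp, ← Functor.map_comp, coev_naturality]

lemma ihomStr_naturality₂ {j l : C} {f f' : j ⟶ l} (θ : f ⟶ f') (P : M.bar.toPseudo.obj j) :
    (ihom M N j).obj P ◁ emb₂ k θ ≫ ihomStr M N f' P =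
      ihomStr M N f P ≫ (ihom M N l).map (nt M.bar.toPseudo θ P) := by
  apply ihom_hom_ext
  simp only [Functor.map_comp, Category.assoc]
  rw [map_ihomStr_coev, reassoc_of% @evStr_naturality₂, coev_naturality, reassoc_of% @map_ihomStr_coev,
    nt_naturality]

lemma ihomStr_id {j : C} (P : M.bar.toPseudo.obj j) :
    ihomStr M N (𝟙 j) P ≫ (ihom M N j).map (unt M.bar.toPseudo P).hom =
      (ihom M N j).obj P ◁ (embId k j).hom ≫ (ρ_ _).hom := by
  apply ihom_hom_ext
  rw [Functor.map_comp, Category.assoc, coev_naturality, reassoc_of% @map_ihomStr_coev,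
    unt_naturality, ← Category.assoc, evStr_id]

/-- After evaluation this is `evStr_comp` combined with naturality of the counit; it is the
composition axiom of the future strong transformation. -/
lemma ihomStr_comp {j l m : C} (f : j ⟶ l) (g : l ⟶ m) (P : M.bar.toPseudo.obj j) :
    ihomStr M N (f ≫ g) P ≫ (ihom M N m).map (cmp M.bar.toPseudo f g P).hom =
      ((ihom M N j).obj P ◁ (embComp k f g).hom ≫ (α_ _ _ _).inv) ≫
        ihomStr M N f P ▷ emb₁ k g ≫ ihomStr M N g _ := by
  apply ihom_hom_ext
  rw [Functor.map_comp, Category.assoc, coev_naturality, reassoc_of% @map_ihomStr_coev,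
    cmp_naturality, ← Category.assoc, evStr_comp]
  rw [Functor.map_comp _ _ (_ ≫ _), Functor.map_comp _ (_ ▷ _)]
  simp only [Category.assoc]
  rw [map_ihomStr_coev, reassoc_of% @evStr_naturality, ← Functor.map_comp, ← Functor.map_comp,
    map_ihomStr_coev]

/-- The algebra acts next to `N` and `f` acts from outside; the two commute by `endAct_str`, so the
comparison is a module morphism. -/
lemma ihomStr_act {j l : C} (f : j ⟶ l) (P : M.bar.toPseudo.obj j) :
    iEnd M N ◁ ihomStr M N f P ≫ ihomAct M N ((fn M.bar.toPseudo f).obj P) =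
      ((α_ _ _ _).inv ≫ ihomAct M N P ▷ emb₁ k f) ≫ ihomStr M N f P := by
  rw [← cancel_epi (α_ _ _ _).hom, Category.assoc, Iso.hom_inv_id_assoc]
  apply ihom_hom_ext
  simp only [Functor.map_comp, Category.assoc]
  rw [map_ihomAct_coev, reassoc_of% @endAct_naturality, map_ihomStr_coev,
    reassoc_of% @endAct_str, reassoc_of% @evStr_naturality, ← Functor.map_comp, ← Functor.map_comp,
    map_ihomAct_coev]

end InternalHom


/-! ### Adjoint 1-morphisms acting on categories. -/

namespace CatAction

variable {C : Type u} [Bicategory.{w, v} C] (T : Pseudofunctor C Cat.{v₁, u₁})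
  {j l : C} {g : l ⟶ j} {f : j ⟶ l} (adj : g ⊣ f)

/-- The unit of the action of a pair of adjoint `1`-morphisms. -/
def actUnit (X : T.obj l) : X ⟶ (fn T f).obj ((fn T g).obj X) :=
  (unt T X).inv ≫ nt T adj.unit X ≫ (cmp T g f X).hom

/-- The counit of the action of a pair of adjoint `1`-morphisms. -/
def actCounit (X : T.obj j) : (fn T g).obj ((fn T f).obj X) ⟶ X :=
  (cmp T f g X).inv ≫ nt T adj.counit X ≫ (unt T X).hom

lemma actUnit_naturality {X Y : T.obj l} (x : X ⟶ Y) :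
    actUnit T adj X ≫ (fn T f).map ((fn T g).map x) = x ≫ actUnit T adj Y := by
  have h : (unt T X).inv ≫ (fn T (𝟙 l)).map x = x ≫ (unt T Y).inv := by
    rw [Iso.inv_comp_eq, ← reassoc_of% @unt_naturality, Iso.hom_inv_id, Category.comp_id]
  simp only [actUnit, Category.assoc]
  rw [← cmp_naturality, ← reassoc_of% @nt_naturality, reassoc_of% h]

lemma actCounit_naturality {X Y : T.obj j} (x : X ⟶ Y) :
    (fn T g).map ((fn T f).map x) ≫ actCounit T adj Y = actCounit T adj X ≫ x := by
  simp only [actCounit, Category.assoc]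
  have h : (fn T g).map ((fn T f).map x) ≫ (cmp T f g Y).inv =
      (cmp T f g X).inv ≫ (fn T (f ≫ g)).map x := by
    rw [Iso.comp_inv_eq, Category.assoc, cmp_naturality, Iso.inv_hom_id_assoc]
  rw [← unt_naturality, ← reassoc_of% @nt_naturality, reassoc_of% h]

lemma adjunction_right_triangle {B : Type*} [Bicategory B] {j l : B} {g : l ⟶ j} {f : j ⟶ l}
    (adj : g ⊣ f) :
    f ◁ adj.unit ≫ (α_ f g f).inv ≫ adj.counit ▷ f = (ρ_ f).hom ≫ (λ_ f).inv := by
  simpa [rightZigzag, bicategoricalComp] using adj.right_triangle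

lemma actUnit_actCounit (X : T.obj j) :
    actUnit T adj ((fn T f).obj X) ≫ (fn T f).map (actCounit T adj X) = 𝟙 _ := by
  have h₁ : (cmp T f (𝟙 l) X).hom ≫ nt T adj.unit ((fn T f).obj X) ≫
      (cmp T g f ((fn T f).obj X)).hom ≫ (fn T f).map (cmp T f g X).inv =
      nt T (f ◁ adj.unit ≫ (α_ f g f).inv) X ≫ (cmp T (f ≫ g) f X).hom := by
    rw [← reassoc_of% @nt_whiskerLeft, nt_comp, Category.assoc]
    congr 1
    have h : nt T (α_ f g f).inv X ≫ nt T (α_ f g f).hom X = 𝟙 _ := by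
      rw [← nt_comp, Iso.inv_hom_id, nt_id]
    have h' : (cmp T (f ≫ g) f X).hom = (cmp T (f ≫ g) f X).hom ≫
        (fn T f).map (cmp T f g X).hom ≫ (fn T f).map (cmp T f g X).inv := by
      rw [← Functor.map_comp, Iso.hom_inv_id, CategoryTheory.Functor.map_id,
        Category.comp_id]
    rw [h', ← reassoc_of% @nt_associator, reassoc_of% h]
  -- Preceded by the isomorphism `cmp T f (𝟙 l) X`, the triangle composite is the image under `T` of
  -- the triangle 2-morphism of `adj`, which reduces to unitors.
  have h₂ : (cmp T f (𝟙 l) X).hom ≫ nt T adj.unit ((fn T f).obj X) ≫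
      (cmp T g f ((fn T f).obj X)).hom ≫ (fn T f).map (actCounit T adj X) =
      nt T (ρ_ f).hom X := by
    simp only [actCounit, Functor.map_comp]
    rw [reassoc_of% h₁, ← reassoc_of% @nt_whiskerRight, ← reassoc_of% @nt_comp, cmp_id_left, ← nt_comp]
    congr 1
    simp only [Category.assoc]
    rw [reassoc_of% (adjunction_right_triangle adj)]
    simp
  rw [← cmp_id_right] at h₂
  have h₃ := (cancel_epi _).1 h₂
  simp only [actUnit, Category.assoc]
  rw [h₃, Iso.inv_hom_id]

end CatAction

/-! ### The internal hom commutes with the action. -/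

section

variable {k : Type uk} [Field k] {C : Type u} [Bicategory.{w, v} C] [PreadditiveBicategory C]
  [LinearBicategory k C] {j l : C} {g : l ⟶ j} {f : j ⟶ l} (adj : g ⊣ f)

variable (k) in
/-- The unit of a pair of adjoint `1`-morphisms, in the projective abelianization. -/
def embUnit : 𝟙 (⟨l⟩ : AbBicat k C) ⟶ emb₁ k g ≫ emb₁ k f :=
  (embId k l).inv ≫ emb₂ k adj.unit ≫ (embComp k g f).hom

variable (k) in
/-- The counit of a pair of adjoint `1`-morphisms, in the projective abelianization. -/
def embCounit : emb₁ k f ≫ emb₁ k g ⟶ 𝟙 (⟨j⟩ : AbBicat k C) :=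
  (embComp k f g).inv ≫ emb₂ k adj.counit ≫ (embId k j).hom

lemma embUnit_embCounit :
    emb₁ k f ◁ embUnit k adj ≫ (α_ _ _ _).inv ≫ embCounit k adj ▷ emb₁ k f =
      (ρ_ _).hom ≫ (λ_ _).inv :=
  adjunction_right_triangle ((AbBicat.embed k C).mapAdjunction adj)

variable (M : TwoRep k C) {i : C} (N : M.toPseudo.obj i)

/-- Evaluation matches the unit of `adj` in the abelianized bicategory with the unit of its action
on `M.bar`, so transposition may be carried out on either side. -/
lemma evStr_actUnit (X : (⟨i⟩ : AbBicat k C) ⟶ ⟨l⟩) :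
    (evBar M N l).map ((ρ_ X).inv ≫ X ◁ embUnit k adj ≫ (α_ _ _ _).inv) ≫
      (evStr M N _ f).hom ≫ (fn M.bar.toPseudo f).map (evStr M N X g).hom =
      actUnit M.bar.toPseudo adj _ := by
  have h := evStr_comp M N X g f
  have h' := evStr_id M N X
  simp only [embUnit, actUnit, Functor.map_comp, Bicategory.whiskerLeft_comp, Category.assoc] at h h' ⊢
  rw [← h, reassoc_of% @evStr_naturality₂, ← Category.assoc, ← Category.assoc]
  congr 1
  rw [← cancel_mono (unt M.bar.toPseudo ((evBar M N l).obj X)).hom, Iso.inv_hom_id, Category.assoc,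
    h', ← Functor.map_comp, ← Functor.map_comp, ← Functor.map_comp]
  simp only [Category.assoc, ← whiskerLeft_comp_assoc]
  simp

lemma evStr_actCounit (X : (⟨i⟩ : AbBicat k C) ⟶ ⟨j⟩) :
    (evStr M N (X ≫ emb₁ k f) g).hom ≫ (fn M.bar.toPseudo g).map (evStr M N X f).hom ≫
      actCounit M.bar.toPseudo adj _ =
      (evBar M N j).map ((α_ _ _ _).hom ≫ X ◁ embCounit k adj ≫ (ρ_ X).hom) := by
  have h := evStr_comp M N X f g
  have h' := evStr_id M N X
  rw [← cancel_epi ((evBar M N j).map (X ◁ (embComp k f g).hom ≫ (α_ _ _ _).inv))]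
  rw [← reassoc_of% h, actCounit, Iso.hom_inv_id_assoc, ← reassoc_of% @evStr_naturality₂, h',
    ← Functor.map_comp, ← Functor.map_comp]
  simp only [embCounit, Bicategory.whiskerLeft_comp, Category.assoc, Iso.inv_hom_id_assoc,
    Bicategory.whiskerLeft_hom_inv_assoc]

variable [H : ∀ j, (evBar M N j).IsLeftAdjoint]

/-- The inverse of the comparison `[N, P] f ⟶ [N, f P]`, on morphisms. -/
noncomputable def ihomStrLift {P : M.bar.toPseudo.obj j} {X : (⟨i⟩ : AbBicat k C) ⟶ ⟨l⟩}
    (y : (evBar M N l).obj X ⟶ (fn M.bar.toPseudo f).obj P) :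
    X ⟶ (ihom M N j).obj P ≫ emb₁ k f :=
  ((ρ_ X).inv ≫ X ◁ embUnit k adj ≫ (α_ _ _ _).inv) ≫
    toIhom ((evStr M N X g).hom ≫ (fn M.bar.toPseudo g).map y ≫ actCounit M.bar.toPseudo adj P) ▷
      emb₁ k f

/-- Transposing forth on `M.bar` and back on 1-morphisms cancels by the triangle identity of the
action. -/
lemma ihomStrLift_comp {P : M.bar.toPseudo.obj j} {X : (⟨i⟩ : AbBicat k C) ⟶ ⟨l⟩}
    (y : (evBar M N l).obj X ⟶ (fn M.bar.toPseudo f).obj P) :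
    ihomStrLift adj M N y ≫ ihomStr M N f P = toIhom y := by
  apply ihom_hom_ext
  have h := evStr_actUnit adj M N X
  rw [map_toIhom_coev, Functor.map_comp, Category.assoc, map_ihomStr_coev, ihomStrLift,
    Functor.map_comp, Category.assoc, reassoc_of% @evStr_naturality, ← Functor.map_comp, map_toIhom_coev]
  simp only [Functor.map_comp, Category.assoc] at h ⊢
  rw [reassoc_of% h, reassoc_of% @actUnit_naturality, actUnit_actCounit, Category.comp_id]

/-- The opposite cancellation, by the triangle identity in the abelianized bicategory. -/
lemma ihomStrLift_eq {P : M.bar.toPseudo.obj j} {X : (⟨i⟩ : AbBicat k C) ⟶ ⟨l⟩}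
    (x : X ⟶ (ihom M N j).obj P ≫ emb₁ k f) :
    ihomStrLift adj M N ((evBar M N l).map x ≫ (evStr M N _ f).hom ≫
      (fn M.bar.toPseudo f).map (coev M N P)) = x := by
  have h : toIhom ((evStr M N X g).hom ≫ (fn M.bar.toPseudo g).map ((evBar M N l).map x ≫
      (evStr M N _ f).hom ≫ (fn M.bar.toPseudo f).map (coev M N P)) ≫
      actCounit M.bar.toPseudo adj P) =
      x ▷ emb₁ k g ≫ (α_ _ _ _).hom ≫ (ihom M N j).obj P ◁ embCounit k adj ≫ (ρ_ _).hom := by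
    apply ihom_hom_ext
    have h' := evStr_actCounit adj M N ((ihom M N j).obj P)
    rw [map_toIhom_coev, Functor.map_comp, Functor.map_comp, Functor.map_comp, Category.assoc,
      Category.assoc, ← reassoc_of% @evStr_naturality, ← h']
    simp only [Category.assoc]
    rw [actCounit_naturality]
  rw [ihomStrLift, h]
  simp only [Bicategory.comp_whiskerRight, Category.assoc]
  have h₁ : (ρ_ X).inv ≫ X ◁ embUnit k adj ≫ (α_ _ _ _).inv ≫ x ▷ emb₁ k g ▷ emb₁ k f =
      x ≫ (ρ_ _).inv ≫ _ ◁ embUnit k adj ≫ (α_ _ _ _).inv := by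
    rw [← associator_inv_naturality_left, whisker_exchange_assoc, rightUnitor_inv_naturality_assoc]
  rw [reassoc_of% h₁]
  have h₂ : (ihom M N j).obj P ◁ (emb₁ k f ◁ embUnit k adj ≫ (α_ _ _ _).inv ≫
      embCounit k adj ▷ emb₁ k f) = _ ◁ ((ρ_ _).hom ≫ (λ_ _).inv) :=
    congrArg ((ihom M N j).obj P ◁ ·) (embUnit_embCounit (k := k) adj)
  simp only [Bicategory.whiskerLeft_comp] at h₂
  have h₃ : (ρ_ ((ihom M N j).obj P ≫ emb₁ k f)).inv ≫
      ((ihom M N j).obj P ≫ emb₁ k f) ◁ embUnit k adj ≫ (α_ _ _ _).inv ≫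
      (α_ ((ihom M N j).obj P) (emb₁ k f) (emb₁ k g)).hom ▷ emb₁ k f ≫
      ((ihom M N j).obj P ◁ embCounit k adj) ▷ emb₁ k f ≫ (ρ_ _).hom ▷ emb₁ k f =
      (ρ_ _).inv ≫ (α_ _ _ _).hom ≫ ((ihom M N j).obj P ◁ emb₁ k f ◁ embUnit k adj ≫
      (ihom M N j).obj P ◁ (α_ _ _ _).inv ≫ (ihom M N j).obj P ◁ embCounit k adj ▷ emb₁ k f) ≫
      (α_ _ _ _).inv ≫ (ρ_ _).hom ▷ emb₁ k f := by
    simp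
  rw [h₃, h₂]
  simp

/-- A Yoneda argument: transposing along `g ⊣ f` and along evaluation identifies morphisms into `[N,
P] ≫ f` with morphisms into `[N, f P]`. The inverse is the lift of the counit at `f P`. -/
lemma isIso_ihomStr (adj : g ⊣ f) (P : M.bar.toPseudo.obj j) : IsIso (ihomStr M N f P) := by
  have h : ihomStrLift adj M N (coev M N ((fn M.bar.toPseudo f).obj P)) ≫ ihomStr M N f P = 𝟙 _ := by
    rw [ihomStrLift_comp]
    apply ihom_hom_ext
    rw [map_toIhom_coev, CategoryTheory.Functor.map_id, Category.id_comp]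
  refine ⟨_, ?_, h⟩
  -- A morphism into `[N, P] ≫ f` is recovered from the morphism to `f P` that it induces, so it
  -- suffices to compare the latter.
  rw [← ihomStrLift_eq adj M N (𝟙 _), ← ihomStrLift_eq adj M N (ihomStr M N f P ≫ _)]
  congr 1
  rw [← map_ihomStr_coev, ← Functor.map_comp_assoc, ← Functor.map_comp_assoc,
    Category.assoc, h, Category.comp_id, Category.id_comp]

/-- In a fiat bicategory the internal hom commutes with the action. -/
lemma isIso_ihomStr_of_fiat (S : FiatStructure k C) (f : j ⟶ l) (P : M.bar.toPseudo.obj j) :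
    IsIso (ihomStr M N f P) := by
  -- The adjunction `f^* ⊣ f^{**}` settles the claim for `f^{**}`; naturality of the comparison in
  -- the 1-morphism transports it along any isomorphism `f^{**} ≅ f`, with no coherence needed.
  obtain ⟨adj⟩ := S.adjunction ((S.star j l).obj (.op f))
  obtain ⟨e⟩ := S.star_star f
  have := isIso_ihomStr M N adj P
  have h := ihomStr_naturality₂ M N e.hom P
  have h₁ : IsIso (nt M.bar.toPseudo e.hom P) :=
    ⟨nt M.bar.toPseudo e.inv P, by rw [← nt_comp, e.hom_inv_id, nt_id],
      by rw [← nt_comp, e.inv_hom_id, nt_id]⟩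
  have h₂ : IsIso (emb₂ k e.hom) := ⟨emb₂ k e.inv,
    ((AbBicat.embed k C).map₂_comp e.hom e.inv).symm.trans
      ((congrArg _ e.hom_inv_id).trans ((AbBicat.embed k C).map₂_id _)),
    ((AbBicat.embed k C).map₂_comp e.inv e.hom).symm.trans
      ((congrArg _ e.inv_hom_id).trans ((AbBicat.embed k C).map₂_id _))⟩
  have h₃ : IsIso ((ihom M N j).obj P ◁ emb₂ k e.hom ≫ ihomStr M N f P) := by
    rw [h]; infer_instance
  exact IsIso.of_isIso_comp_left ((ihom M N j).obj P ◁ emb₂ k e.hom) _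

/-- The comparison `[N, P] f ≅ [N, f P]` as an isomorphism of right `[N, N]`-modules. -/
noncomputable def ihomModStr (f : j ⟶ l) (P : M.bar.toPseudo.obj j) [IsIso (ihomStr M N f P)] :
    (RightMod.post (emb₁ k f)).obj ((ihomMod M N j).obj P) ≅
      (ihomMod M N l).obj ((fn M.bar.toPseudo f).obj P) :=
  RightMod.isoMk (M := RightMod.postObj (emb₁ k f) ((ihomMod M N j).obj P))
    (@asIso _ _ _ _ (ihomStr M N f P) ‹_›) (ihomStr_act M N f P)

open scoped Pseudofunctor.StrongTrans

/-- The internal hom as a strong transformation. -/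
noncomputable def ihomTrans [hiso : ∀ {j l : C} (f : j ⟶ l) P, IsIso (ihomStr M N f P)] :
    M.bar.toPseudo ⟶ (modRep (iEnd M N)).toPseudo :=
  strongTransMkInv (ihomMod M N) (fun f P => ihomModStr M N f P)
    (fun {_ _} f {_ _} p => RightMod.hom_ext (ihomStr_naturality M N f p))
    (fun η P => RightMod.hom_ext (ihomStr_naturality₂ M N η P))
    (fun P => RightMod.hom_ext (ihomStr_id M N P))
    (fun f g P => RightMod.hom_ext (ihomStr_comp M N f g P))

end

/-! ### Cokernels of finite families in preadditive categories. -/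

section Cokernels

variable {𝒟 : Type u} [Category.{v} 𝒟] [Preadditive 𝒟]

/-- `π` is a cokernel of a finite family of morphisms. -/
structure IsCoker {n : ℕ} {P : Fin n → 𝒟} {Q K : 𝒟} (x : ∀ t, P t ⟶ Q) (π : Q ⟶ K) : Prop where
  epi : Epi π
  w : ∀ t, x t ≫ π = 0
  desc : ∀ {T : 𝒟} (e : Q ⟶ T), (∀ t, x t ≫ e = 0) → ∃ d, π ≫ d = e

namespace IsCoker

variable {n : ℕ} {P : Fin n → 𝒟} {Q K : 𝒟} {x : ∀ t, P t ⟶ Q} {π : Q ⟶ K}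

lemma isIso (h : IsCoker x π) {K' : 𝒟} {π' : Q ⟶ K'} (h' : IsCoker x π') (u : K ⟶ K')
    (hu : π ≫ u = π') : IsIso u := by
  obtain ⟨d, hd⟩ := h'.desc π h.w
  have := h.epi
  have := h'.epi
  refine ⟨d, ?_, ?_⟩
  · rw [← cancel_epi π, reassoc_of% hu, hd, Category.comp_id]
  · rw [← cancel_epi π', reassoc_of% hd, hu, Category.comp_id]

lemma comp_iso (h : IsCoker x π) {K' : 𝒟} (u : K ⟶ K') [IsIso u] : IsCoker x (π ≫ u) where
  epi := by
    have := h.epi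
    infer_instance
  w t := by rw [reassoc_of% h.w t, zero_comp]
  desc e he := by
    obtain ⟨d, hd⟩ := h.desc e he
    exact ⟨inv u ≫ d, by simpa using hd⟩

lemma of_iso (h : IsCoker x π) {P' : Fin n → 𝒟} {Q' : 𝒟} {x' : ∀ t, P' t ⟶ Q'}
    (a : ∀ t, P' t ⟶ P t) [∀ t, IsIso (a t)] (b : Q' ⟶ Q) [IsIso b]
    (hab : ∀ t, x' t ≫ b = a t ≫ x t) : IsCoker x' (b ≫ π) where
  epi := by
    have := h.epi
    infer_instance
  w t := by rw [reassoc_of% hab t, h.w t, comp_zero]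
  desc e he := by
    obtain ⟨d, hd⟩ := h.desc (inv b ≫ e) (fun t => by
      have h' : x t ≫ inv b = inv (a t) ≫ x' t := by
        rw [IsIso.comp_inv_eq, Category.assoc, hab, IsIso.inv_hom_id_assoc]
      rw [reassoc_of% h', he, comp_zero])
    exact ⟨d, by rw [Category.assoc, hd, IsIso.hom_inv_id_assoc]⟩

/-- A split coequalizer is a cokernel. -/
lemma of_split {X Y Z : 𝒟} {f g : X ⟶ Y} {e : Y ⟶ Z} (s : Z ⟶ Y) (t : Y ⟶ X)
    (hfg : f ≫ e = g ≫ e) (hs : s ≫ e = 𝟙 Z) (ht : t ≫ f = 𝟙 Y) (hts : t ≫ g = e ≫ s) :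
    IsCoker (fun _ : Fin 1 => f - g) e where
  epi := have := SplitEpi.mk s hs; this.epi
  w _ := by rw [Preadditive.sub_comp, hfg, sub_self]
  desc d hd := ⟨s ≫ d, by
    have h := hd 0
    rw [Preadditive.sub_comp, sub_eq_zero] at h
    rw [← reassoc_of% hts, ← h, reassoc_of% ht]⟩

end IsCoker

end Cokernels

/-! ### Cokernels in projective abelianizations and right exactness of right adjoints. -/

namespace ProjAb

variable {k : Type uk} [Field k] {𝒜 : Type u} [Category.{v} 𝒜] [Preadditive 𝒜] [Linear k 𝒜]

lemma isCoker_proj (P : ProjAb k 𝒜) : IsCoker (fun t => embMap k (P.arr t)) P.proj where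
  epi := inferInstance
  w := P.arr_proj
  desc e he := exists_desc e he

section coker

variable {n : ℕ} {Y : Fin n → 𝒜} (Q : ProjAb k 𝒜) (g : ∀ t, Y t ⟶ Q.pt)

/-- The arrows of the object obtained by adjoining arrows. -/
def adjoinArr : ∀ s : Fin Q.n ⊕ Fin n, Sum.elim Q.src Y s ⟶ Q.pt
  | .inl i => Q.arr i
  | .inr t => g t

/-- The object obtained by adjoining finitely many arrows. -/
abbrev adjoin : ProjAb k 𝒜 where
  pt := Q.pt
  n := Q.n + n
  src s := Sum.elim Q.src Y (finSumFinEquiv.symm s)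
  arr s := adjoinArr Q g (finSumFinEquiv.symm s)

lemma adjoinArr_mem (s : Fin Q.n ⊕ Fin n) :
    adjoinArr Q g s ∈ (adjoin Q g).image (Sum.elim Q.src Y s) := by
  obtain ⟨i, rfl⟩ := finSumFinEquiv.symm.surjective s
  exact (adjoin Q g).arr_mem i

lemma exists_of_mem_adjoin {Z : 𝒜} {φ : Z ⟶ Q.pt} (h : φ ∈ (adjoin Q g).image Z) :
    ∃ q : ∀ t, Z ⟶ Y t, φ - ∑ t, q t ≫ g t ∈ Q.image Z := by
  obtain ⟨q, hq⟩ := h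
  have h' : φ = ∑ s, (show Z ⟶ Sum.elim Q.src Y (finSumFinEquiv.symm s) from q s) ≫
    adjoinArr Q g (finSumFinEquiv.symm s) := hq
  have key : ∀ q' : ∀ s, Z ⟶ Sum.elim Q.src Y s,
      (∑ s, q' s ≫ adjoinArr Q g s) - ∑ t, q' (.inr t) ≫ g t ∈ Q.image Z := by
    intro q'
    rw [Fintype.sum_sum_type]
    exact ⟨fun i => q' (.inl i), add_sub_cancel_right _ _⟩
  -- Reindexes from `Fin (Q.n + n)` to the disjoint union; `eqToHom` corrects the sources.
  let q' : ∀ s, Z ⟶ Sum.elim Q.src Y s := fun s =>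
    q (finSumFinEquiv s) ≫ eqToHom (congrArg (Sum.elim Q.src Y) (finSumFinEquiv.symm_apply_apply s))
  have e : ∀ s s' (hs : s' = s) (z : Z ⟶ Sum.elim Q.src Y s'),
      (z ≫ eqToHom (congrArg (Sum.elim Q.src Y) hs)) ≫ adjoinArr Q g s = z ≫ adjoinArr Q g s' := by
    rintro s _ rfl z
    simp
  have h'' : φ = ∑ s, q' s ≫ adjoinArr Q g s := by
    rw [h', ← Equiv.sum_comp finSumFinEquiv]
    exact Finset.sum_congr rfl fun s _ => (e s _ (finSumFinEquiv.symm_apply_apply s) _).symm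
  refine ⟨fun t => q' (.inr t), ?_⟩
  rw [h'']
  exact key q'

/-- Representatives of the `x t` are adjoined to the arrows of `Q`, and the identity of `Q.pt`
represents the projection. Exactness on embedded objects is then visible from the presentation. -/
lemma exists_isCoker_exact {P : Fin n → ProjAb k 𝒜} {Q : ProjAb k 𝒜} (x : ∀ t, P t ⟶ Q) :
    ∃ (K : ProjAb k 𝒜) (π : Q ⟶ K), IsCoker x π ∧ ∀ (Z : 𝒜) (w : emb k Z ⟶ Q), w ≫ π = 0 →
      ∃ q : ∀ t, emb k Z ⟶ P t, w = ∑ t, q t ≫ x t := by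
  choose g hg hx using fun t => homMk_surj (x t)
  have hπ : 𝟙 Q.pt ∈ homSub Q (adjoin Q g) := fun i => by
    rw [Category.comp_id]
    exact adjoinArr_mem Q g (.inl i)
  refine ⟨adjoin Q g, homMk (Q := adjoin Q g) (𝟙 Q.pt) hπ, ⟨⟨fun y z h => ?_⟩, fun t => ?_, ?_⟩, ?_⟩
  · obtain ⟨y, hy, rfl⟩ := homMk_surj y
    obtain ⟨z, hz, rfl⟩ := homMk_surj z
    have h' := (homMk_eq_iff _ _).1 h
    refine (homMk_eq_iff _ _).2 ?_
    change 𝟙 Q.pt ≫ y - 𝟙 Q.pt ≫ z ∈ _ at h'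
    rwa [Category.id_comp, Category.id_comp] at h'
  · rw [hx t]
    refine (homMk_eq_zero_iff (P := P t) (Q := adjoin Q g) _ _).2 ?_
    change g t ≫ 𝟙 Q.pt ∈ _
    rw [Category.comp_id]
    exact adjoinArr_mem Q g (.inr t)
  · intro T e he
    obtain ⟨e, hem, rfl⟩ := homMk_surj e
    have h : ∀ s, adjoinArr Q g s ≫ e ∈ T.image _ := by
      rintro (i | t)
      · exact hem i
      · have := he t
        rw [hx t] at this
        exact (homMk_eq_zero_iff (P := P t) _ _).1 this
    exact ⟨homMk (P := adjoin Q g) e (fun s => h _), homMk_congr (Category.id_comp _)⟩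
  · intro Z w hw
    obtain ⟨φ, hφ, rfl⟩ := homMk_surj w
    have h := (homMk_eq_zero_iff (Q := adjoin Q g) _ _).1 hw
    change φ ≫ 𝟙 Q.pt ∈ _ at h
    rw [Category.comp_id] at h
    obtain ⟨q, hq⟩ := exists_of_mem_adjoin Q g h
    refine ⟨fun t => homMk (P := emb k Z) (Q := P t) (q t) (mem_of_emb _), ?_⟩
    have h₁ : ∑ t, homMk (P := emb k Z) (Q := P t) (q t) (mem_of_emb _) ≫ x t =
        ∑ t, embMap k (q t ≫ g t) ≫ Q.proj :=
      Finset.sum_congr rfl fun t _ => by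
        rw [hx t]
        exact homMk_congr (Category.comp_id _).symm
    rw [h₁, ← Preadditive.sum_comp, ← embMap_sum]
    refine (homMk_eq_iff _ _).2 ?_
    rw [Category.comp_id]
    exact hq

end coker

variable {n : ℕ} {P : Fin n → ProjAb k 𝒜} {Q K : ProjAb k 𝒜} {x : ∀ t, P t ⟶ Q} {π : Q ⟶ K}

lemma exists_isCoker {P Q : ProjAb k 𝒜} (x : P ⟶ Q) :
    ∃ (K : ProjAb k 𝒜) (π : Q ⟶ K), IsCoker (fun _ : Fin 1 => x) π := by
  obtain ⟨K, π, h, -⟩ := exists_isCoker_exact (fun _ : Fin 1 => x)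
  exact ⟨K, π, h⟩

/-- Whatever `π` kills is also killed by the explicit cokernel, for which exactness is known. -/
lemma exists_eq_sum_of_isCoker (h : IsCoker x π) {Z : 𝒜} (w : emb k Z ⟶ Q) (hw : w ≫ π = 0) :
    ∃ q : ∀ t, emb k Z ⟶ P t, w = ∑ t, q t ≫ x t := by
  obtain ⟨K', π', h', hex⟩ := exists_isCoker_exact x
  obtain ⟨d, hd⟩ := h.desc π' h'.w
  exact hex Z w (by rw [← hd, reassoc_of% hw, zero_comp])

section Map

variable {ℬ : Type u₁} [Category.{v₁} ℬ] [Preadditive ℬ] [Linear k ℬ] (E : 𝒜 ⥤ ℬ) [E.Additive]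

lemma map_proj (P : ProjAb k 𝒜) :
    (mapFunctor k E).map P.proj = (mapEmbIso E P.pt).hom ≫ mapProj E P :=
  homMk_congr ((E.map_id _).trans (Category.comp_id _).symm)

lemma isCoker_mapProj (P : ProjAb k 𝒜) :
    IsCoker (fun t => embMap k (E.map (P.arr t))) (mapProj E P) where
  epi := inferInstance
  w := map_arr_mapProj E P
  desc e he := exists_mapProj_desc E e he

lemma isCoker_map_proj (P : ProjAb k 𝒜) :
    IsCoker (fun t => (mapFunctor k E).map (embMap k (P.arr t)))
      ((mapFunctor k E).map P.proj) := by
  rw [map_proj]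
  exact (isCoker_mapProj E P).of_iso (fun t => (mapEmbIso E (P.src t)).hom) _
    (fun t => mapEmbIso_hom_naturality E _)

variable {E}

/-- A right adjoint to a componentwise functor is right exact. -/
lemma isCoker_map_of_adjunction {R : ProjAb k ℬ ⥤ ProjAb k 𝒜} (adj : mapFunctor k E ⊣ R) {n : ℕ}
    {P : Fin n → ProjAb k ℬ} {Q K : ProjAb k ℬ} {x : ∀ t, P t ⟶ Q} {π : Q ⟶ K}
    (h : IsCoker x π) : IsCoker (fun t => R.map (x t)) (R.map π) := by
  have hR : R.Additive := adj.right_adjoint_additive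
  have := h.epi
  -- `K'` is the cokernel of the images `R.map (x t)`; the comparison `c` from `K'` to `R.obj K` is
  -- tested on embedded objects.
  obtain ⟨K', π', h', -⟩ := exists_isCoker_exact (fun t => R.map (x t))
  have := h'.epi
  obtain ⟨c, hc⟩ := h'.desc (R.map π) (fun t => by rw [← R.map_comp, h.w, R.map_zero])
  have hciso : IsIso c := by
    refine isIso_of_bijective c (fun Z z hz => ?_) (fun Z z => ?_)
    -- Transposed, `w` starts from the embedded object `E Z` and is killed by `π`, so it is a
    -- combination of the `x t`; transposing back shows that `π'` kills `w`.
    · obtain ⟨w, rfl⟩ := emb_lift_of_epi π' z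
      rw [Category.assoc, hc] at hz
      have hw : ((mapEmbIso E Z).inv ≫ (adj.homEquiv _ _).symm w) ≫ π = 0 := by
        rw [Category.assoc, ← adj.homEquiv_naturality_right_symm, hz, Adjunction.homEquiv_counit,
          Functor.map_zero, zero_comp, comp_zero]
      obtain ⟨q, hq⟩ := exists_eq_sum_of_isCoker h _ hw
      rw [Iso.inv_comp_eq, Equiv.symm_apply_eq] at hq
      rw [hq, Adjunction.homEquiv_unit, Preadditive.comp_sum, Functor.map_sum, Preadditive.comp_sum,
        Preadditive.sum_comp]
      refine Finset.sum_eq_zero fun t _ => ?_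
      rw [Functor.map_comp, Functor.map_comp, Category.assoc, Category.assoc, Category.assoc, h'.w]
      simp only [comp_zero]
    -- The transpose of `z` again starts from an embedded, hence projective, object and so lifts
    -- through `π`.
    · obtain ⟨y, hy⟩ := emb_lift_of_epi π ((mapEmbIso E Z).inv ≫ (adj.homEquiv _ _).symm z)
      refine ⟨(adj.homEquiv _ _) ((mapEmbIso E Z).hom ≫ y) ≫ π', ?_⟩
      rw [Category.assoc, hc, ← adj.homEquiv_naturality_right, Category.assoc, hy,
        Iso.hom_inv_id_assoc, Equiv.apply_symm_apply]
  rw [← hc]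
  exact h'.comp_iso c

end Map

end ProjAb


/-! ### The internal hom is an equivalence onto modules. -/

section InternalHomEquivalence

variable {k : Type uk} [Field k] {C : Type u} [Bicategory.{w, v} C] [PreadditiveBicategory C]
  [LinearBicategory k C] (M : TwoRep k C) {i : C} (N : M.toPseudo.obj i)

instance (j : C) : (evBar M N j).Additive :=
  ProjAb.mapFunctor_additive (k := k) (ev M N j)

instance (j : C) : (evBar M N j).Linear k where
  map_smul x t := by
    obtain ⟨g, hg, rfl⟩ := ProjAb.homMk_surj x
    exact ProjAb.homMk_congr ((ev M N j).map_smul t g)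

/-- The canonical epimorphism onto a `1`-morphism of the projective abelianization. -/
def proj₁ {j l : C} (X : (⟨j⟩ : AbBicat k C) ⟶ ⟨l⟩) : emb₁ k (ProjAb.pt X) ⟶ X := ProjAb.proj X

lemma isCoker_proj₁ {j l : C} (X : (⟨j⟩ : AbBicat k C) ⟶ ⟨l⟩) :
    IsCoker (fun t : Fin (ProjAb.n X) => emb₂ k (ProjAb.arr X t)) (proj₁ X) :=
  ProjAb.isCoker_proj (𝒜 := (j ⟶ l)) X

lemma isCoker_evBar_proj₁ {j : C} (X : (⟨i⟩ : AbBicat k C) ⟶ ⟨j⟩) :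
    IsCoker (fun t : Fin (ProjAb.n X) => (evBar M N j).map (emb₂ k (ProjAb.arr X t)))
      ((evBar M N j).map (proj₁ X)) :=
  ProjAb.isCoker_map_proj (k := k) (ev M N j) X

/-- The whiskered projection is represented by an identity, so a null-homotopy after composing with
it was one before. -/
lemma epi_whiskerLeft_proj₁ {i j l : C} (Y : (⟨i⟩ : AbBicat k C) ⟶ ⟨j⟩)
    (X : (⟨j⟩ : AbBicat k C) ⟶ ⟨l⟩) : Epi (Y ◁ proj₁ X) where
  left_cancellation {Z} y z h := by
    obtain ⟨y, hy, rfl⟩ := ProjAb.homMk_surj y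
    obtain ⟨z, hz, rfl⟩ := ProjAb.homMk_surj z
    have h' := (ProjAb.homMk_eq_iff _ _).1 h
    refine (ProjAb.homMk_eq_iff _ _).2 ?_
    have e : ∀ y : ProjAb.pt Y ≫ ProjAb.pt X ⟶ ProjAb.pt Z,
        ProjAb.pt Y ◁ 𝟙 (ProjAb.pt X) ≫ y = y := fun y => by simp
    exact Eq.mp (congrArg (· ∈ _) (congrArg₂ _ (e y) (e z))) h'

variable [H : ∀ j, (evBar M N j).IsLeftAdjoint]

instance (j : C) : (ihom M N j).Additive := (ihomAdj M N j).right_adjoint_additive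

lemma isCoker_ihom {j : C} {n : ℕ} {P : Fin n → M.bar.toPseudo.obj j} {Q K : M.bar.toPseudo.obj j}
    {x : ∀ t, P t ⟶ Q} {π : Q ⟶ K} (h : IsCoker x π) :
    IsCoker (fun t => (ihom M N j).map (x t)) ((ihom M N j).map π) :=
  ProjAb.isCoker_map_of_adjunction (k := k) (E := ev M N j) (ihomAdj M N j) h

variable {M N} in
lemma toIhom_map {j : C} {X : (⟨i⟩ : AbBicat k C) ⟶ ⟨j⟩} {P Q : M.bar.toPseudo.obj j}
    (y : (evBar M N j).obj X ⟶ P) (p : P ⟶ Q) :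
    toIhom y ≫ (ihom M N j).map p = toIhom (y ≫ p) := by
  apply ihom_hom_ext
  rw [Functor.map_comp, Category.assoc, coev_naturality, reassoc_of% @map_toIhom_coev, map_toIhom_coev]

variable {M N} in
lemma comp_toIhom {j : C} {X' X : (⟨i⟩ : AbBicat k C) ⟶ ⟨j⟩} {P : M.bar.toPseudo.obj j}
    (x : X' ⟶ X) (y : (evBar M N j).obj X ⟶ P) :
    x ≫ toIhom y = toIhom ((evBar M N j).map x ≫ y) := by
  apply ihom_hom_ext
  rw [Functor.map_comp, Category.assoc, map_toIhom_coev, map_toIhom_coev]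

/-- The comparison between multiplication by `[N, N]` and `[N, - N]`. -/
noncomputable def endIhom {j : C} (X : (⟨i⟩ : AbBicat k C) ⟶ ⟨j⟩) :
    iEnd M N ≫ X ⟶ (ihom M N j).obj ((evBar M N j).obj X) := toIhom (endAct M N X)

lemma endIhom_naturality {j : C} {X X' : (⟨i⟩ : AbBicat k C) ⟶ ⟨j⟩} (x : X ⟶ X') :
    iEnd M N ◁ x ≫ endIhom M N X' = endIhom M N X ≫ (ihom M N j).map ((evBar M N j).map x) := by
  rw [endIhom, endIhom, toIhom_map, comp_toIhom, endAct_naturality]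

/-- Both transpose the functor of `F` applied to the counit at `N`. Hence compatibility of `[N, -]`
with the action yields `[N, N] ≫ F ≅ [N, F N]`. -/
lemma endIhom_emb₁ {j : C} (F : i ⟶ j) :
    endIhom M N (emb₁ k F) ≫ (ihom M N j).map (evEmb M N F).hom =
      ihomStr M N F (embObj M N) := by
  rw [endIhom, toIhom_map, endAct, evAct_emb]
  rfl

/-- The equation between the two maps to the quotient of `X N` by `[N, N]`. -/
lemma map_act_eq {j : C} {X : RightMod (iEnd M N) (⟨j⟩ : AbBicat k C)} {K : M.bar.toPseudo.obj j}
    {π : (evBar M N j).obj X.X ⟶ K}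
    (h : IsCoker (fun _ : Fin 1 => endAct M N X.X - (evBar M N j).map X.act) π) :
    (evBar M N j).map X.act ≫ π = endAct M N X.X ≫ π := by
  have := h.w 0
  rw [Preadditive.sub_comp, sub_eq_zero] at this
  exact this.symm

/-- The bar presentation of a module. It is split by the unit of the algebra, through morphisms that
need not be module morphisms. -/
lemma isCoker_act {j : C} (X : RightMod (iEnd M N) (⟨j⟩ : AbBicat k C)) :
    IsCoker (fun _ : Fin 1 => ((α_ _ _ X.X).inv ≫ endMul M N ▷ X.X) - iEnd M N ◁ X.act)
      X.act := by
  have h₁ : endOne M N ▷ X.X ≫ X.act = (λ_ X.X).hom := X.one_act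
  have h₂ : endMul M N ▷ X.X ≫ X.act = (α_ _ _ X.X).hom ≫ iEnd M N ◁ X.act ≫ X.act := X.mul_act
  have h₃ : endOne M N ▷ iEnd M N ≫ endMul M N = (λ_ _).hom := endOne_ihomAct M N (embObj M N)
  refine IsCoker.of_split ((λ_ X.X).inv ≫ endOne M N ▷ X.X)
    ((λ_ (iEnd M N ≫ X.X)).inv ≫ endOne M N ▷ (iEnd M N ≫ X.X)) ?_ ?_ ?_ ?_
  · rw [Category.assoc, h₂, Iso.inv_hom_id_assoc]
  · rw [Category.assoc, h₁, Iso.inv_hom_id]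
  · rw [Category.assoc, associator_inv_naturality_left_assoc, ← Bicategory.comp_whiskerRight, h₃]
    simp
  · rw [Category.assoc, ← whisker_exchange, leftUnitor_inv_naturality_assoc]

lemma toIhom_act {j : C} {X : RightMod (iEnd M N) (⟨j⟩ : AbBicat k C)} {K : M.bar.toPseudo.obj j}
    {π : (evBar M N j).obj X.X ⟶ K}
    (h : (evBar M N j).map X.act ≫ π = endAct M N X.X ≫ π) :
    iEnd M N ◁ toIhom π ≫ ihomAct M N K = X.act ≫ toIhom π := by
  apply ihom_hom_ext
  rw [Functor.map_comp, Functor.map_comp, Category.assoc, Category.assoc, map_ihomAct_coev,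
    reassoc_of% @endAct_naturality, map_toIhom_coev, h]

/-- Morphisms `F N ⟶ P` are morphisms `F ⟶ [N, P]`, so an isomorphism on internal homs gives a
bijection on morphisms from the objects `F N`, and these generate. -/
lemma isIso_of_isIso_ihom {j : C} (hgen : ∀ Y : M.toPseudo.obj j,
    IsSummandOfSum (fun Z => ∃ F : i ⟶ j, Z = (M.toPseudo.map F).toFunctor.obj N) Y)
    {P Q : M.bar.toPseudo.obj j} (p : P ⟶ Q) [IsIso ((ihom M N j).map p)] :
    IsIso p := by
  let e : ∀ F : i ⟶ j, (evBar M N j).obj (emb₁ k F) ≅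
    embObj M ((fn M.toPseudo F).obj N) := fun F => ProjAb.mapEmbIso (k := k) (ev M N j) F
  have hinj : ∀ (F : i ⟶ j) (z : embObj M ((fn M.toPseudo F).obj N) ⟶ P), z ≫ p = 0 → z = 0 := by
    intro F z hz
    have h₁ : toIhom ((e F).hom ≫ z) = 0 := by
      rw [← cancel_mono ((ihom M N j).map p), toIhom_map, Category.assoc, hz, comp_zero, zero_comp]
      apply ihom_hom_ext
      rw [map_toIhom_coev, Functor.map_zero, zero_comp]
    have h₂ := map_toIhom_coev ((e F).hom ≫ z)
    rw [h₁, Functor.map_zero, zero_comp] at h₂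
    rw [← cancel_epi (e F).hom, ← h₂, comp_zero]
  have hsurj : ∀ (F : i ⟶ j) (z : embObj M ((fn M.toPseudo F).obj N) ⟶ Q),
      ∃ z', z' ≫ p = z := by
    intro F z
    refine ⟨(e F).inv ≫ (evBar M N j).map (toIhom ((e F).hom ≫ z) ≫ inv ((ihom M N j).map p)) ≫
      coev M N P, ?_⟩
    rw [Category.assoc, Category.assoc, ← coev_naturality, ← Functor.map_comp_assoc, Category.assoc,
      IsIso.inv_hom_id, Category.comp_id, map_toIhom_coev, Iso.inv_hom_id_assoc]
  refine ProjAb.isIso_of_bijective_of_generates (k := k) (𝒜 := M.toPseudo.obj j) _ hgen p ?_ ?_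
  · rintro _ ⟨F, rfl⟩ z hz
    exact hinj F z hz
  · rintro _ ⟨F, rfl⟩ z
    exact hsurj F z

lemma ihomMod_additive (j : C) : (ihomMod M N j).Additive where
  map_add {_ _ _ _} := RightMod.hom_ext ((ihom M N j).map_add)

lemma ihomMod_linear (j : C) : (ihomMod M N j).Linear k where
  map_smul p t := RightMod.hom_ext (by
    change (ihom M N j).map (t • p) = t • (ihom M N j).map p
    apply ihom_hom_ext
    rw [coev_naturality, Functor.map_smul, Linear.smul_comp, coev_naturality, Linear.comp_smul])

variable [hiso : ∀ {j l : C} (f : j ⟶ l) P, IsIso (ihomStr M N f P)]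

instance isIso_endIhom_emb₁ {j : C} (F : i ⟶ j) : IsIso (endIhom M N (emb₁ k F)) := by
  have h : IsIso (endIhom M N (emb₁ k F) ≫ (ihom M N j).map (evEmb M N F).hom) := by
    rw [endIhom_emb₁]
    exact hiso F _
  exact IsIso.of_isIso_comp_right _ ((ihom M N j).map (evEmb M N F).hom)

/-- `X` is presented by 1-morphisms of `C`, where the claim is known. As `[N, -]` and evaluation
preserve the presentation, the inverse on its target descends to `[N, X N]`. -/
instance isIso_endIhom {j : C} (X : (⟨i⟩ : AbBicat k C) ⟶ ⟨j⟩) : IsIso (endIhom M N X) := by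
  have h := isCoker_ihom M N (isCoker_evBar_proj₁ M N X)
  have := epi_whiskerLeft_proj₁ (iEnd M N) X
  obtain ⟨φ, hφ⟩ := h.desc (inv (endIhom M N (emb₁ k (ProjAb.pt X))) ≫ iEnd M N ◁ proj₁ X)
    (fun t => by
      have h₁ : (ihom M N j).map ((evBar M N j).map (emb₂ k (ProjAb.arr X t))) ≫
          inv (endIhom M N (emb₁ k (ProjAb.pt X))) =
          inv (endIhom M N (emb₁ k (ProjAb.src X t))) ≫ iEnd M N ◁ emb₂ k (ProjAb.arr X t) := by
        rw [IsIso.comp_inv_eq, Category.assoc, endIhom_naturality, IsIso.inv_hom_id_assoc]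
      rw [reassoc_of% h₁, ← Bicategory.whiskerLeft_comp, (isCoker_proj₁ X).w]
      have h₂ : iEnd M N ◁ (0 : emb₁ k (ProjAb.src X t) ⟶ X) = 0 :=
        map_zero (whiskerLeftHom (iEnd M N) _ _)
      rw [h₂, comp_zero])
  refine ⟨φ, ?_, ?_⟩
  · rw [← cancel_epi (iEnd M N ◁ proj₁ X), reassoc_of% @endIhom_naturality, hφ, IsIso.hom_inv_id_assoc,
      Category.comp_id]
  · have := h.epi
    rw [← cancel_epi ((ihom M N j).map ((evBar M N j).map (proj₁ X))), reassoc_of% hφ,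
      endIhom_naturality, IsIso.inv_hom_id_assoc, Category.comp_id]

/-- A right `[N, N]`-module is the internal hom to the quotient of its evaluation. -/
lemma isIso_toIhom {j : C} {X : RightMod (iEnd M N) (⟨j⟩ : AbBicat k C)} {K : M.bar.toPseudo.obj j}
    {π : (evBar M N j).obj X.X ⟶ K}
    (h : IsCoker (fun _ : Fin 1 => endAct M N X.X - (evBar M N j).map X.act) π) :
    IsIso (toIhom π) := by
  -- Applying `[N, -]` to the presentation of `K` and identifying `[N, Y N]` with `[N, N] ≫ Y`
  -- through `endIhom` yields the bar presentation of `X`. Two cokernels of the same morphism are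
  -- then compared.
  have h' := (isCoker_ihom M N h).of_iso
    (x' := fun _ : Fin 1 => ((α_ _ _ X.X).inv ≫ endMul M N ▷ X.X) - iEnd M N ◁ X.act)
    (fun _ => endIhom M N (iEnd M N ≫ X.X)) (endIhom M N X.X) (fun _ => by
      rw [Functor.map_sub, Preadditive.sub_comp, Preadditive.comp_sub, endIhom_naturality]
      congr 1
      rw [endIhom, endIhom, toIhom_map, comp_toIhom, Functor.map_comp, Category.assoc,
        endMul_endAct, ← Functor.map_comp_assoc, Iso.inv_hom_id, CategoryTheory.Functor.map_id,
        Category.id_comp])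
  refine (isCoker_act M N X).isIso h' _ ?_
  rw [comp_toIhom, map_act_eq M N h, endIhom, toIhom_map]

lemma exists_isCoker_bar {j : C} {P Q : M.bar.toPseudo.obj j} (x : P ⟶ Q) :
    ∃ (K : M.bar.toPseudo.obj j) (π : Q ⟶ K), IsCoker (fun _ : Fin 1 => x) π :=
  ProjAb.exists_isCoker (k := k) (𝒜 := M.toPseudo.obj j) x

/-- The preimage of `X` is its evaluation `X N` with the two actions of `[N, N]` made equal, that
is, `X` tensored with `N` over `[N, N]`. -/
instance ihomMod_essSurj (j : C) : (ihomMod M N j).EssSurj where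
  mem_essImage X := by
    obtain ⟨K, π, h⟩ := exists_isCoker_bar M (endAct M N X.X - (evBar M N j).map X.act)
    have := isIso_toIhom M N h
    exact ⟨K, ⟨(RightMod.isoMk (M := X) (N := (ihomMod M N j).obj K) (@asIso _ _ _ _ (toIhom π) this)
      (toIhom_act M N (map_act_eq M N h))).symm⟩⟩

/-- An object is the quotient of `[N, P] N` by `[N, N]`. -/
lemma isCoker_coev {j : C} (hgen : ∀ Y : M.toPseudo.obj j,
    IsSummandOfSum (fun Z => ∃ F : i ⟶ j, Z = (M.toPseudo.map F).toFunctor.obj N) Y)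
    (P : M.bar.toPseudo.obj j) :
    IsCoker (fun _ : Fin 1 => endAct M N ((ihom M N j).obj P) -
      (evBar M N j).map (ihomAct M N P)) (coev M N P) := by
  obtain ⟨K, π, h⟩ := exists_isCoker_bar M (endAct M N ((ihom M N j).obj P) -
      (evBar M N j).map (ihomAct M N P))
  have : IsIso (toIhom π) := isIso_toIhom M N (X := (ihomMod M N j).obj P) h
  -- The counit factors through the quotient `K` by a morphism `c`; `[N, c]` is a one-sided inverse
  -- of the isomorphism `toIhom π`, so it is invertible, and `[N, -]` reflects this.
  obtain ⟨c, hc⟩ := h.desc (coev M N P) (fun _ => by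
    rw [Preadditive.sub_comp, map_ihomAct_coev, sub_self])
  have h' : toIhom π ≫ (ihom M N j).map c = 𝟙 _ := by
    rw [toIhom_map, hc]
    apply ihom_hom_ext
    rw [map_toIhom_coev, CategoryTheory.Functor.map_id, Category.id_comp]
  have h₁ : IsIso (toIhom π ≫ (ihom M N j).map c) := by
    rw [h']
    infer_instance
  have h₂ : IsIso ((ihom M N j).map c) := IsIso.of_isIso_comp_left (toIhom π) _
  have := isIso_of_isIso_ihom M N hgen c
  rw [← hc]
  exact h.comp_iso c

/-- Linearity of `x` says that its evaluation followed by the counit of `Q` equalizes the two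
actions, so it descends along the counit of `P`, which is their cokernel. -/
lemma exists_ihom_map_eq {j : C} (hgen : ∀ Y : M.toPseudo.obj j,
    IsSummandOfSum (fun Z => ∃ F : i ⟶ j, Z = (M.toPseudo.map F).toFunctor.obj N) Y)
    {P Q : M.bar.toPseudo.obj j}
    (x : (ihom M N j).obj P ⟶ (ihom M N j).obj Q)
    (hx : iEnd M N ◁ x ≫ ihomAct M N Q = ihomAct M N P ≫ x) :
    ∃ p : P ⟶ Q, (ihom M N j).map p = x := by
  obtain ⟨p, hp⟩ := (isCoker_coev M N hgen P).desc ((evBar M N j).map x ≫ coev M N Q) (fun _ => by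
    rw [Preadditive.sub_comp, sub_eq_zero, ← Functor.map_comp_assoc, ← hx, Functor.map_comp,
      Category.assoc, map_ihomAct_coev, reassoc_of% @endAct_naturality])
  refine ⟨p, ihom_hom_ext ?_⟩
  rw [coev_naturality, hp]

lemma ihomMod_isEquivalence {j : C} (hgen : ∀ Y : M.toPseudo.obj j,
    IsSummandOfSum (fun Z => ∃ F : i ⟶ j, Z = (M.toPseudo.map F).toFunctor.obj N) Y) :
    (ihomMod M N j).IsEquivalence where
  faithful := ⟨fun {P Q p q} h => by
    have h' : (ihom M N j).map p = (ihom M N j).map q := congrArg RightMod.Hom.val h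
    have := (isCoker_coev M N hgen P).epi
    rw [← cancel_epi (coev M N P), ← coev_naturality, h', coev_naturality]⟩
  full := ⟨fun {P Q} x => by
    obtain ⟨p, hp⟩ := exists_ihom_map_eq M N hgen (RightMod.Hom.val x) (RightMod.Hom.comm x)
    exact ⟨p, RightMod.hom_ext hp⟩⟩

end InternalHomEquivalence

/-! ### Corestriction of strong transformations to full sub-pseudofunctors. -/

namespace CatAction

open scoped Pseudofunctor.StrongTrans

variable {C : Type u} [Bicategory.{w, v} C] {T T' : Pseudofunctor C Cat.{v₁, u₁}} (θ : T ⟶ T')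

/-- The components of the structure isomorphisms of a strong transformation. -/
def strIso {a b : C} (f : a ⟶ b) (X : T.obj a) :
    (θ.app b).toFunctor.obj ((fn T f).obj X) ≅ (fn T' f).obj ((θ.app a).toFunctor.obj X) :=
  (Cat.Hom.toNatIso (θ.naturality f)).app X

lemma strIso_naturality {a b : C} (f : a ⟶ b) {X Y : T.obj a} (x : X ⟶ Y) :
    (θ.app b).toFunctor.map ((fn T f).map x) ≫ (strIso θ f Y).hom =
      (strIso θ f X).hom ≫ (fn T' f).map ((θ.app a).toFunctor.map x) :=
  (θ.naturality f).hom.toNatTrans.naturality x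

lemma strIso_naturality₂ {a b : C} {f g : a ⟶ b} (η : f ⟶ g) (X : T.obj a) :
    (θ.app b).toFunctor.map (nt T η X) ≫ (strIso θ g X).hom =
      (strIso θ f X).hom ≫ nt T' η ((θ.app a).toFunctor.obj X) :=
  congrArg (fun t => t.toNatTrans.app X) (θ.naturality_naturality η)

lemma strIso_id {a : C} (X : T.obj a) :
    (strIso θ (𝟙 a) X).hom ≫ (unt T' ((θ.app a).toFunctor.obj X)).hom =
      (θ.app a).toFunctor.map (unt T X).hom := by
  refine (congrArg (fun t => t.toNatTrans.app X) (θ.naturality_id a)).trans ?_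
  change (θ.app a).toFunctor.map (unt T X).hom ≫ 𝟙 _ ≫ 𝟙 _ = _
  rw [Category.comp_id, Category.comp_id]

lemma strIso_comp {a b c : C} (f : a ⟶ b) (g : b ⟶ c) (X : T.obj a) :
    (strIso θ (f ≫ g) X).hom ≫ (cmp T' f g ((θ.app a).toFunctor.obj X)).hom =
      (θ.app c).toFunctor.map (cmp T f g X).hom ≫ (strIso θ g ((fn T f).obj X)).hom ≫
        (fn T' g).map (strIso θ f X).hom := by
  refine (congrArg (fun t => t.toNatTrans.app X) (θ.naturality_comp f g)).trans ?_
  change (θ.app c).toFunctor.map (cmp T f g X).hom ≫ 𝟙 _ ≫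
    (strIso θ g ((fn T f).obj X)).hom ≫ 𝟙 _ ≫ (fn T' g).map (strIso θ f X).hom ≫ 𝟙 _ = _
  simp only [Category.id_comp, Category.comp_id]

variable (P : T'.ObjectProperty) [P.IsClosedUnderMapObj]
  (hθ : ∀ (a : C) (X : T.obj a), P.prop a ((θ.app a).toFunctor.obj X))

/-- The corestriction of a strong transformation to a full sub-pseudofunctor. -/
def liftFull : T ⟶ P.fullsubcategory :=
  strongTransMk (T' := P.fullsubcategory)
    (fun a => (P.prop a).lift (θ.app a).toFunctor (hθ a))
    (fun {_ b} f X => (P.prop b).isoMk (X := ⟨_, hθ b ((fn T f).obj X)⟩)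
      (Y := ⟨_, P.map_obj (hθ _ X) f⟩) (strIso θ f X))
    (fun {_ _} f {_ _} x => ObjectProperty.hom_ext _ (strIso_naturality θ f x))
    (fun η X => ObjectProperty.hom_ext _ (strIso_naturality₂ θ η X))
    (fun X => ObjectProperty.hom_ext _ (strIso_id θ X))
    (fun f g X => ObjectProperty.hom_ext _ (strIso_comp θ f g X))

/-- A strong transformation factors through its corestriction. -/
def liftFullι : liftFull θ P hθ ≫ P.ι ≅ θ :=
  Pseudofunctor.StrongTrans.isoMk
    (fun a => Cat.Hom.isoMk (NatIso.ofComponents (F := ((liftFull θ P hθ ≫ P.ι).app a).toFunctor)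
      (G := (θ.app a).toFunctor) (fun X => Iso.refl _)
      (fun x => (Category.comp_id _).trans (Category.id_comp _).symm)))
    (fun {a b} f => by
      ext X
      change 𝟙 _ ≫ (strIso θ f X).hom =
        (𝟙 _ ≫ (strIso θ f X).hom ≫ 𝟙 _ ≫ 𝟙 _ ≫ 𝟙 _) ≫ (fn T' f).map (𝟙 _)
      simp only [Category.id_comp, Category.comp_id, CategoryTheory.Functor.map_id])

end CatAction


/-! ### Projective modules and restriction of the equivalence. -/

section ProjectiveModules

open scoped Pseudofunctor.StrongTrans

variable {k : Type uk} [Field k] {C : Type u} [Bicategory.{w, v} C] [PreadditiveBicategory C]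
  [LinearBicategory k C] (M : TwoRep k C) {i : C} (N : M.toPseudo.obj i)
  [H : ∀ j, (evBar M N j).IsLeftAdjoint]

lemma projective_embObj {j : C} (Z : M.toPseudo.obj j) : Projective (embObj M Z) :=
  ProjAb.projective_emb (k := k) Z

lemma projective_ihomMod_iff {j : C} [(ihomMod M N j).IsEquivalence] (P : M.bar.toPseudo.obj j) :
    Projective ((ihomMod M N j).obj P) ↔ Projective P :=
  (ihomMod M N j).asEquivalence.map_projective_iff P

/-- A preimage of `Y` in `M.bar` is again projective, hence embedded up to isomorphism because
idempotents split. -/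
lemma exists_iso_of_projective {j : C} [IsIdempotentComplete (M.toPseudo.obj j)]
    [(ihomMod M N j).IsEquivalence] (Y : RightMod (iEnd M N) (⟨j⟩ : AbBicat k C)) (hY : Projective Y) :
    ∃ Z : M.toPseudo.obj j, Nonempty ((ihomMod M N j).obj (embObj M Z) ≅ Y) := by
  have e := (ihomMod M N j).objObjPreimageIso Y
  have : Projective ((ihomMod M N j).objPreimage Y) :=
    (projective_ihomMod_iff M N _).1 (Projective.of_iso e.symm hY)
  obtain ⟨Z, ⟨e'⟩⟩ := @ProjAb.exists_iso_emb_of_projective k _ (M.toPseudo.obj j) _ _ _ _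
    ((ihomMod M N j).objPreimage Y) this
  exact ⟨Z, ⟨((ihomMod M N j).mapIso e').symm ≪≫ e⟩⟩

variable [hiso : ∀ {j l : C} (f : j ⟶ l) P, IsIso (ihomStr M N f P)]

lemma projMod_isClosedUnderMapObj (hM : ∀ j, IsIdempotentComplete (M.toPseudo.obj j))
    (hE : ∀ j, (ihomMod M N j).IsEquivalence) : (projMod (iEnd M N)).IsClosedUnderMapObj where
  map_obj := by
    intro j l Y (hY : Projective Y) f
    have := hM j
    have := hE j
    have := hE l
    obtain ⟨Z, ⟨e⟩⟩ := exists_iso_of_projective M N Y hY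
    -- With `Y ≅ [N, Z]` one has `f Y ≅ [N, f Z]`, and the componentwise action keeps `f Z`
    -- embedded.
    have e' : (fn M.bar.toPseudo f).obj (embObj M Z) ≅ embObj M ((fn M.toPseudo f).obj Z) :=
      ProjAb.mapEmbIso (k := k) (fn M.toPseudo f) Z
    exact Projective.of_iso
      (((ihomMod M N l).mapIso e').symm ≪≫ (ihomModStr M N f (embObj M Z)).symm ≪≫
        (fn (modRep (iEnd M N)).toPseudo f).mapIso e)
      ((projective_ihomMod_iff M N _).2 (projective_embObj M _))

/-- The internal hom as an equivalence of `2`-representations. -/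
noncomputable def ihomEquivalence (hE : ∀ j, (ihomMod M N j).IsEquivalence) :
    TwoRep.Equivalence M.bar (modRep (iEnd M N)) where
  trans := ihomTrans M N
  additive := ihomMod_additive M N
  linear := ihomMod_linear M N
  isEquivalence := hE

/-- The restriction of the internal hom to the original `2`-representation. -/
noncomputable def ihomProjEquivalence (hM : ∀ j, IsIdempotentComplete (M.toPseudo.obj j))
    (hE : ∀ j, (ihomMod M N j).IsEquivalence) [(projMod (iEnd M N)).IsClosedUnderMapObj] :
    TwoRep.Equivalence M ((modRep (iEnd M N)).full (projMod (iEnd M N))) where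
  trans := liftFull (M.embBar ≫ ihomTrans M N) (projMod (iEnd M N)) (fun j Z => by
    have := hE j
    exact (projective_ihomMod_iff M N _).2 (projective_embObj M Z))
  additive j := ⟨fun {X Y x y} => ObjectProperty.hom_ext _
    ((ihomMod_additive M N j).map_add (f := ProjAb.embMap k x) (g := ProjAb.embMap k y))⟩
  linear j := ⟨fun {X Y} x t => ObjectProperty.hom_ext _
    ((ihomMod_linear M N j).map_smul (ProjAb.embMap k x) t)⟩
  isEquivalence j := by
    have := hE j
    exact
    { faithful := ⟨fun {X Y x y} h => by
        have h' : (ihomMod M N j).map (X := embObj M X) (Y := embObj M Y) (ProjAb.embMap k x) =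
          (ihomMod M N j).map (ProjAb.embMap k y) := congrArg (fun t => t.hom) h
        exact ProjAb.embMap_injective ((ihomMod M N j).map_injective h')⟩
      full := ⟨fun {X Y} x => by
        obtain ⟨y, hy⟩ := (ihomMod M N j).map_surjective (X := embObj M X) (Y := embObj M Y) x.hom
        obtain ⟨z, rfl⟩ := ProjAb.embMap_surjective (k := k) y
        exact ⟨z, ObjectProperty.hom_ext _ hy⟩⟩
      essSurj := ⟨fun Y => by
        have := hM j
        have hY : Projective (C := RightMod (iEnd M N) (⟨j⟩ : AbBicat k C)) Y.obj := Y.property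
        obtain ⟨Z, ⟨e⟩⟩ := exists_iso_of_projective M N (j := j) Y.obj hY
        exact ⟨Z, ⟨((projMod (iEnd M N)).prop j).isoMk e⟩⟩⟩ }

end ProjectiveModules

end FinTwoRep


/-! ### The main theorem. -/

theorem corollary4p6 {k : Type uk} [Field k] [IsAlgClosed k]
    {C : Type u} [Bicategory.{w, v} C] [PreadditiveBicategory C] [LinearBicategory k C]
    [IsFinitaryBicategory k C] (S : FiatStructure k C)
    (M : TwoRep k C) (hM : M.IsTransitive)
    (i : C) (N : M.toPseudo.obj i) (hN : ¬ IsZero N) :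
    ∃ (A : (⟨i⟩ : AbBicat k C) ⟶ ⟨i⟩) (_ : MonObj A)
      (Φ : TwoRep.Equivalence M.bar (modRep A))
      (_ : (projMod A).IsClosedUnderMapObj)
      (Ψ : TwoRep.Equivalence M ((modRep A).full (projMod A))),
      Nonempty (Ψ.trans ≫ (projMod A).ι ≅ M.embBar ≫ Φ.trans) ∧
      Nonempty ((Φ.trans.app i).toFunctor.obj (ProjAb.emb k N) ≅ RightMod.regular A) := by
  -- Finitariness gives the internal hom, the fiat structure its compatibility with the action, and
  -- transitivity the generation by `N` needed for an equivalence.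
  have H : ∀ j, (evBar M N j).IsLeftAdjoint := fun j =>
    have := IsFinitaryBicategory.finitary_hom (k := k) i j
    ProjAb.mapFunctor_isLeftAdjoint (ev M N j) (hM.1 j).finiteDimensional_hom
  have hiso : ∀ {j l : C} (f : j ⟶ l) P, IsIso (ihomStr M N f P) := fun f P =>
    isIso_ihomStr_of_fiat M N S f P
  have hE : ∀ j, (ihomMod M N j).IsEquivalence := fun j =>
    ihomMod_isEquivalence M N fun Y => TwoRep.isSummandOfSum_of_gen (hM.gen_eq_top hN Y)
  have hI : ∀ j, IsIdempotentComplete (M.toPseudo.obj j) := fun j => (hM.1 j).isIdempotentComplete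
  have hcl := projMod_isClosedUnderMapObj M N hI hE
  -- The image of `N` is `[N, N]` acting on itself by definition of the multiplication, so the last
  -- isomorphism is an identity.
  exact ⟨iEnd M N, inferInstance, ihomEquivalence M N hE, hcl, ihomProjEquivalence M N hI hE,
    ⟨CatAction.liftFullι _ _ _⟩, ⟨Iso.refl _⟩⟩
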